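/- **Setting.** For each $n$ let $K=K_n\in\mathbb N$ and $0\le q=q_n\le p=p_n\le 1$. In the planted dense subgraph model there is a deterministic or random vertex set $C^*\subset[n]$; given $C^*$, distinct pairs of vertices of the graph $G$ on $[n]$ are joined independently, with probability $p$ if both vertices lie in $C^*$ and with probability $q$ otherwise. Put $$\nu=\log\frac{n-K}{K},\qquad \lambda=\frac{K^2(p-q)^2}{(n-K)q},$$ and let $\log^*x$ be the number of times the logarithm must be applied to $x$ to get a result at most $1$. With $\partial i$ the set of neighbors of $i$ in $G$, the belief propagation messages and beliefs are given by $R^0_{i\to j}=0$ and $$R^{t+1}_{i\to j}=-K(p-q)+\sum_{\ell\in\partial i\setminus\{j\}}\log\frac{e^{R^t_{\ell\to i}-\nu}\,\frac pq+1}{e^{R^t_{\ell\to i}-\nu}+1},\qquad R^{t+1}_{i}=-K(p-q)+\sum_{\ell\in\partial i}\log\frac{e^{R^t_{\ell\to i}-\nu}\,\frac pq+1}{e^{R^t_{\ell\to i}-\nu}+1},$$ and $\hat C$ is a set of $K$ vertices with the largest values of $R_i^{t_f}$ (ties broken in any way). **Theorem.** Let $\lambda>1/e$ be a constant. There are constants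 $\bar t_0\in\mathbb N$ and $c$ depending only on $\lambda$ such that the following holds with $t_f=\bar t_0+\log^*(\nu)+2$. Suppose that, as $n\to\infty$, $n^{1-o(1)}\le K\le o(n)$, $p/q\le M$ for all large $n$ with a constant $M$, $K^2(p-q)^2/((n-K)q)=\lambda$ for all large $n$, and $(np)^{\log^*\nu}=n^{o(1)}$. 1. If $|C^*|=K$ almost surely (for all large $n$), then there is a term $n^{o(1)}$ such that for every $r>0$ there is $\nu(r)$, depending only on $r,\lambda,M$, with $$\mathbb E|C^*\triangle\hat C|\le n^{o(1)}+2Ke^{-\nu r}\qquad\text{whenever }\nu\ge\nu(r).$$ 2. If instead $|C^*|$ is random with $\mathbb P\{||C^*|-K|\ge\sqrt{3K\log n}\}\le n^{-1/2+o(1)}$, then likewise $$\mathbb E|C^*\triangle\hat C|\le n^{1/2+o(1)}+2Ke^{-\nu r}\qquad\text{whenever }\nu\ge\nu(r).$$ 3. In both cases weak recovery is achieved: $\mathbb E|C^*\triangle\hat C|=o(K)$. 4. Running time, counted in unit-cost operations on real and natural numbers (arithmetic, $\exp$, $\log$, comparisons, memory accesses), for a graph given by adjacency lists: an explicit implementation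 of the algorithm (each vertex combines all its incoming messages and subtracts one contribution per neighbor; the $K$ largest beliefs are found by median-of-medians selection) outputs such a set $\hat C$ whenever $K\le n$. It makes at most $c\,(n+|E|)\log^*n$ steps on every graph with $n\ge2$ vertices and edge set $E$. On the random graph $G$ it makes at most $c\,|E(G)|\log^*n$ steps with probability tending to $1$ as $n\to\infty$. -/

import Mathlib

open Filter Topology MeasureTheory Asymptotics

noncomputable section

namespace HiddenCommunity

/-! ### Notation of the model -/

/-- The iterated logarithm `log* x`: how many times the logarithm has to be applied to `x` to get
a result that is at most one. -/
def logStar (x : ℝ) : ℕ := sInf {k : ℕ | Real.log^[k] x ≤ 1}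

/-- `ν = log ((n - K) / K)`. -/
def nu (n K : ℕ) : ℝ := Real.log (((n : ℝ) - K) / K)

/-- The signal to noise ratio `K² (p - q)² / ((n - K) q)`. -/
def snr (n K : ℕ) (p q : ℝ) : ℝ := (K : ℝ) ^ 2 * (p - q) ^ 2 / (((n : ℝ) - K) * q)

/-- `f n = n^{o(1)}`. -/
def EqNPowLittleO (f : ℕ → ℝ) : Prop :=
  ∃ ε : ℕ → ℝ, Tendsto ε atTop (𝓝 0) ∧ ∀ᶠ n : ℕ in atTop, f n = (n : ℝ) ^ ε n

/-- The asymptotic regime: `q ≤ p` are probabilities, `p / q` is eventually at most `M`,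
`n^{1 - o(1)} ≤ K = o(n)`, and the signal to noise ratio is the constant `lam`
(if `lam ≠ 0`, the last condition forces `q ≠ 0` for all large `n`). -/
structure SublinearRegime (lam M : ℝ) (K : ℕ → ℕ) (p q : ℕ → ℝ) : Prop where
  probabilities : ∀ n, 0 ≤ q n ∧ q n ≤ p n ∧ p n ≤ 1
  ratio_le : ∀ᶠ n in atTop, p n ≤ M * q n
  size_ge : ∃ ε : ℕ → ℝ, Tendsto ε atTop (𝓝 0) ∧
    ∀ᶠ n : ℕ in atTop, (n : ℝ) ^ (1 - ε n) ≤ (K n : ℝ)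
  size_sublinear : (fun n => (K n : ℝ)) =o[atTop] (fun n : ℕ => (n : ℝ))
  snr_eq : ∀ᶠ n in atTop, snr n (K n) (p n) (q n) = lam

open Classical in
/-- The probability that the pair `e` is an edge when the community is `C`. -/
def edgeProb {n : ℕ} (p q : ℝ) (C : Finset (Fin n)) (e : Sym2 (Fin n)) : ℝ :=
  if ∀ v ∈ e, v ∈ C then p else q

open Classical in
/-- `(Cs, G)` is a planted dense subgraph model with parameters `p`, `q` on the probability space
`(Ω, P)`: `Cs` is a (deterministic or random) set of vertices, and given `Cs = C`, the pairs of
distinct vertices are edges of `G` independently of each other, with probability `p` for a pair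
inside `C` and probability `q` for every other pair. -/
structure IsPlantedDenseSubgraph {n : ℕ} {Ω : Type*} [MeasurableSpace Ω] (P : Measure Ω)
    (p q : ℝ) (Cs : Ω → Finset (Fin n)) (G : Ω → SimpleGraph (Fin n)) : Prop where
  measurable_community : ∀ C, MeasurableSet {ω | Cs ω = C}
  measurable_graph : ∀ H, MeasurableSet {ω | G ω = H}
  law : ∀ (C : Finset (Fin n)) (H : SimpleGraph (Fin n)),
    P.real {ω | Cs ω = C ∧ G ω = H} = P.real {ω | Cs ω = C} *
      ∏ e : Sym2 (Fin n) with ¬ e.IsDiag,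
        if e ∈ H.edgeSet then edgeProb p q C e else 1 - edgeProb p q C e

/-! ### Belief propagation -/

/-- The contribution of an incoming message `x`: `log ((e^{x - ν} (p / q) + 1) / (e^{x - ν} + 1))`. -/
def contribution (n K : ℕ) (p q x : ℝ) : ℝ :=
  Real.log ((Real.exp (x - nu n K) * (p / q) + 1) / (Real.exp (x - nu n K) + 1))

open Classical in
/-- The messages `R^t_{i → j}`. -/
def message {n : ℕ} (H : SimpleGraph (Fin n)) (K : ℕ) (p q : ℝ) : ℕ → Fin n → Fin n → ℝ
  | 0, _, _ => 0
  | t + 1, i, j => -(K * (p - q)) +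
      ∑ l : Fin n with H.Adj i l ∧ l ≠ j, contribution n K p q (message H K p q t l i)

open Classical in
/-- The beliefs `R^t_i` (for `t ≥ 1`; the value at `t = 0` is a dummy). -/
def belief {n : ℕ} (H : SimpleGraph (Fin n)) (K : ℕ) (p q : ℝ) : ℕ → Fin n → ℝ
  | 0, _ => 0
  | t + 1, i => -(K * (p - q)) +
      ∑ l : Fin n with H.Adj i l, contribution n K p q (message H K p q t l i)

/-- `S` is a set of `K` indices with largest values of `R` (ties are broken arbitrarily). -/
def IsTopSet {n : ℕ} (R : Fin n → ℝ) (K : ℕ) (S : Finset (Fin n)) : Prop :=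
  S.card = K ∧ ∀ i ∈ S, ∀ j ∉ S, R j ≤ R i

/-- The number of iterations `t_f = t₀ + log* ν + 2`. -/
def iterations (t0 n K : ℕ) : ℕ := t0 + logStar (nu n K) + 2

/-- The expected number of misclassified vertices `E |C* △ Ĉ|`. -/
def expectedError {n : ℕ} {Ω : Type*} [MeasurableSpace Ω] (P : Measure Ω)
    (Cs Chat : Ω → Finset (Fin n)) : ℝ :=
  ∫ ω, ((symmDiff (Cs ω) (Chat ω)).card : ℝ) ∂P

/-! ### Step counting

The running time is counted in the unit cost model of a random access machine that computes with
real numbers and natural numbers: each arithmetic operation (including `exp` and `log`), each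
comparison, each access to a memory cell, and each list operation on a single cell (testing for the
empty list, together with reading the head and the tail; adding one cell in front) is one step. -/

/-- A value together with the number of steps that were made to compute it. -/
structure Timed (α : Type) where
  val : α
  time : ℕ

instance : Monad Timed where
  pure a := ⟨a, 0⟩
  bind x f := ⟨(f x.val).val, x.time + (f x.val).time⟩

/-- A single step with result `a`. In the programs below, `a` is always written as one primitive
operation on values that have already been computed. -/
def step {α : Type} (a : α) : Timed α := ⟨a, 1⟩

/-- A single step without a result, such as moving on to the next cell of a list. -/
def tick : Timed Unit := step ()

/-- Run `body` on the entries of a list one after the other, passing on the state `s`. -/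
def forEach {α σ : Type} (body : σ → α → Timed σ) : List α → σ → Timed σ
  | [], s => step s
  | a :: l, s => do
    tick
    let s' ← body s a
    forEach body l s'

/-- Run `body` a given number of times, passing on the state `s`. -/
def repeatTimes {σ : Type} (body : σ → Timed σ) : ℕ → σ → Timed σ
  | 0, s => step s
  | t + 1, s => do
    tick
    let s' ← body s
    repeatTimes body t s'

/-! #### Linear time selection (median of medians) -/

section Selection

variable {R α : Type} [LinearOrder R]

/-- The length of a list. -/
def lengthT {β : Type} (l : List β) : Timed ℕ :=
  forEach (fun k _ => step (k + 1)) l 0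

/-- Append two lists. -/
def appendT {β : Type} : List β → List β → Timed (List β)
  | [], l => step l
  | a :: k, l => do
    tick
    let r ← appendT k l
    step (a :: r)

/-- The first `k` entries of a list. -/
def takeT {β : Type} : ℕ → List β → Timed (List β)
  | 0, _ => step []
  | _ + 1, [] => step []
  | k + 1, a :: l => do
    tick
    tick
    let r ← takeT k l
    step (a :: r)

/-- Insert an entry into a list that is in decreasing order with respect to the keys. -/
def insertT (x : R × α) : List (R × α) → Timed (List (R × α))
  | [] => step [x]
  | y :: l => do
    tick
    if ← step (decide (y.1 ≤ x.1)) then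
      let r ← step (y :: l)
      step (x :: r)
    else
      let r ← insertT x l
      step (y :: r)

/-- Insertion sort into decreasing order with respect to the keys; used for short lists only. -/
def sortT (l : List (R × α)) : Timed (List (R × α)) :=
  forEach (fun s x => insertT x s) l []

/-- The medians of the consecutive blocks of five entries; an incomplete last block is ignored. -/
def mediansT : List (R × α) → Timed (List (R × α))
  | a :: b :: c :: d :: e :: l => do
    tick
    let s ← sortT [a, b, c, d, e]
    let ms ← mediansT l
    match s with
    | _ :: _ :: m :: _ => step (m :: ms)
    | _ => step ms
  | _ => step []

/-- The smallest key of a list, and `m` if all keys are larger than `m`. -/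
def minKeyT (m : R) (l : List (R × α)) : Timed R :=
  forEach (fun m x => do
    if ← step (decide (x.1 < m)) then step x.1 else step m) l m

/-- Split a list into the entries whose keys are larger than, equal to, and smaller than `m`. -/
def splitT (m : R) (l : List (R × α)) :
    Timed (List (R × α) × List (R × α) × List (R × α)) :=
  forEach (fun s x => do
    if ← step (decide (m < x.1)) then
      step (x :: s.1, s.2.1, s.2.2)
    else if ← step (decide (x.1 < m)) then
      step (s.1, s.2.1, x :: s.2.2)
    else
      step (s.1, x :: s.2.1, s.2.2)) l ([], [], [])

/-- Select `k` entries with largest keys (all entries if there are at most `k`). The first argument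
bounds the depth of the recursion; it is never exhausted if it exceeds the length of the list. -/
def selectT : ℕ → ℕ → List (R × α) → Timed (List (R × α))
  | 0, _, l => step l
  | fuel + 1, k, l => do
    let len ← lengthT l
    if ← step (decide (len ≤ k)) then
      step l
    else if ← step (decide (len < 5)) then
      let s ← sortT l
      takeT k s
    else
      let ms ← mediansT l
      let nm ← lengthT ms
      let h ← step (nm + 1)
      let h ← step (h / 2)
      let upper ← selectT fuel h ms
      match upper with
      | [] => step []
      | x :: xs =>
        let pivot ← minKeyT x.1 xs
        let s ← splitT pivot l
        let a ← lengthT s.1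
        if ← step (decide (k ≤ a)) then
          selectT fuel k s.1
        else
          let k ← step (k - a)
          let b ← lengthT s.2.1
          if ← step (decide (k ≤ b)) then
            let e ← takeT k s.2.1
            appendT s.1 e
          else
            let k ← step (k - b)
            let r ← selectT fuel k s.2.2
            let r ← appendT s.2.1 r
            appendT s.1 r

end Selection

/-! #### The belief propagation program -/

open Classical in
/-- The adjacency lists of a graph, which are the form in which the program gets the graph. -/
def adjacencyList {n : ℕ} (H : SimpleGraph (Fin n)) (i : Fin n) : List (Fin n) :=
  (List.finRange n).filter (fun j => H.Adj i j)

/-- An array of reals indexed by ordered pairs of vertices. -/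
abbrev Memory (n : ℕ) : Type := Fin n × Fin n → ℝ

/-- The constants `-K (p - q)`, `p / q` and `ν`. -/
structure Constants where
  offset : ℝ
  ratio : ℝ
  shift : ℝ

/-- Compute the constants. -/
def constantsT (n K : ℕ) (p q : ℝ) : Timed Constants := do
  let a ← step (p - q)
  let b ← step ((K : ℝ) * a)
  let offset ← step (-b)
  let ratio ← step (p / q)
  let c ← step ((n : ℝ) - (K : ℝ))
  let d ← step (c / (K : ℝ))
  let shift ← step (Real.log d)
  step ⟨offset, ratio, shift⟩

/-- Compute the contribution of an incoming message `x`. -/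
def contributionT (c : Constants) (x : ℝ) : Timed ℝ := do
  let d ← step (x - c.shift)
  let e ← step (Real.exp d)
  let f ← step (e * c.ratio)
  let a ← step (f + 1)
  let b ← step (e + 1)
  let r ← step (a / b)
  step (Real.log r)

/-- Combine all messages in `m` that are directed to `i`. -/
def beliefT {n : ℕ} (adj : Fin n → List (Fin n)) (c : Constants) (m : Memory n) (i : Fin n) :
    Timed ℝ := do
  let l ← step (adj i)
  forEach (fun s j => do
    let x ← step (m (j, i))
    let y ← contributionT c x
    step (s + y)) l c.offset

/-- Compute the new messages of `i` from the messages in `m` and write them to `w`: first combine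
all incoming messages, then subtract the contribution of each neighbor in turn. -/
def sendT {n : ℕ} (adj : Fin n → List (Fin n)) (c : Constants) (m w : Memory n) (i : Fin n) :
    Timed (Memory n) := do
  let b ← beliefT adj c m i
  let l ← step (adj i)
  forEach (fun w j => do
    let x ← step (m (j, i))
    let y ← contributionT c x
    let z ← step (b - y)
    step (Function.update w (i, j) z)) l w

/-- One iteration for all vertices. The current messages are in the first array; the new messages
are written to the second array, and the two arrays exchange their roles. -/
def iterationT {n : ℕ} (adj : Fin n → List (Fin n)) (c : Constants) (s : Memory n × Memory n) :
    Timed (Memory n × Memory n) := do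
  let w ← forEach (fun w i => sendT adj c s.1 w i) (List.finRange n) s.2
  step (w, s.1)

/-- Write the initial messages. -/
def initializeT {n : ℕ} (adj : Fin n → List (Fin n)) (m : Memory n) : Timed (Memory n) :=
  forEach (fun m i => do
    let l ← step (adj i)
    forEach (fun m j => step (Function.update m (i, j) 0)) l m) (List.finRange n) m

/-- Belief propagation for weak recovery: initialize the messages, run `t - 1` iterations, compute
the beliefs `R^t_i` of all vertices, and return `K` vertices with the largest beliefs. The result
does not depend on the contents `m₁`, `m₂` of the memory at the start. -/
def beliefPropagation {n : ℕ} (K : ℕ) (p q : ℝ) (adj : Fin n → List (Fin n)) (t : ℕ)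
    (m₁ m₂ : Memory n) : Timed (List (Fin n)) := do
  let c ← constantsT n K p q
  let m ← initializeT adj m₁
  let t' ← step (t - 1)
  let s ← repeatTimes (iterationT adj c) t' (m, m₂)
  let bs ← forEach (fun bs i => do
    let b ← beliefT adj c s.1 i
    step ((b, i) :: bs)) (List.finRange n) []
  let top ← selectT (n + 1) K bs
  forEach (fun out x => step (x.2 :: out)) top []

/-- A run of the program on a graph, with `t` iterations, started with empty memory. -/
def runBP {n : ℕ} (H : SimpleGraph (Fin n)) (K : ℕ) (p q : ℝ) (t : ℕ) : Timed (List (Fin n)) :=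
  beliefPropagation K p q (adjacencyList H) t (fun _ => 0) (fun _ => 0)

end HiddenCommunity

end

open HiddenCommunity

noncomputable section

namespace HiddenCommunity

open scoped ENNReal

/-! ### Rules for timed programs -/

section TimedRules

variable {α β σ : Type}

/-! On the idealized Poisson tree, a message is a log likelihood ratio: its laws at vertices inside
and outside the community differ by the density e^x (`law_true`). The law after t + 1 rounds is
compound Poisson over the law after t rounds. It is handled through `expOp`, the exponential series
of convolution operators, whose exponential moments are explicit (`expOp_exp`). Let r be the
likelihood ratio of one incoming message and b_t the signal strength. The identity `mean_sq` says
that (r - 1)² integrates to λ b_t. Hence E₀ e^{2Λ} = e^{λ b_t} exactly, E₀ e^{3Λ} is bounded in the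
same way, and the Bhattacharyya coefficient E₀ e^{Λ/2} is at most e^{-c b_t} (`avg_exp_two`,
`avg_exp_three`, `avg_exp_half`).

These moments bound b_{t+1} from below: by nearly e^{λ b_t} while b_t is below a small multiple of ν
(`le_signal_succ`), and by an exponential in ν once b_t is above it (`le_signal_succ_of_le`). Since
e^{λx} ≥ eλx and eλ > 1, the signal first grows geometrically. After a constant number of steps it
climbs like a tower of exponentials, which reaches order ν within log* ν steps; one further step
makes it exponentially large in ν. The last round turns this into a Bhattacharyya coefficient below
e^{-rν} for every r (`exists_growth`, `exists_small_coefficient`).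

The passage to the graph is a one-sided domination, not a coupling. A neighborhood fails to be a
forest with small levels with probability n^{-1+o(1)} for a community of fixed size, and
n^{-1/2+o(1)} for random size. On the good event, the expectation of any nonnegative function of the
belief is at most a constant times its expectation on the Poisson tree (`expect_treeValue_le`). For
this, vertices are exposed one at a time: absent edges satisfy 1 - w ≤ e^{-w}, and a sum of
independent optional terms is dominated by the exponential series, because (1 + B) e^A ≤ e^{A+B} for
commuting positive operators (`expOp_add_shiftOp_le`, `sum_powerset_productAvg_le`).

Thresholding the beliefs at ν and Markov's inequality for e^{±Λ/2} bound the expected number of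
errors, and the K largest beliefs do at most twice as badly, up to the deviation of |C*| from K
(`IsTopSet.card_symmDiff_le`).

For the running time, a round costs O(n + |E|) because all messages of a vertex are obtained from
its belief by one subtraction each, selection is linear by median of medians (`selectT_spec`), and
there are O(log* n) rounds. The random graph has at least n edges with high probability, as nq → ∞.
-/

@[simp] theorem Timed.bind_val (x : Timed α) (f : α → Timed β) :
    (x >>= f).val = (f x.val).val := rfl

@[simp] theorem Timed.bind_time (x : Timed α) (f : α → Timed β) :
    (x >>= f).time = x.time + (f x.val).time := rfl

@[simp] theorem step_val (a : α) : (step a).val = a := rfl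

@[simp] theorem step_time (a : α) : (step a).time = 1 := rfl

@[simp] theorem tick_time : tick.time = 1 := rfl

@[simp] theorem forEach_nil (body : σ → α → Timed σ) (s : σ) : forEach body [] s = step s := rfl

theorem forEach_cons_val (body : σ → α → Timed σ) (a : α) (l : List α) (s : σ) :
    (forEach body (a :: l) s).val = (forEach body l (body s a).val).val := rfl

theorem forEach_cons_time (body : σ → α → Timed σ) (a : α) (l : List α) (s : σ) :
    (forEach body (a :: l) s).time
      = 1 + ((body s a).time + (forEach body l (body s a).val).time) := rfl

theorem forEach_val (body : σ → α → Timed σ) (l : List α) (s : σ) :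
    (forEach body l s).val = l.foldl (fun s a => (body s a).val) s := by
  induction l generalizing s with
  | nil => rfl
  | cons a l ih => rw [forEach_cons_val, ih, List.foldl_cons]

theorem forEach_time_le (body : σ → α → Timed σ) (b : α → ℕ) (l : List α) (s : σ)
    (h : ∀ s, ∀ a ∈ l, (body s a).time ≤ b a) :
    (forEach body l s).time ≤ (l.map b).sum + l.length + 1 := by
  induction l generalizing s with
  | nil => simp
  | cons a l ih =>
    have h1 := h s a (by simp)
    have h2 := ih (body s a).val (fun s a ha => h s a (by simp [ha]))
    rw [forEach_cons_time]
    simp only [List.map_cons, List.sum_cons, List.length_cons]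
    omega

theorem forEach_time_le_mul (body : σ → α → Timed σ) (b : ℕ) (l : List α) (s : σ)
    (h : ∀ s, ∀ a ∈ l, (body s a).time ≤ b) :
    (forEach body l s).time ≤ (b + 1) * l.length + 1 := by
  have := forEach_time_le body (fun _ => b) l s h
  simp only [List.map_const', List.sum_replicate, smul_eq_mul] at this
  linarith [add_mul b 1 l.length, mul_comm b l.length]

theorem repeatTimes_succ_val (body : σ → Timed σ) (t : ℕ) (s : σ) :
    (repeatTimes body (t + 1) s).val = (repeatTimes body t (body s).val).val := rfl

theorem repeatTimes_succ_time (body : σ → Timed σ) (t : ℕ) (s : σ) :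
    (repeatTimes body (t + 1) s).time
      = 1 + ((body s).time + (repeatTimes body t (body s).val).time) := rfl

theorem repeatTimes_val (body : σ → Timed σ) (t : ℕ) (s : σ) :
    (repeatTimes body t s).val = (fun s => (body s).val)^[t] s := by
  induction t generalizing s with
  | zero => rfl
  | succ t ih => rw [repeatTimes_succ_val, ih, Function.iterate_succ_apply]

theorem repeatTimes_time_le (body : σ → Timed σ) (b t : ℕ) (s : σ)
    (h : ∀ s, (body s).time ≤ b) : (repeatTimes body t s).time ≤ (b + 1) * t + 1 := by
  induction t generalizing s with
  | zero => simp [repeatTimes]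
  | succ t ih =>
    have h1 := h s
    have h2 := ih (body s).val
    rw [repeatTimes_succ_time]
    linarith [mul_add (b + 1) t 1]

end TimedRules

/-! ### Selection -/

section SelectionSpec

variable {R α β : Type} [LinearOrder R]

theorem lengthT_val (l : List β) : (lengthT l).val = l.length := by
  have : ∀ k, (forEach (fun k (_ : β) => step (k + 1)) l k).val = k + l.length := by
    induction l with
    | nil => simp
    | cons a l ih => intro k; rw [forEach_cons_val, ih]; simp; omega
  simpa [lengthT] using this 0

theorem lengthT_time (l : List β) : (lengthT l).time ≤ 2 * l.length + 1 :=
  forEach_time_le_mul _ 1 l 0 (by simp)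

theorem appendT_val (k l : List β) : (appendT k l).val = k ++ l := by
  induction k with
  | nil => rfl
  | cons a k ih => simp [appendT, ih]

theorem appendT_time (k l : List β) : (appendT k l).time = 2 * k.length + 1 := by
  induction k with
  | nil => rfl
  | cons a k ih => simp [appendT, ih]; omega

theorem takeT_val (k : ℕ) (l : List β) : (takeT k l).val = l.take k := by
  induction k generalizing l with
  | zero => simp [takeT]
  | succ k ih => cases l <;> simp [takeT, ih]

theorem takeT_time (k : ℕ) (l : List β) : (takeT k l).time ≤ 3 * l.length + 1 := by
  induction k generalizing l with
  | zero => simp [takeT]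
  | succ k ih =>
    cases l with
    | nil => simp [takeT]
    | cons a l => have := ih l; simp [takeT]; omega

/-- The keys are decreasing along the list. -/
def Decreasing (l : List (R × α)) : Prop := l.Pairwise (fun x y => y.1 ≤ x.1)

theorem insertT_perm (x : R × α) (l : List (R × α)) : (insertT x l).val.Perm (x :: l) := by
  induction l with
  | nil => rfl
  | cons y l ih =>
    simp only [insertT, Timed.bind_val, step_val]
    by_cases hyx : y.1 ≤ x.1
    · simp only [hyx, decide_true, if_true]
      rfl
    · simp only [hyx, decide_false, Bool.false_eq_true, if_false]
      exact (List.Perm.cons y ih).trans (List.Perm.swap x y l)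

theorem insertT_decreasing (x : R × α) (l : List (R × α)) (h : Decreasing l) :
    Decreasing (insertT x l).val := by
  unfold Decreasing at *
  induction l with
  | nil => simp [insertT]
  | cons y l ih =>
    rw [List.pairwise_cons] at h
    simp only [insertT, Timed.bind_val, step_val]
    by_cases hyx : y.1 ≤ x.1
    · simp only [hyx, decide_true, if_true, Timed.bind_val, step_val, List.pairwise_cons, List.mem_cons, forall_eq_or_imp]
      exact ⟨⟨trivial, fun z hz => (h.1 z hz).trans hyx⟩, h⟩
    · simp only [hyx, decide_false, Bool.false_eq_true, if_false, Timed.bind_val, step_val, List.pairwise_cons]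
      refine ⟨fun z hz => ?_, ih h.2⟩
      rw [(insertT_perm x l).mem_iff, List.mem_cons] at hz
      rcases hz with rfl | hz
      · exact (not_le.1 hyx).le
      · exact h.1 z hz

theorem insertT_time (x : R × α) (l : List (R × α)) : (insertT x l).time ≤ 3 * l.length + 1 := by
  induction l with
  | nil => simp [insertT]
  | cons y l ih =>
    simp only [insertT, Timed.bind_time, step_time, tick_time, step_val, List.length_cons]
    by_cases hyx : y.1 ≤ x.1
    · simp [hyx]
    · simp [hyx]; omega

/-- Quadratic time suffices, since only lists of at most five entries are sorted. The accumulator is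
arbitrary to make the induction go through. -/
theorem sortT_spec (l s : List (R × α)) (hs : Decreasing s) :
    (forEach (fun s x => insertT x s) l s).val.Perm (l ++ s) ∧
      Decreasing (forEach (fun s x => insertT x s) l s).val ∧
      (forEach (fun s x => insertT x s) l s).time
        ≤ l.length * (3 * (s.length + l.length) + 2) + 1 := by
  induction l generalizing s with
  | nil => simpa using hs
  | cons a l ih =>
    obtain ⟨h1, h2, h3⟩ := ih (insertT a s).val (insertT_decreasing a s hs)
    have hlen : (insertT a s).val.length = s.length + 1 := by
      rw [(insertT_perm a s).length_eq, List.length_cons]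
    rw [forEach_cons_val, forEach_cons_time]
    refine ⟨h1.trans ?_, h2, ?_⟩
    · exact (List.Perm.append_left l (insertT_perm a s)).trans List.perm_middle
    · have := insertT_time a s
      rw [hlen] at h3
      simp only [List.length_cons]
      nlinarith

theorem sortT_perm (l : List (R × α)) : (sortT l).val.Perm l :=
  (List.append_nil l ▸ (sortT_spec l [] List.Pairwise.nil).1 :)

theorem sortT_decreasing (l : List (R × α)) : Decreasing (sortT l).val :=
  (sortT_spec l [] List.Pairwise.nil).2.1

theorem sortT_time (l : List (R × α)) (h : l.length ≤ 5) : (sortT l).time ≤ 86 := by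
  have := (sortT_spec l [] List.Pairwise.nil).2.2
  simp only [List.length_nil, zero_add] at this
  refine this.trans ?_
  have h2 : l.length * (3 * l.length + 2) ≤ 5 * (3 * 5 + 2) := by gcongr
  omega

/-- In a block of five, three keys are at least the median and three are at most the median; hence
the factor 3 in the counts. A block costs 88 steps: at most 86 for sorting, one for entering it and
one for storing its median. -/
theorem mediansT_spec (l : List (R × α)) :
    (mediansT l).time ≤ 88 * (mediansT l).val.length + 1 ∧
    5 * (mediansT l).val.length ≤ l.length ∧
    l.length ≤ 5 * (mediansT l).val.length + 4 ∧
    (∀ x ∈ (mediansT l).val, x ∈ l) ∧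
    (∀ m : R, 3 * (mediansT l).val.countP (fun x => decide (m ≤ x.1))
      ≤ l.countP (fun x => decide (m ≤ x.1))) ∧
    (∀ m : R, 3 * (mediansT l).val.countP (fun x => decide (x.1 ≤ m))
      ≤ l.countP (fun x => decide (x.1 ≤ m))) := by
  induction l using mediansT.induct with
  | case1 a b c d e l ih =>
    obtain ⟨h1, h2, h3, h4, h5, h6⟩ := ih
    have hp := sortT_perm [a, b, c, d, e]
    have hd := sortT_decreasing [a, b, c, d, e]
    have ht := sortT_time [a, b, c, d, e] (by simp)
    have hl := hp.length_eq
    simp only [mediansT, Timed.bind_val, Timed.bind_time, tick_time]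
    generalize (sortT [a, b, c, d, e]).val = s at hp hd hl
    match s, hl with
    | [x1, x2, x3, x4, x5], _ =>
      simp only [Decreasing, List.pairwise_cons, List.mem_cons, forall_eq_or_imp] at hd
      obtain ⟨⟨h12, h13, h14, h15, -⟩, ⟨h23, h24, h25, -⟩, ⟨h34, h35, -⟩, ⟨h45, -⟩, -⟩ := hd
      simp only [step_val, step_time, List.length_cons]
      refine ⟨by omega, by omega, by omega, ?_, ?_, ?_⟩
      · intro x hx
        rcases List.mem_cons.1 hx with rfl | hx
        · have : x ∈ [a, b, c, d, e] := hp.mem_iff.1 (by simp)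
          have := List.mem_append_left l this
          simpa using this
        · have := List.mem_append_right [a, b, c, d, e] (h4 x hx)
          simpa using this
      · intro m
        have hc := hp.countP_eq (fun x => decide (m ≤ x.1))
        have : (a :: b :: c :: d :: e :: l) = [a, b, c, d, e] ++ l := rfl
        rw [this, List.countP_append, ← hc, List.countP_cons]
        have h5 := h5 m
        by_cases hm : m ≤ x3.1
        · simp only [List.countP_cons, hm, hm.trans h13, hm.trans h23, decide_true, if_true]
          omega
        · simp only [hm, decide_false, Bool.false_eq_true, if_false]
          omega
      · intro m
        have hc := hp.countP_eq (fun x => decide (x.1 ≤ m))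
        have : (a :: b :: c :: d :: e :: l) = [a, b, c, d, e] ++ l := rfl
        rw [this, List.countP_append, ← hc, List.countP_cons]
        have h6 := h6 m
        by_cases hm : x3.1 ≤ m
        · simp only [List.countP_cons, hm, h34.trans hm, h35.trans hm, decide_true, if_true]
          omega
        · simp only [hm, decide_false, Bool.false_eq_true, if_false]
          omega
  | case2 l hl =>
    match l, hl with
    | [], _ => simp [mediansT]
    | [_], _ => simp [mediansT]
    | [_, _], _ => simp [mediansT]
    | [_, _, _], _ => simp [mediansT]
    | [_, _, _, _], _ => simp [mediansT]
    | a :: b :: c :: d :: e :: l, hl => exact absurd rfl (hl a b c d e l)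

theorem minKeyT_spec (m : R) (l : List (R × α)) :
    (minKeyT m l).val ≤ m ∧ (∀ x ∈ l, (minKeyT m l).val ≤ x.1) ∧
      ((minKeyT m l).val = m ∨ ∃ x ∈ l, (minKeyT m l).val = x.1) := by
  induction l generalizing m with
  | nil => simp [minKeyT]
  | cons a l ih =>
    by_cases h : a.1 < m
    · have : (minKeyT m (a :: l)).val = (minKeyT a.1 l).val := by
        rw [minKeyT, forEach_cons_val]; simp [h, minKeyT]
      rw [this]
      obtain ⟨h1, h2, h3⟩ := ih a.1
      refine ⟨h1.trans h.le, ?_, Or.inr ?_⟩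
      · intro x hx
        rcases List.mem_cons.1 hx with rfl | hx
        · exact h1
        · exact h2 x hx
      · rcases h3 with h3 | ⟨x, hx, h3⟩
        · exact ⟨a, by simp, h3⟩
        · exact ⟨x, by simp [hx], h3⟩
    · have : (minKeyT m (a :: l)).val = (minKeyT m l).val := by
        rw [minKeyT, forEach_cons_val]; simp [h, minKeyT]
      rw [this]
      obtain ⟨h1, h2, h3⟩ := ih m
      refine ⟨h1, ?_, ?_⟩
      · intro x hx
        rcases List.mem_cons.1 hx with rfl | hx
        · exact h1.trans (not_lt.1 h)
        · exact h2 x hx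
      · rcases h3 with h3 | ⟨x, hx, h3⟩
        · exact Or.inl h3
        · exact Or.inr ⟨x, by simp [hx], h3⟩

theorem minKeyT_time (m : R) (l : List (R × α)) : (minKeyT m l).time ≤ 3 * l.length + 1 := by
  refine forEach_time_le_mul _ 2 l m ?_
  intro s a _
  simp only [Timed.bind_time, step_time, step_val]
  by_cases h : a.1 < s <;> simp [h]

theorem splitT_spec (m : R) (l : List (R × α)) (s : List (R × α) × List (R × α) × List (R × α)) :
    let r := (forEach (fun (s : List (R × α) × List (R × α) × List (R × α)) (x : R × α) => do
      if ← step (decide (m < x.1)) then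
        step (x :: s.1, s.2.1, s.2.2)
      else if ← step (decide (x.1 < m)) then
        step (s.1, s.2.1, x :: s.2.2)
      else
        step (s.1, x :: s.2.1, s.2.2)) l s).val
    r.1.Perm (l.filter (fun x => decide (m < x.1)) ++ s.1) ∧
    r.2.1.Perm (l.filter (fun x => decide (x.1 = m)) ++ s.2.1) ∧
    r.2.2.Perm (l.filter (fun x => decide (x.1 < m)) ++ s.2.2) := by
  induction l generalizing s with
  | nil => simp
  | cons a l ih =>
    simp only [forEach_cons_val]
    rcases lt_trichotomy m a.1 with h | h | h
    · obtain ⟨h1, h2, h3⟩ := ih (a :: s.1, s.2.1, s.2.2)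
      simp only [Timed.bind_val, step_val, h, decide_true, if_true, h.not_gt, h.ne',
        List.filter_cons, decide_false, Bool.false_eq_true, if_false]
      exact ⟨h1.trans List.perm_middle, h2, h3⟩
    · obtain ⟨h1, h2, h3⟩ := ih (s.1, a :: s.2.1, s.2.2)
      simp only [Timed.bind_val, step_val, h, decide_true, if_true, lt_irrefl,
        List.filter_cons, decide_false, Bool.false_eq_true, if_false]
      rw [h] at h1 h2 h3
      exact ⟨h1, h2.trans List.perm_middle, h3⟩
    · obtain ⟨h1, h2, h3⟩ := ih (s.1, s.2.1, a :: s.2.2)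
      simp only [Timed.bind_val, step_val, h, decide_true, if_true, h.not_gt, h.ne,
        List.filter_cons, decide_false, Bool.false_eq_true, if_false]
      exact ⟨h1, h2, h3.trans List.perm_middle⟩

theorem splitT_val (m : R) (l : List (R × α)) :
    (splitT m l).val.1.Perm (l.filter (fun x => decide (m < x.1))) ∧
    (splitT m l).val.2.1.Perm (l.filter (fun x => decide (x.1 = m))) ∧
    (splitT m l).val.2.2.Perm (l.filter (fun x => decide (x.1 < m))) := by
  have := splitT_spec m l ([], [], [])
  simp only [List.append_nil] at this
  exact this

theorem splitT_time (m : R) (l : List (R × α)) : (splitT m l).time ≤ 4 * l.length + 1 := by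
  refine forEach_time_le_mul _ 3 l _ ?_
  intro s a _
  by_cases h : m < a.1 <;> by_cases h' : a.1 < m <;> simp [h, h']

/-- `r` consists of `k` entries of `l` with largest keys (of all entries if there are at most
`k`). -/
def IsSelection (k : ℕ) (l r : List (R × α)) : Prop :=
  r.length = min k l.length ∧ ∃ rest, (r ++ rest).Perm l ∧ ∀ x ∈ r, ∀ y ∈ rest, y.1 ≤ x.1

theorem perm_filter_three (m : R) (l : List (R × α)) :
    (l.filter (fun x => decide (m < x.1)) ++ (l.filter (fun x => decide (x.1 = m)) ++
      l.filter (fun x => decide (x.1 < m)))).Perm l := by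
  induction l with
  | nil => simp
  | cons a l ih =>
    rcases lt_trichotomy m a.1 with h | h | h
    · simp only [List.filter_cons, h, h.not_gt, h.ne', decide_true, decide_false, if_true,
        Bool.false_eq_true, if_false, List.cons_append]
      exact ih.cons a
    · simp only [List.filter_cons, h, lt_irrefl, decide_true, decide_false, if_true,
        Bool.false_eq_true, if_false, List.cons_append]
      rw [h] at ih
      exact List.perm_middle.trans (ih.cons a)
    · simp only [List.filter_cons, h, h.not_gt, h.ne, decide_true, decide_false, if_true,
        Bool.false_eq_true, if_false]
      rw [← List.append_assoc] at ih ⊢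
      exact List.perm_middle.trans (ih.cons a)

theorem IsSelection.of_length_le {k : ℕ} {l : List (R × α)} (h : l.length ≤ k) :
    IsSelection k l l := ⟨by omega, [], by simp, by simp⟩

theorem IsSelection.take_of_decreasing (k : ℕ) {l s : List (R × α)} (hp : s.Perm l)
    (hd : Decreasing s) : IsSelection k l (s.take k) := by
  refine ⟨by rw [List.length_take, hp.length_eq], s.drop k, by rwa [List.take_append_drop], ?_⟩
  rw [Decreasing, ← List.take_append_drop k s, List.pairwise_append] at hd
  exact hd.2.2

variable {m : R} {l A B C : List (R × α)}

/-- This lemma and the next two are the three outcomes of the split at the pivot `m`. In each, every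
discarded entry is compared with a selected one through the pivot or through the recursive
selection. -/
theorem IsSelection.of_large (hA : A.Perm (l.filter (fun x => decide (m < x.1)))) {k : ℕ}
    (hk : k ≤ A.length) {r : List (R × α)} (hr : IsSelection k A r) : IsSelection k l r := by
  obtain ⟨h1, rest, h2, h3⟩ := hr
  have hle : A.length ≤ l.length := by rw [hA.length_eq]; exact List.length_filter_le _ _
  refine ⟨by omega, rest ++ (l.filter (fun x => decide (x.1 = m)) ++
    l.filter (fun x => decide (x.1 < m))), ?_, ?_⟩
  · rw [← List.append_assoc]
    exact ((h2.trans hA).append_right _).trans (perm_filter_three m l)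
  · intro x hx y hy
    have hxA : x ∈ A := h2.mem_iff.1 (List.mem_append_left _ hx)
    have hmx : m < x.1 := by
      have := hA.mem_iff.1 hxA
      simpa using (List.mem_filter.1 this).2
    rw [List.mem_append, List.mem_append, List.mem_filter, List.mem_filter] at hy
    rcases hy with hy | ⟨_, hy⟩ | ⟨_, hy⟩
    · exact h3 x hx y hy
    · have : y.1 = m := by simpa using hy
      exact this.le.trans hmx.le
    · have : y.1 < m := by simpa using hy
      exact this.le.trans hmx.le

theorem IsSelection.of_middle (hA : A.Perm (l.filter (fun x => decide (m < x.1))))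
    (hB : B.Perm (l.filter (fun x => decide (x.1 = m)))) {k : ℕ}
    (hk : A.length < k) (hk' : k - A.length ≤ B.length) :
    IsSelection k l (A ++ B.take (k - A.length)) := by
  have hp : (A ++ (B ++ l.filter (fun x => decide (x.1 < m)))).Perm l :=
    (hA.append (hB.append_right _)).trans (perm_filter_three m l)
  have hlen := hp.length_eq
  simp only [List.length_append] at hlen
  refine ⟨?_, B.drop (k - A.length) ++ l.filter (fun x => decide (x.1 < m)), ?_, ?_⟩
  · rw [List.length_append, List.length_take]; omega
  · rw [List.append_assoc, ← List.append_assoc (B.take _), List.take_append_drop]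
    exact hp
  · have hBm : ∀ y ∈ B, y.1 = m := fun y hy => by
      simpa using (List.mem_filter.1 (hB.mem_iff.1 hy)).2
    intro x hx y hy
    have h1 : m ≤ x.1 := by
      rcases List.mem_append.1 hx with hx | hx
      · have := (List.mem_filter.1 (hA.mem_iff.1 hx)).2
        exact (by simpa using this : m < x.1).le
      · exact (hBm x (List.mem_of_mem_take hx)).ge
    have h2 : y.1 ≤ m := by
      rcases List.mem_append.1 hy with hy | hy
      · exact (hBm y (List.mem_of_mem_drop hy)).le
      · have := (List.mem_filter.1 hy).2
        exact (by simpa using this : y.1 < m).le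
    exact h2.trans h1

theorem IsSelection.of_small (hA : A.Perm (l.filter (fun x => decide (m < x.1))))
    (hB : B.Perm (l.filter (fun x => decide (x.1 = m))))
    (hC : C.Perm (l.filter (fun x => decide (x.1 < m)))) {k : ℕ}
    (hk : A.length < k) (hk' : B.length < k - A.length) {r : List (R × α)}
    (hr : IsSelection (k - A.length - B.length) C r) :
    IsSelection k l (A ++ (B ++ r)) := by
  obtain ⟨h1, rest, h2, h3⟩ := hr
  have hp : (A ++ (B ++ C)).Perm l :=
    (hA.append (hB.append hC)).trans (perm_filter_three m l)
  have hlen := hp.length_eq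
  simp only [List.length_append] at hlen
  refine ⟨?_, rest, ?_, ?_⟩
  · simp only [List.length_append]; omega
  · rw [List.append_assoc, List.append_assoc]
    exact (((h2.append_left B).append_left A)).trans hp
  · intro x hx y hy
    have hy1 : y.1 < m := by
      have : y ∈ C := h2.mem_iff.1 (List.mem_append_right _ hy)
      simpa using (List.mem_filter.1 (hC.mem_iff.1 this)).2
    rcases List.mem_append.1 hx with hx | hx
    · have := (List.mem_filter.1 (hA.mem_iff.1 hx)).2
      exact hy1.le.trans (by simpa using this : m < x.1).le
    rcases List.mem_append.1 hx with hx | hx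
    · have := (List.mem_filter.1 (hB.mem_iff.1 hx)).2
      exact hy1.le.trans (by simpa using this : x.1 = m).ge
    · exact h3 x hx y hy

/-- The minimum of the upper half of the medians splits off a constant fraction of the list. -/
theorem pivot_splits {l ms upper : List (R × α)} {h : ℕ} {m : R}
    (hge : 3 * ms.countP (fun x => decide (m ≤ x.1)) ≤ l.countP (fun x => decide (m ≤ x.1)))
    (hle : 3 * ms.countP (fun x => decide (x.1 ≤ m)) ≤ l.countP (fun x => decide (x.1 ≤ m)))
    (hh : h = (ms.length + 1) / 2) (hm0 : 0 < ms.length) (hsel : IsSelection h ms upper)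
    (hmin : ∀ x ∈ upper, m ≤ x.1) (hmem : ∃ x ∈ upper, x.1 = m) :
    (l.filter (fun x => decide (m < x.1))).length + 3 * h ≤ l.length ∧
    (l.filter (fun x => decide (x.1 < m))).length + 3 * h ≤ l.length := by
  obtain ⟨h1, rest, h2, h3⟩ := hsel
  have hlen := h2.length_eq
  rw [List.length_append] at hlen
  obtain ⟨x0, hx0, hx0m⟩ := hmem
  have hrest : ∀ y ∈ rest, y.1 ≤ m := fun y hy => hx0m ▸ h3 x0 hx0 y hy
  have hup : upper.length ≤ ms.countP (fun x => decide (m ≤ x.1)) := by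
    rw [← h2.countP_eq, List.countP_append]
    have : upper.countP (fun x => decide (m ≤ x.1)) = upper.length :=
      List.countP_eq_length.2 (fun x hx => by simpa using hmin x hx)
    omega
  -- The pivot itself lies in `upper` and has key `m`; this extra entry brings the count up to `h`
  -- also when the number of medians is odd.
  have hlow : rest.length + 1 ≤ ms.countP (fun x => decide (x.1 ≤ m)) := by
    rw [← h2.countP_eq, List.countP_append]
    have h4 : rest.countP (fun x => decide (x.1 ≤ m)) = rest.length :=
      List.countP_eq_length.2 (fun x hx => by simpa using hrest x hx)
    have h5 : 0 < upper.countP (fun x => decide (x.1 ≤ m)) :=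
      List.countP_pos_iff.2 ⟨x0, hx0, by simp [hx0m]⟩
    omega
  have hc1 : (l.filter (fun x => decide (m < x.1))).length
      + l.countP (fun x => decide (x.1 ≤ m)) = l.length := by
    rw [← List.countP_eq_length_filter, List.length_eq_countP_add_countP (fun x => decide (m < x.1))]
    congr 2
    ext x; simp
  have hc2 : (l.filter (fun x => decide (x.1 < m))).length
      + l.countP (fun x => decide (m ≤ x.1)) = l.length := by
    rw [← List.countP_eq_length_filter, List.length_eq_countP_add_countP (fun x => decide (x.1 < m))]
    congr 2
    ext x; simp
  omega

/-- With `ms` medians and h = (ms + 1) / 2, the recursive calls have lengths ms ≤ 2h and at most |l|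
- 3h, so together they save at least h ≥ 1 entries. As |l| ≤ 5 ms + 4 ≤ 10h + 4, the saved 1000h
steps pay for the linear work and for the additive constant of the second call. -/
theorem selectT_spec (fuel k : ℕ) (l : List (R × α)) (hf : l.length < fuel) :
    IsSelection k l (selectT fuel k l).val ∧ (selectT fuel k l).time ≤ 1000 * l.length + 200 := by
  induction fuel generalizing k l with
  | zero => omega
  | succ fuel ih =>
    have t0 := lengthT_time l
    simp only [selectT, Timed.bind_val, Timed.bind_time, step_val, step_time, lengthT_val]
    by_cases h1 : l.length ≤ k
    · simp only [h1, decide_true, if_true, step_val, step_time]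
      exact ⟨IsSelection.of_length_le h1, by omega⟩
    simp only [h1, decide_false, Bool.false_eq_true, if_false, Timed.bind_val, Timed.bind_time,
      step_val, step_time]
    by_cases h2 : l.length < 5
    · simp only [h2, decide_true, if_true, Timed.bind_val, Timed.bind_time, takeT_val]
      have t1 := sortT_time l h2.le
      have t2 := takeT_time k (sortT l).val
      rw [(sortT_perm l).length_eq] at t2
      exact ⟨IsSelection.take_of_decreasing k (sortT_perm l) (sortT_decreasing l), by omega⟩
    simp only [h2, decide_false, Bool.false_eq_true, if_false, Timed.bind_val, Timed.bind_time,
      step_val, step_time, lengthT_val]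
    obtain ⟨m1, m2, m3, m4, m5, m6⟩ := mediansT_spec l
    generalize mediansT l = ms at *
    have t1 := lengthT_time ms.val
    obtain ⟨hsel, tsel⟩ := ih ((ms.val.length + 1) / 2) ms.val (by omega)
    generalize selectT fuel ((ms.val.length + 1) / 2) ms.val = upper at *
    obtain ⟨upper, tu⟩ := upper
    simp only at hsel tsel ⊢
    have hul := hsel.1
    match upper, hul with
    | [], hul => simp only [List.length_nil] at hul; omega
    | x :: xs, hul =>
      simp only [Timed.bind_val, Timed.bind_time, step_val, step_time, lengthT_val]
      obtain ⟨p1, p2, p3⟩ := minKeyT_spec x.1 xs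
      have t2 := minKeyT_time x.1 xs
      generalize (minKeyT x.1 xs).val = m at *
      obtain ⟨s1, s2, s3⟩ := splitT_val m l
      have t3 := splitT_time m l
      obtain ⟨b1, b2⟩ := pivot_splits (m5 m) (m6 m) rfl (by omega) hsel
        (fun y hy => by
          rcases List.mem_cons.1 hy with rfl | hy
          · exact p1
          · exact p2 y hy)
        (by
          rcases p3 with p3 | ⟨y, hy, p3⟩
          · exact ⟨x, by simp, p3.symm⟩
          · exact ⟨y, by simp [hy], p3.symm⟩)
      rw [← s1.length_eq] at b1
      rw [← s3.length_eq] at b2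
      have b3 : (splitT m l).val.2.1.length ≤ l.length := by
        rw [s2.length_eq]; exact List.length_filter_le _ _
      generalize splitT m l = s at *
      have t4 := lengthT_time s.val.1
      have t5 := lengthT_time s.val.2.1
      rw [List.length_cons] at hul
      have hx : xs.length ≤ ms.val.length := by omega
      have hh : ms.val.length ≤ 2 * ((ms.val.length + 1) / 2) := by omega
      have hh1 : 1 ≤ (ms.val.length + 1) / 2 := by omega
      have ha : s.val.1.length ≤ l.length := by omega
      by_cases h3 : k ≤ s.val.1.length
      · simp only [h3, decide_true, if_true]
        obtain ⟨i1, i2⟩ := ih k s.val.1 (by omega)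
        exact ⟨IsSelection.of_large s1 h3 i1, by omega⟩
      simp only [h3, decide_false, Bool.false_eq_true, if_false, Timed.bind_val, Timed.bind_time,
        step_val, step_time, lengthT_val]
      by_cases h4 : k - s.val.1.length ≤ s.val.2.1.length
      · simp only [h4, decide_true, if_true, Timed.bind_val, Timed.bind_time, takeT_val,
          appendT_val, appendT_time]
        have t6 := takeT_time (k - s.val.1.length) s.val.2.1
        have i1 := IsSelection.of_middle s1 s2 (by omega) h4
        refine ⟨i1, ?_⟩
        linarith
      · simp only [h4, decide_false, Bool.false_eq_true, if_false, Timed.bind_val,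
          Timed.bind_time, step_val, step_time, appendT_val, appendT_time]
        obtain ⟨i1, i2⟩ := ih (k - s.val.1.length - s.val.2.1.length) s.val.2.2 (by omega)
        have i3 := IsSelection.of_small s1 s2 s3 (not_le.1 h3) (not_le.1 h4) i1
        refine ⟨i3, ?_⟩
        linarith

end SelectionSpec

/-! ### Correctness and running time of the belief propagation program -/

section Program

variable {n : ℕ} (H : SimpleGraph (Fin n)) (K : ℕ) (p q : ℝ)

theorem contributionT_val (x : ℝ) :
    (contributionT (constantsT n K p q).val x).val = contribution n K p q x := rfl

theorem contributionT_time (c : Constants) (x : ℝ) : (contributionT c x).time = 7 := rfl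

theorem adjacencyList_nodup (i : Fin n) : (adjacencyList H i).Nodup :=
  (List.nodup_finRange n).filter _

theorem mem_adjacencyList {i j : Fin n} : j ∈ adjacencyList H i ↔ H.Adj i j := by
  simp [adjacencyList]

open Classical in
theorem sum_adjacencyList (i : Fin n) (f : Fin n → ℝ) :
    ((adjacencyList H i).map f).sum = ∑ l : Fin n with H.Adj i l, f l := by
  rw [← List.sum_toFinset f (adjacencyList_nodup H i)]
  congr 1
  ext j
  simp [mem_adjacencyList]

open Classical in
theorem length_adjacencyList (i : Fin n) : (adjacencyList H i).length = H.degree i := by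
  rw [← List.toFinset_card_of_nodup (adjacencyList_nodup H i), ← SimpleGraph.card_neighborFinset_eq_degree]
  congr 1
  ext j
  simp [mem_adjacencyList]

theorem sum_length_adjacencyList :
    ((List.finRange n).map (fun i => (adjacencyList H i).length)).sum = 2 * H.edgeSet.ncard := by
  classical
  simp only [length_adjacencyList]
  rw [← List.sum_toFinset _ (List.nodup_finRange n)]
  have : (List.finRange n).toFinset = Finset.univ := by ext; simp
  rw [this, SimpleGraph.sum_degrees_eq_twice_card_edges, ← SimpleGraph.coe_edgeFinset,
    Set.ncard_coe_finset]

theorem beliefT_val (c : Constants) (m : Memory n) (i : Fin n) :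
    (beliefT (adjacencyList H) c m i).val
      = c.offset + ((adjacencyList H i).map (fun j => (contributionT c (m (j, i))).val)).sum := by
  have : ∀ (l : List (Fin n)) (s : ℝ), l.foldl (fun s j => s + (contributionT c (m (j, i))).val) s
      = s + (l.map (fun j => (contributionT c (m (j, i))).val)).sum := by
    intro l
    induction l with
    | nil => simp
    | cons a l ih => intro s; rw [List.foldl_cons, ih]; simp [add_assoc]
  rw [← this]
  simp only [beliefT, Timed.bind_val, step_val, forEach_val]

theorem beliefT_time (c : Constants) (m : Memory n) (i : Fin n) :
    (beliefT (adjacencyList H) c m i).time ≤ 10 * (adjacencyList H i).length + 2 := by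
  simp only [beliefT, Timed.bind_time, step_time, step_val]
  have := forEach_time_le_mul (fun (s : ℝ) j => do
    let x ← step (m (j, i))
    let y ← contributionT c x
    step (s + y)) 9 (adjacencyList H i) c.offset (by
      intro s a _; simp [contributionT_time])
  omega

theorem foldl_update (l : List (Fin n)) (w : Memory n) (i : Fin n) (g : Fin n → ℝ)
    (a b : Fin n) :
    l.foldl (fun (w : Memory n) j => Function.update w (i, j) (g j)) w (a, b)
      = if a = i ∧ b ∈ l then g b else w (a, b) := by
  induction l generalizing w with
  | nil => simp
  | cons j l ih =>
    rw [List.foldl_cons, ih]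
    by_cases h : a = i ∧ b ∈ l
    · rw [if_pos h, if_pos ⟨h.1, by simp [h.2]⟩]
    · rw [if_neg h]
      by_cases hj : (a, b) = (i, j)
      · obtain ⟨rfl, rfl⟩ := Prod.mk.inj hj
        rw [Function.update_self, if_pos ⟨rfl, by simp⟩]
      · rw [Function.update_of_ne hj, if_neg]
        rintro ⟨rfl, hb⟩
        rcases List.mem_cons.1 hb with rfl | hb
        · exact hj rfl
        · exact h ⟨rfl, hb⟩

/-- The written values `g i j` do not depend on the array being filled: the program reads from one
array and writes to the other, so the order of the writes is irrelevant. -/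
theorem foldl_foldl_update (L : List (Fin n)) (w : Memory n) (adj : Fin n → List (Fin n))
    (g : Fin n → Fin n → ℝ) (a b : Fin n) :
    L.foldl (fun (w : Memory n) i =>
        (adj i).foldl (fun (w : Memory n) j => Function.update w (i, j) (g i j)) w) w (a, b)
      = if a ∈ L ∧ b ∈ adj a then g a b else w (a, b) := by
  induction L generalizing w with
  | nil => simp
  | cons i L ih =>
    rw [List.foldl_cons, ih, foldl_update]
    by_cases hb : b ∈ adj a
    · by_cases ha : a ∈ L
      · simp [ha, hb]
      · by_cases hi : a = i
        · subst hi; simp [ha, hb]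
        · simp [ha, hi]
    · simp only [hb, and_false, if_false]
      rw [if_neg]
      rintro ⟨rfl, h⟩
      exact hb h

/-- The entries of the memory for adjacent vertices are the messages at time `t`. -/
def HoldsMessages (t : ℕ) (m : Memory n) : Prop :=
  ∀ i j, H.Adj i j → m (i, j) = message H K p q t i j

theorem initializeT_holds (m : Memory n) :
    HoldsMessages H K p q 0 (initializeT (adjacencyList H) m).val := by
  intro i j hij
  simp only [initializeT, forEach_val, Timed.bind_val, step_val]
  rw [foldl_foldl_update (g := fun _ _ => 0), if_pos ⟨List.mem_finRange i,
    (mem_adjacencyList H).2 hij⟩, message]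

theorem initializeT_time (m : Memory n) :
    (initializeT (adjacencyList H) m).time ≤ 3 * n + 4 * H.edgeSet.ncard + 1 := by
  have := forEach_time_le (fun (m : Memory n) i => do
    let l ← step (adjacencyList H i)
    forEach (fun (m : Memory n) j => step (Function.update m (i, j) 0)) l m)
    (fun i => 2 * (adjacencyList H i).length + 2) (List.finRange n) m (by
      intro s i _
      have := forEach_time_le_mul (fun (m : Memory n) j => step (Function.update m (i, j) 0)) 1
        (adjacencyList H i) s (by simp)
      simp only [Timed.bind_time, step_time, step_val]
      omega)
  rw [List.sum_map_add, List.sum_map_mul_left, sum_length_adjacencyList] at this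
  simp only [List.map_const', List.length_finRange, List.sum_replicate, smul_eq_mul] at this
  unfold initializeT
  omega

theorem belief_of_holds {t : ℕ} {m : Memory n} (h : HoldsMessages H K p q t m) (i : Fin n) :
    (beliefT (adjacencyList H) (constantsT n K p q).val m i).val = belief H K p q (t + 1) i := by
  classical
  rw [beliefT_val, sum_adjacencyList, belief]
  refine congrArg₂ _ rfl (Finset.sum_congr (by ext; simp) fun j hj => ?_)
  rw [contributionT_val, h j i (by simpa using (Finset.mem_filter.1 hj).2.symm)]

/-- This is what makes a round linear: one sum per vertex and one subtraction per neighbor, instead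
of one sum per directed edge. -/
theorem message_eq_belief_sub {t : ℕ} {i j : Fin n} (hij : H.Adj i j) :
    message H K p q (t + 1) i j
      = belief H K p q (t + 1) i - contribution n K p q (message H K p q t j i) := by
  classical
  rw [message, belief]
  have h1 : (Finset.univ.filter fun l => H.Adj i l)
      = insert j (Finset.univ.filter fun l => H.Adj i l ∧ l ≠ j) := by
    ext l
    by_cases h : l = j
    · simp [h, hij]
    · simp [h]
  have h2 : j ∉ Finset.univ.filter fun l => H.Adj i l ∧ l ≠ j := by simp
  have h3 := Finset.sum_insert (f := fun l => contribution n K p q (message H K p q t l i)) h2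
  rw [← h1] at h3
  linarith

theorem iterationT_holds {t : ℕ} {s : Memory n × Memory n} (h : HoldsMessages H K p q t s.1) :
    HoldsMessages H K p q (t + 1)
      (iterationT (adjacencyList H) (constantsT n K p q).val s).val.1 := by
  intro i j hij
  simp only [iterationT, sendT, forEach_val, Timed.bind_val, step_val]
  rw [foldl_foldl_update (g := fun i j => (beliefT (adjacencyList H) (constantsT n K p q).val s.1 i).val
    - (contributionT (constantsT n K p q).val (s.1 (j, i))).val), if_pos ⟨List.mem_finRange i,
    (mem_adjacencyList H).2 hij⟩, belief_of_holds H K p q h, contributionT_val,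
    h j i hij.symm, message_eq_belief_sub H K p q hij]

theorem iterationT_time (c : Constants) (s : Memory n × Memory n) :
    (iterationT (adjacencyList H) c s).time ≤ 5 * n + 42 * H.edgeSet.ncard + 2 := by
  have hsend : ∀ w, ∀ i ∈ List.finRange n, (sendT (adjacencyList H) c s.1 w i).time
      ≤ 21 * (adjacencyList H i).length + 4 := by
    intro w i _
    have h1 := beliefT_time H c s.1 i
    simp only [sendT, Timed.bind_time, step_time, step_val]
    have h2 := forEach_time_le_mul (fun (w : Memory n) j => do
      let x ← step (s.1 (j, i))
      let y ← contributionT c x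
      let z ← step ((beliefT (adjacencyList H) c s.1 i).val - y)
      step (Function.update w (i, j) z)) 10 (adjacencyList H i) w (by
        intro s a _; simp [contributionT_time])
    omega
  have := forEach_time_le (fun w i => sendT (adjacencyList H) c s.1 w i)
    (fun i => 21 * (adjacencyList H i).length + 4) (List.finRange n) s.2 hsend
  rw [List.sum_map_add, List.sum_map_mul_left, sum_length_adjacencyList] at this
  simp only [List.map_const', List.length_finRange, List.sum_replicate, smul_eq_mul] at this
  simp only [iterationT, Timed.bind_time, step_time]
  omega

theorem iterate_iterationT_holds (t : ℕ) (m₁ m₂ : Memory n) :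
    HoldsMessages H K p q t
      ((fun s => (iterationT (adjacencyList H) (constantsT n K p q).val s).val)^[t]
        ((initializeT (adjacencyList H) m₁).val, m₂)).1 := by
  induction t with
  | zero => exact initializeT_holds H K p q m₁
  | succ t ih =>
    rw [Function.iterate_succ_apply']
    exact iterationT_holds H K p q ih

theorem foldl_cons_eq {α β : Type} (f : α → β) (l : List α) (s : List β) :
    l.foldl (fun s a => f a :: s) s = (l.map f).reverse ++ s := by
  induction l generalizing s with
  | nil => rfl
  | cons a l ih => rw [List.foldl_cons, ih]; simp

/-- The program makes `t - 1` rounds and then forms the beliefs, so `t ≥ 1` excludes the truncated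
subtraction and the dummy belief at time 0. -/
theorem runBP_val (t : ℕ) (ht : 1 ≤ t) :
    (runBP H K p q t).val = ((selectT (n + 1) K
      (((List.finRange n).map (fun i => (belief H K p q t i, i))).reverse)).val.map
        Prod.snd).reverse := by
  obtain ⟨t, rfl⟩ := Nat.exists_eq_add_of_le' ht
  have h : (((List.finRange n).map (fun i => (belief H K p q (t + 1) i, i))).reverse)
      = (forEach (fun (bs : List (ℝ × Fin n)) i => do
        let b ← beliefT (adjacencyList H) (constantsT n K p q).val ((fun s =>
          (iterationT (adjacencyList H) (constantsT n K p q).val s).val)^[t]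
          ((initializeT (adjacencyList H) (fun _ => 0)).val, (fun _ => 0))).1 i
        step ((b, i) :: bs)) (List.finRange n) []).val := by
    simp only [forEach_val, Timed.bind_val, step_val,
      belief_of_holds H K p q (iterate_iterationT_holds H K p q t _ _)]
    rw [foldl_cons_eq (fun i => (belief H K p q (t + 1) i, i)), List.append_nil]
  rw [h]
  simp only [runBP, beliefPropagation, Timed.bind_val, step_val, Nat.add_sub_cancel]
  rw [forEach_val]
  simp only [step_val]
  rw [foldl_cons_eq, List.append_nil]
  simp only [repeatTimes_val]

theorem isTopSet_of_isSelection {R : Fin n → ℝ} {r : List (ℝ × Fin n)} (hK : K ≤ n)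
    (h : IsSelection K (((List.finRange n).map (fun i => (R i, i))).reverse) r) :
    IsTopSet R K (r.map Prod.snd).reverse.toFinset := by
  obtain ⟨h1, rest, h2, h3⟩ := h
  have hkey : ∀ x ∈ r ++ rest, x.1 = R x.2 := by
    intro x hx
    rw [h2.mem_iff, List.mem_reverse, List.mem_map] at hx
    obtain ⟨i, -, rfl⟩ := hx
    rfl
  have hp : ((r.map Prod.snd) ++ (rest.map Prod.snd)).Perm (List.finRange n) := by
    rw [← List.map_append]
    refine (h2.map _).trans ?_
    rw [List.map_reverse, List.map_map]
    refine (List.reverse_perm _).trans ?_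
    simp [Function.comp_def]
  have hnd := (hp.nodup_iff.2 (List.nodup_finRange n)).of_append_left
  constructor
  · rw [List.toFinset_reverse, List.toFinset_card_of_nodup hnd, List.length_map, h1]
    simp [hK]
  · intro i hi j hj
    rw [List.toFinset_reverse, List.mem_toFinset] at hi hj
    have hj' : j ∈ rest.map Prod.snd := by
      have : j ∈ r.map Prod.snd ++ rest.map Prod.snd := hp.mem_iff.2 (List.mem_finRange j)
      exact (List.mem_append.1 this).resolve_left hj
    obtain ⟨x, hx, rfl⟩ := List.mem_map.1 hi
    obtain ⟨y, hy, rfl⟩ := List.mem_map.1 hj'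
    rw [← hkey x (List.mem_append_left _ hx), ← hkey y (List.mem_append_right _ hy)]
    exact h3 x hx y hy

theorem runBP_isTopSet (t : ℕ) (ht : 1 ≤ t) (hK : K ≤ n) :
    IsTopSet (belief H K p q t) K (runBP H K p q t).val.toFinset := by
  rw [runBP_val H K p q t ht]
  exact isTopSet_of_isSelection K hK (selectT_spec _ _ _ (by simp)).1

theorem runBP_time (t : ℕ) :
    (runBP H K p q t).time ≤ 2000 * (n + H.edgeSet.ncard + 1) * (t + 1) := by
  simp only [runBP, beliefPropagation, Timed.bind_time, step_time, step_val]
  set c := (constantsT n K p q).val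
  set m := (initializeT (adjacencyList H) (fun _ => 0)).val
  set s := (repeatTimes (iterationT (adjacencyList H) c) (t - 1) (m, fun _ => 0)).val
  have e0 : (constantsT n K p q).time = 8 := by simp [constantsT]
  have e1 := initializeT_time H (fun _ => 0)
  have e2 := repeatTimes_time_le (iterationT (adjacencyList H) c) _ (t - 1) (m, fun _ => 0)
    (iterationT_time H c)
  have e3 := forEach_time_le (fun (bs : List (ℝ × Fin n)) i => do
      let b ← beliefT (adjacencyList H) c s.1 i
      step ((b, i) :: bs)) (fun i => 10 * (adjacencyList H i).length + 3) (List.finRange n) [] (by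
      intro bs i _
      have := beliefT_time H c s.1 i
      simp only [Timed.bind_time, step_time]
      omega)
  rw [List.sum_map_add, List.sum_map_mul_left, sum_length_adjacencyList] at e3
  simp only [List.map_const', List.length_finRange, List.sum_replicate, smul_eq_mul] at e3
  set bs := (forEach (fun (bs : List (ℝ × Fin n)) i => do
      let b ← beliefT (adjacencyList H) c s.1 i
      step ((b, i) :: bs)) (List.finRange n) []).val with hbs
  have hlen : bs.length = n := by
    rw [hbs, forEach_val]
    simp only [Timed.bind_val, step_val]
    rw [foldl_cons_eq (fun i => ((beliefT (adjacencyList H) c s.1 i).val, i))]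
    simp
  obtain ⟨e4, e5⟩ := selectT_spec (n + 1) K bs (by omega)
  have e6 := e4.1
  have e7 := forEach_time_le_mul (fun (out : List (Fin n)) (x : ℝ × Fin n) => step (x.2 :: out)) 1
    (selectT (n + 1) K bs).val [] (by simp)
  have e8 : (selectT (n + 1) K bs).val.length ≤ n := by omega
  rw [hlen] at e5
  set E := H.edgeSet.ncard
  have e9 : (5 * n + 42 * E + 2 + 1) * (t - 1) ≤ (5 * n + 42 * E + 3) * t :=
    Nat.mul_le_mul_left _ (Nat.sub_le t 1)
  rw [e0]
  nlinarith [mul_nonneg (Nat.zero_le n) (Nat.zero_le t), mul_nonneg (Nat.zero_le E) (Nat.zero_le t)]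

end Program

/-! ### The iterated logarithm -/

/-- Since log y ≤ y - 1 for y > 0, an iterate that stays above 1 would drop by at least 1 each time.
Hence the infimum in `logStar` is attained. -/
theorem exists_iterate_log_le_one (x : ℝ) : ∃ k : ℕ, Real.log^[k] x ≤ 1 := by
  by_contra! h
  have hstep : ∀ k, Real.log^[k + 1] x ≤ Real.log^[k] x - 1 := fun k => by
    rw [Function.iterate_succ_apply']
    exact Real.log_le_sub_one_of_pos (by linarith [h k])
  have hall : ∀ k : ℕ, Real.log^[k] x ≤ x - k := fun k => by
    induction k with
    | zero => simp
    | succ k ih => have := hstep k; push_cast; linarith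
  obtain ⟨k, hk⟩ := exists_nat_gt x
  linarith [hall k, h k]

theorem logStar_of_le_one {x : ℝ} (h : x ≤ 1) : logStar x = 0 :=
  Nat.eq_zero_of_le_zero (Nat.sInf_le (by simpa using h))

theorem iterate_logStar_le_one (x : ℝ) : Real.log^[logStar x] x ≤ 1 :=
  Nat.sInf_mem (s := {k : ℕ | Real.log^[k] x ≤ 1}) (exists_iterate_log_le_one x)

theorem one_lt_iterate_of_lt_logStar {x : ℝ} {k : ℕ} (h : k < logStar x) :
    1 < Real.log^[k] x :=
  not_le.1 (Nat.notMem_of_lt_sInf (s := {k : ℕ | Real.log^[k] x ≤ 1}) h)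

theorem logStar_of_one_lt {x : ℝ} (h : 1 < x) : logStar x = logStar (Real.log x) + 1 := by
  apply le_antisymm
  · refine Nat.sInf_le ?_
    rw [Set.mem_ofPred_eq, Function.iterate_succ_apply]
    exact iterate_logStar_le_one _
  · have h0 : logStar x ≠ 0 := by
      intro h0
      have := iterate_logStar_le_one x
      rw [h0] at this
      exact absurd this (not_le.2 h)
    obtain ⟨k, hk⟩ := Nat.exists_eq_succ_of_ne_zero h0
    have h1 := iterate_logStar_le_one x
    rw [hk, Nat.succ_eq_add_one, Function.iterate_succ_apply] at h1
    rw [hk]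
    exact Nat.succ_le_succ (Nat.sInf_le h1)

theorem logStar_mono {x y : ℝ} (h : x ≤ y) : logStar x ≤ logStar y := by
  induction hy : logStar y generalizing x y with
  | zero =>
    rw [logStar_of_le_one (h.trans ?_)]
    simpa [hy] using iterate_logStar_le_one y
  | succ k ih =>
    rcases le_or_gt x 1 with hx | hx
    · simp [logStar_of_le_one hx]
    · rw [logStar_of_one_lt hx]
      rw [logStar_of_one_lt (hx.trans_le h)] at hy
      exact Nat.succ_le_succ (ih (Real.log_le_log (by linarith) h) (by omega))

theorem nu_le_log (n K : ℕ) (hn : 2 ≤ n) : nu n K ≤ Real.log n := by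
  have hn' : (2 : ℝ) ≤ n := by exact_mod_cast hn
  have hlog : 0 ≤ Real.log n := Real.log_nonneg (by linarith)
  unfold nu
  rcases Nat.eq_zero_or_pos K with rfl | hK
  · simpa using hlog
  have hK' : (1 : ℝ) ≤ K := by exact_mod_cast hK
  -- `Real.log` is even, so passing to the absolute value covers K > n; the cases K = 0 and K = n
  -- give log 0 = 0.
  rw [← Real.log_abs]
  rcases eq_or_ne (((n : ℝ) - K) / K) 0 with h0 | h0
  · simpa [h0] using hlog
  · apply Real.log_le_log (abs_pos.2 h0)
    rw [abs_div, abs_of_pos (by linarith : (0 : ℝ) < K), div_le_iff₀ (by linarith), abs_le]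
    constructor <;> nlinarith

theorem one_le_logStar_natCast {n : ℕ} (hn : 2 ≤ n) : 1 ≤ logStar (n : ℝ) := by
  rw [logStar_of_one_lt (by exact_mod_cast hn)]
  omega

/-- Additive constants are absorbed by n + |E| ≥ 1 and log* n ≥ 1, and ν ≤ log n ≤ n compares the
numbers of rounds. -/
theorem runBP_time_le {n : ℕ} (hn : 2 ≤ n) (H : SimpleGraph (Fin n)) (K : ℕ) (p q : ℝ) (t0 : ℕ) :
    (runBP H K p q (iterations t0 n K)).time
      ≤ 4000 * (t0 + 4) * (n + H.edgeSet.ncard) * logStar n := by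
  refine (runBP_time H K p q _).trans ?_
  have h1 := logStar_mono (nu_le_log n K hn)
  have h2 : logStar (Real.log n) ≤ logStar n :=
    logStar_mono (Real.log_le_self (Nat.cast_nonneg n))
  have h3 := one_le_logStar_natCast hn
  have h4 : iterations t0 n K + 1 ≤ (t0 + 4) * logStar n := by
    unfold iterations
    nlinarith
  calc 2000 * (n + H.edgeSet.ncard + 1) * (iterations t0 n K + 1)
      ≤ 2000 * (2 * (n + H.edgeSet.ncard)) * ((t0 + 4) * logStar n) := by
        gcongr; omega
    _ = _ := by ring

/-! ### Discrete weights on the real line and compound Poisson sums -/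

section Weights

/-- The sum of `φ` against the weights `μ`. -/
def avg (μ φ : ℝ → ℝ≥0∞) : ℝ≥0∞ := ∑' x, μ x * φ x

/-- Average `φ (s + c x)` over the weights `μ`. -/
def shiftOp (c : ℝ → ℝ) (μ φ : ℝ → ℝ≥0∞) (s : ℝ) : ℝ≥0∞ := ∑' x, μ x * φ (s + c x)

/-- The exponential series of `shiftOp c μ`: an unnormalized compound Poisson average. -/
def expOp (c : ℝ → ℝ) (μ φ : ℝ → ℝ≥0∞) (s : ℝ) : ℝ≥0∞ :=
  ∑' m : ℕ, (m.factorial : ℝ≥0∞)⁻¹ * (shiftOp c μ)^[m] φ s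

variable {c : ℝ → ℝ} {μ ν φ ψ : ℝ → ℝ≥0∞}

theorem avg_mono (h : ∀ x, φ x ≤ ψ x) : avg μ φ ≤ avg μ ψ :=
  ENNReal.tsum_le_tsum fun x => by gcongr; exact h x

theorem avg_add : avg μ (fun x => φ x + ψ x) = avg μ φ + avg μ ψ := by
  simp only [avg, mul_add, ENNReal.tsum_add]

theorem avg_const_mul (a : ℝ≥0∞) : avg μ (fun x => a * φ x) = a * avg μ φ := by
  simp only [avg, ← ENNReal.tsum_mul_left, mul_left_comm]

theorem avg_tsum {ι : Type*} (f : ι → ℝ → ℝ≥0∞) :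
    avg μ (fun x => ∑' i, f i x) = ∑' i, avg μ (f i) := by
  simp only [avg, ← ENNReal.tsum_mul_left]
  exact ENNReal.tsum_comm

theorem shiftOp_eq_avg (s : ℝ) : shiftOp c μ φ s = avg μ (fun x => φ (s + c x)) := rfl

theorem shiftOp_mono (h : ∀ s, φ s ≤ ψ s) (s : ℝ) : shiftOp c μ φ s ≤ shiftOp c μ ψ s :=
  avg_mono fun _ => h _

theorem shiftOp_mono_weight (h : ∀ x, μ x ≤ ν x) (s : ℝ) : shiftOp c μ φ s ≤ shiftOp c ν φ s :=
  ENNReal.tsum_le_tsum fun x => by gcongr; exact h x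

theorem shiftOp_add (s : ℝ) :
    shiftOp c μ (fun s => φ s + ψ s) s = shiftOp c μ φ s + shiftOp c μ ψ s := avg_add

theorem shiftOp_add_weight (s : ℝ) :
    shiftOp c (fun x => μ x + ν x) φ s = shiftOp c μ φ s + shiftOp c ν φ s := by
  simp only [shiftOp, add_mul, ENNReal.tsum_add]

theorem shiftOp_const_mul (a : ℝ≥0∞) (s : ℝ) :
    shiftOp c μ (fun s => a * φ s) s = a * shiftOp c μ φ s := avg_const_mul a

theorem shiftOp_tsum {ι : Type*} (f : ι → ℝ → ℝ≥0∞) (s : ℝ) :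
    shiftOp c μ (fun s => ∑' i, f i s) s = ∑' i, shiftOp c μ (f i) s := avg_tsum _

theorem shiftOp_comm (s : ℝ) :
    shiftOp c μ (shiftOp c ν φ) s = shiftOp c ν (shiftOp c μ φ) s := by
  simp only [shiftOp, ← ENNReal.tsum_mul_left]
  rw [ENNReal.tsum_comm]
  refine tsum_congr fun y => tsum_congr fun x => ?_
  rw [mul_left_comm, add_right_comm]

theorem shiftOp_shift (d s : ℝ) :
    shiftOp c μ (fun s => φ (s + d)) s = shiftOp c μ φ (s + d) := by
  simp only [shiftOp, add_right_comm]

theorem iterate_shiftOp_shift (m : ℕ) (d s : ℝ) :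
    (shiftOp c μ)^[m] (fun s => φ (s + d)) s = (shiftOp c μ)^[m] φ (s + d) := by
  induction m generalizing φ with
  | zero => rfl
  | succ m ih =>
    rw [Function.iterate_succ_apply, Function.iterate_succ_apply, ← ih]
    exact congrArg (fun g => (shiftOp c μ)^[m] g s) (funext fun s => shiftOp_shift d s)

theorem iterate_shiftOp_mono_weight (h : ∀ x, μ x ≤ ν x) (m : ℕ) (s : ℝ) :
    (shiftOp c μ)^[m] φ s ≤ (shiftOp c ν)^[m] φ s := by
  induction m generalizing s with
  | zero => rfl
  | succ m ih =>
    rw [Function.iterate_succ_apply', Function.iterate_succ_apply']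
    exact (shiftOp_mono ih s).trans (shiftOp_mono_weight h s)

theorem iterate_shiftOp_tsum {ι : Type*} (f : ι → ℝ → ℝ≥0∞) (m : ℕ) (s : ℝ) :
    (shiftOp c μ)^[m] (fun s => ∑' i, f i s) s = ∑' i, (shiftOp c μ)^[m] (f i) s := by
  induction m generalizing f with
  | zero => rfl
  | succ m ih =>
    simp only [Function.iterate_succ_apply]
    rw [← ih]
    exact congrArg (fun g => (shiftOp c μ)^[m] g s) (funext fun s => shiftOp_tsum f s)

theorem iterate_shiftOp_const_mul (a : ℝ≥0∞) (m : ℕ) (s : ℝ) :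
    (shiftOp c μ)^[m] (fun s => a * φ s) s = a * (shiftOp c μ)^[m] φ s := by
  induction m generalizing φ with
  | zero => rfl
  | succ m ih =>
    simp only [Function.iterate_succ_apply]
    rw [← ih]
    exact congrArg (fun g => (shiftOp c μ)^[m] g s) (funext fun s => shiftOp_const_mul a s)

theorem expOp_shift (d s : ℝ) : expOp c μ (fun s => φ (s + d)) s = expOp c μ φ (s + d) := by
  simp only [expOp, iterate_shiftOp_shift]

theorem expOp_mono_weight (h : ∀ x, μ x ≤ ν x) (s : ℝ) : expOp c μ φ s ≤ expOp c ν φ s :=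
  ENNReal.tsum_le_tsum fun m => by gcongr; exact iterate_shiftOp_mono_weight h m s

theorem expOp_tsum {ι : Type*} (f : ι → ℝ → ℝ≥0∞) (s : ℝ) :
    expOp c μ (fun s => ∑' i, f i s) s = ∑' i, expOp c μ (f i) s := by
  simp only [expOp, iterate_shiftOp_tsum, ← ENNReal.tsum_mul_left]
  exact ENNReal.tsum_comm

theorem expOp_const_mul (a : ℝ≥0∞) (s : ℝ) :
    expOp c μ (fun s => a * φ s) s = a * expOp c μ φ s := by
  simp only [expOp, iterate_shiftOp_const_mul, ← ENNReal.tsum_mul_left, mul_left_comm]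

/-- The operators for `μ` and `ν` commute and are positive; these are the first two terms of the
binomial expansion of (A + B)^{m+1}. -/
theorem le_iterate_shiftOp_add (m : ℕ) (s : ℝ) :
    (shiftOp c μ)^[m + 1] φ s + (m + 1 : ℕ) * shiftOp c ν ((shiftOp c μ)^[m] φ) s
      ≤ (shiftOp c (fun x => μ x + ν x))^[m + 1] φ s := by
  induction m generalizing s with
  | zero => simp [shiftOp_add_weight]
  | succ m ih =>
    rw [Function.iterate_succ_apply' _ (m + 1), Function.iterate_succ_apply' _ (m + 1)]
    refine le_trans ?_ (shiftOp_mono ih s)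
    have h1 : shiftOp c μ (shiftOp c ν ((shiftOp c μ)^[m] φ)) s
        = shiftOp c ν ((shiftOp c μ)^[m + 1] φ) s := by
      rw [shiftOp_comm, Function.iterate_succ_apply']
    have h2 : shiftOp c ν ((shiftOp c μ)^[m + 1] φ) s ≤ shiftOp c ν (fun s =>
        (shiftOp c μ)^[m + 1] φ s + (m + 1 : ℕ) * shiftOp c ν ((shiftOp c μ)^[m] φ) s) s :=
      shiftOp_mono (fun s => le_add_of_nonneg_right (zero_le)) s
    rw [shiftOp_add_weight]
    refine le_trans (le_of_eq ?_) (add_le_add_right h2 _)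
    rw [shiftOp_add, shiftOp_const_mul, h1, Nat.cast_succ (m + 1)]
    ring

/-- Adding a further term that is absent or drawn once is dominated by a compound Poisson sum. -/
theorem expOp_add_shiftOp_le (s : ℝ) :
    expOp c μ φ s + shiftOp c ν (expOp c μ φ) s ≤ expOp c (fun x => μ x + ν x) φ s := by
  have h1 : shiftOp c ν (expOp c μ φ) s
      = ∑' m : ℕ, (m.factorial : ℝ≥0∞)⁻¹ * shiftOp c ν ((shiftOp c μ)^[m] φ) s := by
    unfold expOp
    rw [shiftOp_tsum]
    simp only [shiftOp_const_mul]
  rw [h1]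
  unfold expOp
  rw [tsum_eq_zero_add' ENNReal.summable, tsum_eq_zero_add' (f := fun m : ℕ => (m.factorial : ℝ≥0∞)⁻¹ *
    (shiftOp c (fun x => μ x + ν x))^[m] φ s) ENNReal.summable, add_assoc, ← ENNReal.tsum_add]
  refine add_le_add le_rfl (ENNReal.tsum_le_tsum fun m => ?_)
  -- The binomial factor m + 1 turns the coefficient 1/(m+1)! of the larger series into the 1/m!
  -- that is needed.
  have h2 : (m.factorial : ℝ≥0∞)⁻¹ = ((m + 1).factorial : ℝ≥0∞)⁻¹ * (m + 1 : ℕ) := by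
    rw [Nat.factorial_succ, Nat.cast_mul, ENNReal.mul_inv (by simp) (by simp), mul_assoc,
      mul_comm _ (((m + 1 : ℕ)) : ℝ≥0∞), ← mul_assoc, ENNReal.inv_mul_cancel (by simp) (by simp),
      one_mul]
  rw [h2, mul_assoc, ← mul_add]
  gcongr
  exact le_iterate_shiftOp_add m s

theorem tsum_pow_div_factorial {g : ℝ≥0∞} (hg : g ≠ ∞) :
    ∑' m : ℕ, (m.factorial : ℝ≥0∞)⁻¹ * g ^ m = ENNReal.ofReal (Real.exp g.toReal) := by
  lift g to NNReal using hg
  have h := NormedSpace.expSeries_div_hasSum_exp (𝔸 := ℝ) (g : ℝ)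
  rw [← Real.exp_eq_exp_ℝ] at h
  rw [ENNReal.coe_toReal, ← h.tsum_eq, ENNReal.ofReal_tsum_of_nonneg (fun m => by positivity)
    h.summable]
  refine tsum_congr fun m => ?_
  rw [ENNReal.ofReal_div_of_pos (by positivity), ENNReal.ofReal_pow (by positivity),
    ENNReal.ofReal_coe_nnreal, ENNReal.ofReal_natCast, ENNReal.div_eq_inv_mul]

/-- Exponential moments of compound Poisson sums. -/
theorem expOp_exp (θ s : ℝ) (h : avg μ (fun x => ENNReal.ofReal (Real.exp (θ * c x))) ≠ ∞) :
    expOp c μ (fun s => ENNReal.ofReal (Real.exp (θ * s))) s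
      = ENNReal.ofReal (Real.exp (θ * s +
          (avg μ (fun x => ENNReal.ofReal (Real.exp (θ * c x)))).toReal)) := by
  set g := avg μ (fun x => ENNReal.ofReal (Real.exp (θ * c x)))
  -- Exponentials are eigenfunctions of `shiftOp`, with eigenvalue `g`; its exponential series then
  -- acts as multiplication by e^g.
  have h1 : ∀ s, shiftOp c μ (fun s => ENNReal.ofReal (Real.exp (θ * s))) s
      = g * ENNReal.ofReal (Real.exp (θ * s)) := fun s => by
    rw [shiftOp_eq_avg, mul_comm, ← avg_const_mul]
    congr 1
    funext x
    rw [← ENNReal.ofReal_mul (Real.exp_nonneg _), ← Real.exp_add, mul_add]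
  have h2 : ∀ m s, (shiftOp c μ)^[m] (fun s => ENNReal.ofReal (Real.exp (θ * s))) s
      = g ^ m * ENNReal.ofReal (Real.exp (θ * s)) := fun m => by
    induction m with
    | zero => simp
    | succ m ih =>
      intro s
      rw [Function.iterate_succ_apply', funext ih, shiftOp_const_mul, h1, pow_succ, mul_assoc]
  simp only [expOp, h2, ← mul_assoc, ENNReal.tsum_mul_right]
  rw [tsum_pow_div_factorial h, ← ENNReal.ofReal_mul (Real.exp_nonneg _), ← Real.exp_add, add_comm]

/-- Tilting the weights by `e^c` tilts the compound Poisson sums by `e^s`. -/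
theorem expOp_tilt (s : ℝ) :
    expOp c μ (fun s => ENNReal.ofReal (Real.exp s) * φ s) s
      = ENNReal.ofReal (Real.exp s) *
        expOp c (fun x => μ x * ENNReal.ofReal (Real.exp (c x))) φ s := by
  have h : ∀ m s, (shiftOp c μ)^[m] (fun s => ENNReal.ofReal (Real.exp s) * φ s) s
      = ENNReal.ofReal (Real.exp s) *
        (shiftOp c (fun x => μ x * ENNReal.ofReal (Real.exp (c x))))^[m] φ s := by
    intro m
    induction m with
    | zero => intro s; rfl
    | succ m ih =>
      intro s
      rw [Function.iterate_succ_apply', Function.iterate_succ_apply', funext ih]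
      simp only [shiftOp, ← ENNReal.tsum_mul_left]
      refine tsum_congr fun x => ?_
      rw [Real.exp_add, ENNReal.ofReal_mul (Real.exp_nonneg _)]
      ring
  simp only [expOp, h, ← ENNReal.tsum_mul_left, mul_left_comm]

end Weights

/-! ### The laws of the messages on the Poisson tree -/

/-- Parameters of the model in the nondegenerate case. -/
structure Params where
  n : ℕ
  K : ℕ
  p : ℝ
  q : ℝ
  K_pos : 0 < K
  K_lt : K < n
  q_pos : 0 < q
  q_le : q ≤ p

namespace Params

variable (P : Params)

/-- The ratio `ν`. -/
def ν : ℝ := nu P.n P.K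

/-- The signal to noise ratio. -/
def lam : ℝ := snr P.n P.K P.p P.q

/-- The constant term of the messages. -/
def off : ℝ := -(P.K * (P.p - P.q))

/-- The contribution of an incoming message. -/
def con (x : ℝ) : ℝ := contribution P.n P.K P.p P.q x

/-- The expected numbers of neighbors inside the community. -/
def rate (b : Bool) : ℝ := if b then P.p else P.q

/-- The expected number of neighbors of a vertex. -/
def degree (b : Bool) : ℝ := P.K * P.rate b + (P.n - P.K) * P.q

/-- The combined weights of the messages from all neighbors, if messages from inside and outside
the community have the weights `μ₁` and `μ₀`. -/
def mix (b : Bool) (μ₁ μ₀ : ℝ → ℝ≥0∞) (x : ℝ) : ℝ≥0∞ :=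
  ENNReal.ofReal (P.K * P.rate b) * μ₁ x + ENNReal.ofReal ((P.n - P.K) * P.q) * μ₀ x

open Classical in
/-- The law of the messages after `t` iterations on the Poisson tree, if the root is inside
(`b = true`) or outside (`b = false`) the community. -/
def law : ℕ → Bool → ℝ → ℝ≥0∞
  | 0, _ => Pi.single 0 1
  | t + 1, b => fun y => ENNReal.ofReal (Real.exp (-P.degree b)) *
      expOp P.con (P.mix b (law t true) (law t false)) (Pi.single y 1) P.off

/-- The weights of the messages from all neighbors. -/
def mixLaw (t : ℕ) (b : Bool) : ℝ → ℝ≥0∞ := P.mix b (P.law t true) (P.law t false)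

theorem tsum_single (φ : ℝ → ℝ≥0∞) (s : ℝ) :
    (∑' y, φ y * (Pi.single y 1 : ℝ → ℝ≥0∞) s) = φ s := by
  classical
  rw [tsum_eq_single s (fun y hy => by rw [Pi.single_eq_of_ne hy.symm, mul_zero])]
  simp

theorem avg_law_zero (b : Bool) (φ : ℝ → ℝ≥0∞) : avg (P.law 0 b) φ = φ 0 := by
  classical
  rw [avg, tsum_eq_single 0 (fun y hy => by
    simp only [law]; rw [Pi.single_eq_of_ne hy, zero_mul])]
  simp [law]

/-- `law` is defined by point masses only; the formula extends to all `φ` because `φ` is a sum of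
multiples of point masses and `expOp` commutes with such sums. -/
theorem avg_law_succ (t : ℕ) (b : Bool) (φ : ℝ → ℝ≥0∞) :
    avg (P.law (t + 1) b) φ
      = ENNReal.ofReal (Real.exp (-P.degree b)) * expOp P.con (P.mixLaw t b) φ P.off := by
  classical
  have h : φ = fun s => ∑' y, φ y * (Pi.single y 1 : ℝ → ℝ≥0∞) s :=
    funext fun s => (tsum_single φ s).symm
  conv_rhs => rw [h, expOp_tsum]
  rw [← ENNReal.tsum_mul_left, avg]
  refine tsum_congr fun y => ?_
  rw [expOp_const_mul, law, mixLaw]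
  simp only [Pi.single]
  ring

theorem n_sub_K_pos : (0 : ℝ) < P.n - P.K := by
  have := P.K_lt
  rw [sub_pos]; exact_mod_cast this

theorem K_cast_pos : (0 : ℝ) < P.K := by exact_mod_cast P.K_pos

theorem p_pos : 0 < P.p := P.q_pos.trans_le P.q_le

theorem rate_pos (b : Bool) : 0 < P.rate b := by
  cases b <;> simp [rate, P.q_pos, P.p_pos]

theorem exp_neg_ν : Real.exp (-P.ν) = P.K / (P.n - P.K) := by
  have h := div_pos P.n_sub_K_pos P.K_cast_pos
  rw [Real.exp_neg, ν, nu, Real.exp_log h, inv_div]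

theorem avg_mix (b : Bool) (μ₁ μ₀ φ : ℝ → ℝ≥0∞) :
    avg (P.mix b μ₁ μ₀) φ = ENNReal.ofReal (P.K * P.rate b) * avg μ₁ φ
      + ENNReal.ofReal ((P.n - P.K) * P.q) * avg μ₀ φ := by
  simp only [avg, mix, add_mul, ENNReal.tsum_add, ← ENNReal.tsum_mul_left, mul_assoc]

theorem degree_nonneg (b : Bool) : 0 ≤ P.degree b :=
  add_nonneg (mul_nonneg P.K_cast_pos.le (P.rate_pos b).le)
    (mul_nonneg P.n_sub_K_pos.le P.q_pos.le)

theorem avg_law_one (t : ℕ) (b : Bool) : avg (P.law t b) (fun _ => 1) = 1 := by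
  induction t generalizing b with
  | zero => rw [avg_law_zero]
  | succ t ih =>
    have h1 : avg (P.mixLaw t b) (fun _ => 1) = ENNReal.ofReal (P.degree b) := by
      rw [mixLaw, avg_mix, ih, ih, mul_one, mul_one, ← ENNReal.ofReal_add, degree]
      · exact mul_nonneg P.K_cast_pos.le (P.rate_pos b).le
      · exact mul_nonneg P.n_sub_K_pos.le P.q_pos.le
    -- The total mass is the exponential moment with θ = 0.
    have h2 := expOp_exp (c := P.con) (μ := P.mixLaw t b) 0 P.off
    simp only [zero_mul, Real.exp_zero, ENNReal.ofReal_one, zero_add, h1] at h2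
    rw [avg_law_succ, h2 ENNReal.ofReal_ne_top, ENNReal.toReal_ofReal (P.degree_nonneg b),
      ← ENNReal.ofReal_mul (Real.exp_nonneg _), ← Real.exp_add]
    simp

theorem tsum_law (t : ℕ) (b : Bool) : ∑' x, P.law t b x = 1 := by
  simpa [avg] using P.avg_law_one t b

/-- The likelihood ratio of a single message. -/
def ratio (x : ℝ) : ℝ :=
  (Real.exp (x - P.ν) * (P.p / P.q) + 1) / (Real.exp (x - P.ν) + 1)

theorem ratio_pos (x : ℝ) : 0 < P.ratio x := by
  have := div_pos P.p_pos P.q_pos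
  unfold ratio
  positivity

theorem exp_con (x : ℝ) : Real.exp (P.con x) = P.ratio x := Real.exp_log (P.ratio_pos x)

/-- Relative to the law outside the community, messages with value x arrive with density K q e^x +
(n - K) q at a vertex outside and K p e^x + (n - K) q at a vertex inside. Thus `ratio` is the
likelihood ratio of one incoming message. -/
theorem ratio_mul (x : ℝ) :
    (P.K * P.q * Real.exp x + (P.n - P.K) * P.q) * P.ratio x
      = P.K * P.p * Real.exp x + (P.n - P.K) * P.q := by
  have h1 := P.n_sub_K_pos
  have h2 := P.K_cast_pos
  have h3 := P.q_pos
  have h4 : 0 < Real.exp x := Real.exp_pos x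
  rw [ratio, sub_eq_add_neg x, Real.exp_add, exp_neg_ν]
  field_simp

/-- The messages are log likelihood ratios. -/
theorem law_true (t : ℕ) (x : ℝ) :
    P.law t true x = P.law t false x * ENNReal.ofReal (Real.exp x) ∧
    P.mixLaw t true x = P.mixLaw t false x * ENNReal.ofReal (Real.exp (P.con x)) := by
  have step : ∀ t, (∀ x, P.law t true x = P.law t false x * ENNReal.ofReal (Real.exp x)) →
      ∀ x, P.mixLaw t true x = P.mixLaw t false x * ENNReal.ofReal (Real.exp (P.con x)) := by
    intro t ht x
    have e : 0 ≤ Real.exp x := Real.exp_nonneg x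
    have a1 : 0 ≤ (P.n - P.K) * P.q := mul_nonneg P.n_sub_K_pos.le P.q_pos.le
    have a2 : ∀ b, 0 ≤ P.K * P.rate b := fun b => mul_nonneg P.K_cast_pos.le (P.rate_pos b).le
    have h : ∀ b, P.mixLaw t b x = P.law t false x
        * ENNReal.ofReal (P.K * P.rate b * Real.exp x + (P.n - P.K) * P.q) := fun b => by
      rw [mixLaw, mix, ht, ENNReal.ofReal_add (mul_nonneg (a2 b) e) a1,
        ENNReal.ofReal_mul (a2 b)]
      ring
    rw [h, h, exp_con, mul_assoc (P.law t false x), ← ENNReal.ofReal_mul (add_nonneg (mul_nonneg (a2 _) e) a1)]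
    congr 2
    exact (P.ratio_mul x).symm
  induction t generalizing x with
  | zero =>
    have h : ∀ x, P.law 0 true x = P.law 0 false x * ENNReal.ofReal (Real.exp x) := by
      intro x
      simp only [law]
      rcases eq_or_ne x 0 with rfl | hx
      · simp
      · rw [Pi.single_eq_of_ne hx, zero_mul]
    exact ⟨h x, step 0 h x⟩
  | succ t ih =>
    have h : ∀ x, P.law (t + 1) true x = P.law (t + 1) false x * ENNReal.ofReal (Real.exp x) := by
      intro x
      have h1 : (fun s => ENNReal.ofReal (Real.exp s) * (Pi.single x 1 : ℝ → ℝ≥0∞) s)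
          = fun s => ENNReal.ofReal (Real.exp x) * (Pi.single x 1 : ℝ → ℝ≥0∞) s := by
        funext s
        rcases eq_or_ne s x with rfl | hs
        · rfl
        · rw [Pi.single_eq_of_ne hs, mul_zero, mul_zero]
      -- Tilting every summand by e^{con} tilts the sum by e^s, including the starting value `off`.
      have h2 := expOp_tilt (c := P.con) (μ := P.mixLaw t false) (φ := Pi.single x 1) P.off
      rw [h1, expOp_const_mul, ← funext fun x => (ih x).2] at h2
      -- The factor e^{off} is exactly the quotient of the two normalizing constants.
      have h3 : Real.exp (-P.degree true) = Real.exp (-P.degree false) * Real.exp P.off := by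
        rw [← Real.exp_add]
        congr 1
        simp only [degree, off, rate]
        simp
        ring
      have h4 : ∀ b, P.law (t + 1) b x = ENNReal.ofReal (Real.exp (-P.degree b)) *
        expOp P.con (P.mixLaw t b) (Pi.single x 1) P.off := fun b => by
          simp only [law, mixLaw]
      rw [h4, h4, h3, ENNReal.ofReal_mul (Real.exp_nonneg _), mul_assoc, ← h2]
      ring
    exact ⟨h x, step (t + 1) h x⟩

theorem avg_law_true (t : ℕ) (φ : ℝ → ℝ≥0∞) :
    avg (P.law t true) φ = avg (P.law t false) (fun x => ENNReal.ofReal (Real.exp x) * φ x) :=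
  tsum_congr fun x => by rw [(P.law_true t x).1, mul_assoc]

end Params

namespace Params

variable (P : Params)

/-! ### Moments of the messages on the Poisson tree -/

/-- The weight that a message puts on the community. -/
def gain (x : ℝ) : ℝ := Real.exp x / (1 + Real.exp (x - P.ν))

/-- The signal strength `b_t = E₁ [e^Λ / (1 + e^{Λ - ν})]` of the messages after `t` iterations. -/
def signal (t : ℕ) : ℝ := (avg (P.law t true) (fun x => ENNReal.ofReal (P.gain x))).toReal

theorem gain_nonneg (x : ℝ) : 0 ≤ P.gain x := by unfold gain; positivity

theorem gain_le (x : ℝ) : P.gain x ≤ Real.exp P.ν := by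
  unfold gain
  rw [div_le_iff₀ (by positivity), mul_add, ← Real.exp_add]
  have : P.ν + (x - P.ν) = x := by ring
  rw [this, mul_one]
  linarith [Real.exp_pos P.ν]

theorem avg_law_ne_top (t : ℕ) (b : Bool) {h : ℝ → ℝ} {B : ℝ} (hB : ∀ x, h x ≤ B) :
    avg (P.law t b) (fun x => ENNReal.ofReal (h x)) ≠ ∞ := by
  have h1 : avg (P.law t b) (fun x => ENNReal.ofReal (h x)) ≤ ENNReal.ofReal B := by
    calc _ ≤ avg (P.law t b) (fun _ => ENNReal.ofReal B * 1) :=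
          avg_mono fun x => by rw [mul_one]; exact ENNReal.ofReal_le_ofReal (hB x)
      _ = _ := by rw [avg_const_mul, avg_law_one, mul_one]
  exact ne_top_of_le_ne_top ENNReal.ofReal_ne_top h1

theorem avg_mixLaw_ne_top (t : ℕ) (b : Bool) {h : ℝ → ℝ} {B : ℝ} (hB : ∀ x, h x ≤ B) :
    avg (P.mixLaw t b) (fun x => ENNReal.ofReal (h x)) ≠ ∞ := by
  rw [mixLaw, avg_mix]
  exact ENNReal.add_ne_top.2 ⟨ENNReal.mul_ne_top ENNReal.ofReal_ne_top (P.avg_law_ne_top t _ hB),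
    ENNReal.mul_ne_top ENNReal.ofReal_ne_top (P.avg_law_ne_top t _ hB)⟩

theorem one_le_ratio (x : ℝ) : 1 ≤ P.ratio x := by
  have h : 1 ≤ P.p / P.q := (one_le_div P.q_pos).2 P.q_le
  have h' := Real.exp_pos (x - P.ν)
  rw [ratio, le_div_iff₀ (by positivity)]
  nlinarith

theorem ratio_le (x : ℝ) : P.ratio x ≤ P.p / P.q := by
  have h : 1 ≤ P.p / P.q := (one_le_div P.q_pos).2 P.q_le
  have h' := Real.exp_pos (x - P.ν)
  rw [ratio, div_le_iff₀ (by positivity)]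
  nlinarith

/-- The integral of a real function against the weights of the messages from all neighbors of a
vertex outside the community. -/
def mean (t : ℕ) (h : ℝ → ℝ) : ℝ := (avg (P.mixLaw t false) (fun x => ENNReal.ofReal (h x))).toReal

theorem mean_mono (t : ℕ) {h g : ℝ → ℝ} {B : ℝ} (hB : ∀ x, g x ≤ B) (hg : ∀ x, h x ≤ g x) :
    P.mean t h ≤ P.mean t g :=
  ENNReal.toReal_mono (P.avg_mixLaw_ne_top t false hB)
    (avg_mono fun x => ENNReal.ofReal_le_ofReal (hg x))

theorem mean_add (t : ℕ) {h g : ℝ → ℝ} {B : ℝ} (hh : ∀ x, 0 ≤ h x ∧ h x ≤ B)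
    (hg : ∀ x, 0 ≤ g x ∧ g x ≤ B) :
    P.mean t (fun x => h x + g x) = P.mean t h + P.mean t g := by
  unfold mean
  rw [← ENNReal.toReal_add (P.avg_mixLaw_ne_top t false fun x => (hh x).2)
    (P.avg_mixLaw_ne_top t false fun x => (hg x).2), ← avg_add]
  congr 2
  funext x
  exact ENNReal.ofReal_add (hh x).1 (hg x).1

theorem mean_const_mul (t : ℕ) {h : ℝ → ℝ} {a : ℝ} (ha : 0 ≤ a) :
    P.mean t (fun x => a * h x) = a * P.mean t h := by
  unfold mean
  simp only [ENNReal.ofReal_mul ha, avg_const_mul, ENNReal.toReal_mul, ENNReal.toReal_ofReal ha]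

theorem avg_mixLaw_one (t : ℕ) (b : Bool) :
    avg (P.mixLaw t b) (fun _ => 1) = ENNReal.ofReal (P.degree b) := by
  rw [mixLaw, avg_mix, avg_law_one, avg_law_one, mul_one, mul_one, ← ENNReal.ofReal_add, degree]
  · exact mul_nonneg P.K_cast_pos.le (P.rate_pos b).le
  · exact mul_nonneg P.n_sub_K_pos.le P.q_pos.le

theorem mean_one (t : ℕ) : P.mean t (fun _ => 1) = P.degree false := by
  unfold mean
  simp only [ENNReal.ofReal_one, avg_mixLaw_one, ENNReal.toReal_ofReal (P.degree_nonneg false)]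

/-- The density `ratio` turns the incoming weights outside the community into those inside, whose
mass is the degree of an inner vertex. -/
theorem mean_ratio (t : ℕ) : P.mean t P.ratio = P.degree false - P.off := by
  have h : P.degree false - P.off = P.degree true := by
    simp only [degree, off, rate]; simp; ring
  rw [h, ← ENNReal.toReal_ofReal (P.degree_nonneg true), ← avg_mixLaw_one P t true]
  unfold mean avg
  congr 1
  refine tsum_congr fun x => ?_
  rw [mul_one, (P.law_true t x).2, exp_con]

theorem mean_eq_avg_law (t : ℕ) {h : ℝ → ℝ} (hh : ∀ x, 0 ≤ h x) :
    P.mean t h = (avg (P.law t false) (fun x => ENNReal.ofReal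
      ((P.K * P.q * Real.exp x + (P.n - P.K) * P.q) * h x))).toReal := by
  unfold mean
  congr 1
  rw [mixLaw, avg_mix, avg_law_true, ← avg_const_mul, ← avg_const_mul, ← avg_add]
  congr 1
  funext x
  have e : 0 ≤ Real.exp x := Real.exp_nonneg x
  have a1 : 0 ≤ (P.n - P.K) * P.q := mul_nonneg P.n_sub_K_pos.le P.q_pos.le
  have a2 : 0 ≤ P.K * P.q := mul_nonneg P.K_cast_pos.le P.q_pos.le
  have a3 : P.rate false = P.q := rfl
  rw [a3, ← ENNReal.ofReal_mul e, ← ENNReal.ofReal_mul a2, ← ENNReal.ofReal_mul a1,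
    ← ENNReal.ofReal_add (mul_nonneg a2 (mul_nonneg e (hh x))) (mul_nonneg a1 (hh x))]
  congr 1
  ring

theorem lam_nonneg : 0 ≤ P.lam := by
  have h1 := P.n_sub_K_pos
  have h3 := P.q_pos
  unfold lam snr
  positivity

/-- The recursion closes here: (K q e^x + (n - K) q) (r - 1)² = λ e^x gain(x), and the factor e^x
passes from the law outside to the law inside the community. -/
theorem mean_sq (t : ℕ) : P.mean t (fun x => (P.ratio x - 1) ^ 2) = P.lam * P.signal t := by
  rw [mean_eq_avg_law P t (fun x => sq_nonneg _), signal, avg_law_true,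
    ← ENNReal.toReal_ofReal P.lam_nonneg, ← ENNReal.toReal_mul, ← avg_const_mul]
  congr 2
  funext x
  rw [← ENNReal.ofReal_mul (Real.exp_nonneg _), ← ENNReal.ofReal_mul P.lam_nonneg]
  congr 1
  have h1 := P.n_sub_K_pos
  have h2 := P.K_cast_pos
  have h3 := P.q_pos
  have h4 : 0 < Real.exp x := Real.exp_pos x
  rw [ratio, gain, lam, snr, sub_eq_add_neg x, Real.exp_add, exp_neg_ν]
  field_simp
  ring

/-- Exponential moments of the messages. -/
theorem avg_exp (t : ℕ) (θ : ℝ) {h : ℝ → ℝ} {B : ℝ} (hB : ∀ x, h x ≤ B)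
    (hh : ∀ x, Real.exp (θ * P.con x) = h x) :
    avg (P.law (t + 1) false) (fun x => ENNReal.ofReal (Real.exp (θ * x)))
      = ENNReal.ofReal (Real.exp (-P.degree false + θ * P.off + P.mean t h)) := by
  have h1 := P.avg_mixLaw_ne_top t false hB
  have h2 := expOp_exp (c := P.con) (μ := P.mixLaw t false) θ P.off
  simp only [hh] at h2
  rw [avg_law_succ, h2 h1, ← ENNReal.ofReal_mul (Real.exp_nonneg _), ← Real.exp_add, add_assoc]
  rfl

theorem ratio_bounds (x : ℝ) : 0 ≤ P.ratio x ∧ 1 ≤ P.ratio x ∧ P.ratio x ≤ P.p / P.q :=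
  ⟨(P.ratio_pos x).le, P.one_le_ratio x, P.ratio_le x⟩

/-- Write r² = (r - 1)² + 2r - 1. The terms 2r - 1 cancel against the degree and twice the offset,
and (r - 1)² contributes λ b_t. -/
theorem avg_exp_two (t : ℕ) :
    avg (P.law (t + 1) false) (fun x => ENNReal.ofReal (Real.exp (2 * x)))
      = ENNReal.ofReal (Real.exp (P.lam * P.signal t)) := by
  set R := P.p / P.q
  have hr := P.ratio_bounds
  have hB : ∀ x, P.ratio x ^ 2 ≤ R ^ 2 + 1 + 2 * R := fun x => by nlinarith [hr x]
  rw [P.avg_exp t 2 hB (fun x => by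
    rw [← exp_con, ← Real.exp_nat_mul]; norm_num)]
  congr 2
  -- `mean` truncates negative values, so it is additive only on nonnegative functions; the identity
  -- is arranged without differences.
  have h1 := P.mean_add t (h := fun x => P.ratio x ^ 2) (g := fun _ => 1)
    (B := R ^ 2 + 1 + 2 * R) (fun x => ⟨sq_nonneg _, hB x⟩)
    (fun x => ⟨zero_le_one, by nlinarith [hr x]⟩)
  have h2 := P.mean_add t (h := fun x => (P.ratio x - 1) ^ 2) (g := fun x => 2 * P.ratio x)
    (B := R ^ 2 + 1 + 2 * R) (fun x => ⟨sq_nonneg _, by nlinarith [hr x]⟩)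
    (fun x => ⟨by nlinarith [hr x], by nlinarith [hr x]⟩)
  have h3 : (fun x => P.ratio x ^ 2 + 1) = fun x => (P.ratio x - 1) ^ 2 + 2 * P.ratio x := by
    funext x; ring
  rw [h3, h2, mean_sq, mean_const_mul P t (by norm_num : (0 : ℝ) ≤ 2), mean_ratio, mean_one] at h1
  linarith

/-- Here r³ = (r - 1)² (r + 2) + 3r - 2, where r + 2 ≤ p/q + 2 and the linear part cancels. -/
theorem avg_exp_three (t : ℕ) :
    avg (P.law (t + 1) false) (fun x => ENNReal.ofReal (Real.exp (3 * x)))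
      ≤ ENNReal.ofReal (Real.exp ((P.p / P.q + 2) * P.lam * P.signal t)) := by
  set R := P.p / P.q
  have hr := P.ratio_bounds
  have hR : 1 ≤ R := (hr 0).2.1.trans (hr 0).2.2
  have hB0 : ∀ x, P.ratio x ^ 3 ≤ R ^ 3 := fun x => pow_le_pow_left₀ (hr x).1 (hr x).2.2 3
  have hsq : ∀ x, (P.ratio x - 1) ^ 2 ≤ R ^ 2 := fun x =>
    pow_le_pow_left₀ (by linarith [hr x]) (by linarith [hr x]) 2
  have hB1 : ∀ x, (P.ratio x - 1) ^ 2 * (P.ratio x + 2) ≤ R ^ 2 * (R + 2) := fun x =>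
    mul_le_mul (hsq x) (by linarith [hr x]) (by linarith [hr x]) (sq_nonneg _)
  set B := R ^ 3 + 2 + R ^ 2 * (R + 2) + 3 * R with hBdef
  have p1 : 0 ≤ R ^ 3 := by positivity
  have p2 : 0 ≤ R ^ 2 * (R + 2) := by positivity
  rw [P.avg_exp t 3 (h := fun x => P.ratio x ^ 3) (B := B) (fun x => by linarith [hB0 x]) (fun x => by
    rw [← exp_con, ← Real.exp_nat_mul]; norm_num)]
  refine ENNReal.ofReal_le_ofReal (Real.exp_le_exp.2 ?_)
  have h1 := P.mean_add t (h := fun x => P.ratio x ^ 3) (g := fun _ => 2 * 1)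
    (B := B) (fun x => ⟨pow_nonneg (hr x).1 3, by linarith [hB0 x]⟩)
    (fun x => ⟨by norm_num, by linarith [hr x]⟩)
  have h2 := P.mean_add t (h := fun x => (P.ratio x - 1) ^ 2 * (P.ratio x + 2))
    (g := fun x => 3 * P.ratio x)
    (B := B) (fun x => ⟨mul_nonneg (sq_nonneg _) (by linarith [hr x]), by linarith [hB1 x]⟩)
    (fun x => ⟨by linarith [hr x], by linarith [hr x]⟩)
  have h3 : (fun x => P.ratio x ^ 3 + 2 * 1)
      = fun x => (P.ratio x - 1) ^ 2 * (P.ratio x + 2) + 3 * P.ratio x := by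
    funext x; ring
  have h4 : P.mean t (fun x => (P.ratio x - 1) ^ 2 * (P.ratio x + 2))
      ≤ (R + 2) * (P.lam * P.signal t) := by
    rw [← mean_sq, ← mean_const_mul P t (by linarith : (0 : ℝ) ≤ R + 2)]
    refine P.mean_mono t (B := (R + 2) * R ^ 2) (fun x => ?_) (fun x => ?_)
    · exact mul_le_mul_of_nonneg_left (hsq x) (by linarith)
    · rw [mul_comm]
      exact mul_le_mul_of_nonneg_right (by linarith [hr x]) (sq_nonneg _)
  rw [h3, h2, mean_const_mul P t (by norm_num : (0 : ℝ) ≤ 3),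
    mean_const_mul P t (by norm_num : (0 : ℝ) ≤ 2), mean_ratio, mean_one] at h1
  linarith

/-- The rate at which the signal strength enters the Bhattacharyya coefficient. -/
def exponent (lam M : ℝ) : ℝ := lam / (2 * (√M + 1) ^ 2)

/-- Now 2√r = r + 1 - (√r - 1)², where r + 1 cancels, and (r - 1)² ≤ (√M + 1)² (√r - 1)² brings in λ
b_t. -/
theorem avg_exp_half (t : ℕ) {M : ℝ} (hM : P.p / P.q ≤ M) :
    avg (P.law (t + 1) false) (fun x => ENNReal.ofReal (Real.exp (1 / 2 * x)))
      ≤ ENNReal.ofReal (Real.exp (-(exponent P.lam M * P.signal t))) := by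
  set R := P.p / P.q
  have hr := P.ratio_bounds
  have hR : 1 ≤ R := (hr 0).2.1.trans (hr 0).2.2
  have hs : ∀ x, √(P.ratio x) ^ 2 = P.ratio x := fun x => Real.sq_sqrt (hr x).1
  have hs1 : ∀ x, 1 ≤ √(P.ratio x) := fun x => Real.one_le_sqrt.2 (hr x).2.1
  have hsM : ∀ x, √(P.ratio x) ≤ √M := fun x => Real.sqrt_le_sqrt ((hr x).2.2.trans hM)
  have hM0 : 0 ≤ √M := Real.sqrt_nonneg M
  have hsR : ∀ x, √(P.ratio x) ≤ R := fun x => by nlinarith [hs x, hs1 x, hr x]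
  rw [P.avg_exp t (1 / 2) hsR (fun x => by
    rw [← exp_con, Real.sqrt_eq_rpow, ← Real.exp_mul, mul_comm])]
  refine ENNReal.ofReal_le_ofReal (Real.exp_le_exp.2 ?_)
  have hsq : ∀ x, (√(P.ratio x) - 1) ^ 2 ≤ R := fun x => by nlinarith [hs x, hs1 x, hr x]
  have h1 := P.mean_add t (h := fun x => 2 * √(P.ratio x)) (g := fun x => (√(P.ratio x) - 1) ^ 2)
    (B := 2 * R) (fun x => ⟨by linarith [hs1 x], by linarith [hsR x]⟩)
    (fun x => ⟨sq_nonneg _, by linarith [hsq x]⟩)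
  have h2 := P.mean_add t (h := P.ratio) (g := fun _ => 1)
    (B := 2 * R) (fun x => ⟨(hr x).1, by linarith [hr x]⟩) (fun x => ⟨by norm_num, by linarith⟩)
  have h3 : (fun x => 2 * √(P.ratio x) + (√(P.ratio x) - 1) ^ 2) = fun x => P.ratio x + 1 := by
    funext x; nlinarith [hs x]
  have h4 : P.lam * P.signal t ≤ (√M + 1) ^ 2 * P.mean t (fun x => (√(P.ratio x) - 1) ^ 2) := by
    rw [← mean_sq, ← mean_const_mul P t (sq_nonneg _)]
    refine P.mean_mono t (B := (√M + 1) ^ 2 * R) (fun x => ?_) (fun x => ?_)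
    · exact mul_le_mul_of_nonneg_left (hsq x) (sq_nonneg _)
    · rw [← mul_pow]
      have : P.ratio x - 1 = (√(P.ratio x) + 1) * (√(P.ratio x) - 1) := by nlinarith [hs x]
      rw [this]
      refine pow_le_pow_left₀ (mul_nonneg (by linarith [hs1 x]) (by linarith [hs1 x])) ?_ 2
      exact mul_le_mul_of_nonneg_right (by linarith [hsM x]) (by linarith [hs1 x])
  have h5 : exponent P.lam M * P.signal t
      ≤ 1 / 2 * P.mean t (fun x => (√(P.ratio x) - 1) ^ 2) := by
    unfold exponent
    rw [div_mul_eq_mul_div, div_le_iff₀ (by positivity)]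
    nlinarith [h4]
  rw [h3, h2, mean_const_mul P t (by norm_num : (0 : ℝ) ≤ 2), mean_ratio, mean_one] at h1
  linarith

/-- By the change of measure e^x, both types of error are controlled by the same Bhattacharyya
coefficient. -/
theorem avg_law_true_neg_half (t : ℕ) :
    avg (P.law t true) (fun x => ENNReal.ofReal (Real.exp (-(1 / 2) * x)))
      = avg (P.law t false) (fun x => ENNReal.ofReal (Real.exp (1 / 2 * x))) := by
  rw [avg_law_true]
  congr 1
  funext x
  rw [← ENNReal.ofReal_mul (Real.exp_nonneg _), ← Real.exp_add]
  ring_nf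

/-! ### Growth of the signal strength -/

theorem half_le_signal_zero (hν : 0 ≤ P.ν) : 1 / 2 ≤ P.signal 0 := by
  rw [signal, avg_law_zero, ENNReal.toReal_ofReal (P.gain_nonneg 0), gain, Real.exp_zero,
    div_le_div_iff₀ two_pos (by positivity)]
  have : Real.exp (0 - P.ν) ≤ 1 := Real.exp_le_one_iff.2 (by linarith)
  linarith

theorem ofReal_signal (t : ℕ) :
    ENNReal.ofReal (P.signal t) = avg (P.law t true) (fun x => ENNReal.ofReal (P.gain x)) :=
  ENNReal.ofReal_toReal (P.avg_law_ne_top t true P.gain_le)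

theorem signal_nonneg (t : ℕ) : 0 ≤ P.signal t := ENNReal.toReal_nonneg

/-- Use u/(1 + vu) ≥ u - v u² with u = e^x, v = e^{-ν}, and average inside the community. The first
and second moments of e^x there are the second and third moments outside. -/
theorem le_signal_succ (t : ℕ) {M : ℝ} (hM : P.p / P.q ≤ M) :
    Real.exp (P.lam * P.signal t) - Real.exp (-P.ν + (M + 2) * P.lam * P.signal t)
      ≤ P.signal (t + 1) := by
  have h1 : avg (P.law (t + 1) true) (fun x => ENNReal.ofReal (Real.exp x))
      ≤ avg (P.law (t + 1) true) (fun x => ENNReal.ofReal (P.gain x)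
        + ENNReal.ofReal (Real.exp (-P.ν)) * ENNReal.ofReal (Real.exp (2 * x))) := by
    refine avg_mono fun x => ?_
    rw [← ENNReal.ofReal_mul (Real.exp_nonneg _), ← ENNReal.ofReal_add (P.gain_nonneg x)
      (mul_nonneg (Real.exp_nonneg _) (Real.exp_nonneg _))]
    refine ENNReal.ofReal_le_ofReal ?_
    have e1 : Real.exp (2 * x) = Real.exp x * Real.exp x := by rw [← Real.exp_add]; ring_nf
    have e2 : Real.exp (x - P.ν) = Real.exp (-P.ν) * Real.exp x := by
      rw [← Real.exp_add]; ring_nf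
    rw [gain, e1, e2]
    set u := Real.exp x
    set v := Real.exp (-P.ν)
    have hu : 0 < u := Real.exp_pos x
    have hv : 0 < v := Real.exp_pos _
    have h2 : u - v * (u * u) ≤ u / (1 + v * u) := by
      rw [le_div_iff₀ (by positivity)]
      nlinarith [mul_pos (mul_pos hv hu) (mul_pos hv (mul_pos hu hu))]
    linarith
  rw [avg_add, avg_const_mul, avg_law_true, avg_law_true P (t + 1) (fun x =>
    ENNReal.ofReal (Real.exp (2 * x))), ← ofReal_signal] at h1
  simp only [← ENNReal.ofReal_mul (Real.exp_nonneg _), ← Real.exp_add] at h1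
  have e1 : ∀ x : ℝ, x + x = 2 * x := fun x => by ring
  have e2 : ∀ x : ℝ, x + 2 * x = 3 * x := fun x => by ring
  simp only [e1, e2] at h1
  rw [avg_exp_two] at h1
  have h2 := h1.trans (add_le_add_right (mul_le_mul_right (P.avg_exp_three t) _) _)
  rw [← ENNReal.ofReal_mul (Real.exp_nonneg _), ← Real.exp_add,
    ← ENNReal.ofReal_add (P.signal_nonneg _) (Real.exp_nonneg _),
    ENNReal.ofReal_le_ofReal_iff (add_nonneg (P.signal_nonneg _) (Real.exp_nonneg _))] at h2
  have h3 : Real.exp (-P.ν + (P.p / P.q + 2) * P.lam * P.signal t)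
      ≤ Real.exp (-P.ν + (M + 2) * P.lam * P.signal t) := by
    have := P.lam_nonneg
    have := P.signal_nonneg t
    gcongr
  linarith

/-- For x ≥ u the gain is at least e^u / 2, because u ≤ ν. The probability of x < u is at most
e^{u/2} times the Bhattacharyya coefficient. -/
theorem le_signal_succ_of_le (t : ℕ) {M : ℝ} (hM : P.p / P.q ≤ M) {u : ℝ} (hu : u ≤ P.ν) :
    Real.exp u / 2 * (1 - Real.exp (u / 2 - exponent P.lam M * P.signal t))
      ≤ P.signal (t + 1) := by
  have h1 : avg (P.law (t + 1) true) (fun _ => ENNReal.ofReal (Real.exp u / 2) * 1)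
      ≤ avg (P.law (t + 1) true) (fun x => ENNReal.ofReal (P.gain x)
        + ENNReal.ofReal (Real.exp u / 2 * Real.exp (u / 2))
          * ENNReal.ofReal (Real.exp (-(1 / 2) * x))) := by
    refine avg_mono fun x => ?_
    rw [mul_one, ← ENNReal.ofReal_mul (by positivity), ← ENNReal.ofReal_add (P.gain_nonneg x)
      (by positivity)]
    refine ENNReal.ofReal_le_ofReal ?_
    have g0 := P.gain_nonneg x
    have hu0 := Real.exp_pos u
    rcases le_total x u with hx | hx
    · have h2 : 1 ≤ Real.exp (u / 2) * Real.exp (-(1 / 2) * x) := by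
        rw [← Real.exp_add]
        exact Real.one_le_exp (by linarith)
      nlinarith
    · have h2 : Real.exp u / 2 ≤ P.gain x := by
        rw [gain, div_le_div_iff₀ two_pos (by positivity)]
        have h3 : Real.exp u ≤ Real.exp x := Real.exp_le_exp.2 hx
        have h4 : Real.exp u * Real.exp (x - P.ν) ≤ Real.exp x := by
          rw [← Real.exp_add]
          exact Real.exp_le_exp.2 (by linarith)
        linarith
      have : 0 ≤ Real.exp u / 2 * Real.exp (u / 2) * Real.exp (-(1 / 2) * x) := by positivity
      linarith
  rw [avg_add, avg_const_mul, avg_const_mul, avg_law_one, mul_one, avg_law_true_neg_half,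
    ← ofReal_signal] at h1
  have h2 := h1.trans (add_le_add_right (mul_le_mul_right (P.avg_exp_half t hM) _) _)
  rw [← ENNReal.ofReal_mul (by positivity),
    ← ENNReal.ofReal_add (P.signal_nonneg _) (by positivity),
    ENNReal.ofReal_le_ofReal_iff (add_nonneg (P.signal_nonneg _) (by positivity))] at h2
  rw [sub_eq_add_neg (u / 2), Real.exp_add]
  linarith

end Params

set_option maxHeartbeats 400000 in
/-- The growth of a sequence that satisfies the recursions of the signal strength: after
`t₀ + log* ν + 1` steps, where `t₀` depends only on `lam > 1 / e`, it exceeds all multiples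
of `ν`. -/
theorem exists_growth {lam : ℝ} (hlam : 1 / Real.exp 1 < lam) :
    ∃ t0 : ℕ, ∀ M : ℝ, 1 ≤ M → ∀ r : ℝ, ∃ ν0 : ℝ, 0 < ν0 ∧ ∀ ν : ℝ, ν0 ≤ ν → ∀ b : ℕ → ℝ,
      1 / 2 ≤ b 0 →
      (∀ t, Real.exp (lam * b t) - Real.exp (-ν + (M + 2) * lam * b t) ≤ b (t + 1)) →
      (∀ t u, u ≤ ν → Real.exp u / 2 * (1 - Real.exp (u / 2 - Params.exponent lam M * b t))
        ≤ b (t + 1)) →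
      r * ν ≤ Params.exponent lam M * b (t0 + logStar ν + 1) := by
  have he : 0 < Real.exp 1 := Real.exp_pos 1
  have hlam0 : 0 < lam := lt_trans (by positivity) hlam
  have hel : 1 < Real.exp 1 * lam := by
    rw [div_lt_iff₀ he] at hlam; linarith
  set y := 1 / lam with hy
  have hy0 : 0 < y := by positivity
  have hyl : y * lam = 1 := by rw [hy]; field_simp
  -- Large enough for 2 (y + B) ≤ e^{λB}: this slack pays for the factor a ≥ 1/2 and restores the
  -- additive constant in each step of the tower.
  set B := 8 * y ^ 2 + 8 with hB
  have hB0 : 0 < B := by positivity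
  have hBexp : 2 * (y + B) ≤ Real.exp (lam * B) := by
    have h1 := Real.quadratic_le_exp_of_nonneg (mul_pos hlam0 hB0).le
    have h2 : 2 * (y + B) ≤ (lam * B) ^ 2 / 2 := by
      have h3 : 4 * y ^ 2 * (y + B) ≤ B ^ 2 := by
        have : y ≤ B := by rw [hB]; nlinarith [sq_nonneg (y - 1)]
        have : 4 * y ^ 2 * y ≤ 4 * y ^ 2 * B := by gcongr
        nlinarith
      have h4 : B ^ 2 = y ^ 2 * (lam * B) ^ 2 := by
        have : (y * lam) ^ 2 = 1 := by rw [hyl, one_pow]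
        calc B ^ 2 = (y * lam) ^ 2 * B ^ 2 := by rw [this, one_mul]
          _ = _ := by ring
      rw [h4] at h3
      have h5 : 0 < y ^ 2 := by positivity
      have : y ^ 2 * (4 * (y + B)) ≤ y ^ 2 * (lam * B) ^ 2 := by linarith
      linarith [le_of_mul_le_mul_left this h5]
    have := mul_pos hlam0 hB0
    linarith
  -- The geometric rate lies strictly between 1 and eλ. The gap leaves room for the error term, and
  -- `t0` depends on `lam` only.
  set g := (Real.exp 1 * lam + 1) / 2 with hg
  have hg1 : 1 < g := by rw [hg]; linarith
  obtain ⟨t0, ht0⟩ := pow_unbounded_of_one_lt (2 * (y + B)) hg1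
  refine ⟨t0, fun M hM r => ?_⟩
  -- Chosen so that a eλ = g with 1/2 ≤ a < 1: the recursion may lose the fraction 1 - a.
  set a := (1 + 1 / (Real.exp 1 * lam)) / 2 with ha
  have ha1 : a < 1 := by
    have : 1 / (Real.exp 1 * lam) < 1 := by rw [div_lt_one (by positivity)]; exact hel
    rw [ha]; linarith
  have ha2 : 1 / 2 ≤ a := by
    have : 0 < 1 / (Real.exp 1 * lam) := by positivity
    rw [ha]; linarith
  have hag : a * (Real.exp 1 * lam) = g := by
    rw [ha, hg]; field_simp
  set c := Params.exponent lam M with hc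
  have hc0 : 0 < c := by
    rw [hc, Params.exponent]
    have : 0 ≤ √M := Real.sqrt_nonneg M
    positivity
  -- Below c1 ν the subtracted exponential is at most e^{λb} e^{-ν/2}.
  set c1 := 1 / (2 * (M + 1) * lam) with hc1
  have hM0 : 0 < M + 1 := by linarith
  have hc10 : 0 < c1 := by positivity
  -- With u = c2 ν the second recursion applies (u ≤ ν), and u ≤ c b as soon as b > c1 ν.
  set c2 := min (c * c1) 1 with hc2
  have hc20 : 0 < c2 := lt_min (by positivity) one_pos
  -- conditions that hold for all large `ν`
  have hT : Tendsto (fun ν : ℝ => Real.exp (c2 * ν) / ν) atTop atTop := by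
    have h1 := (Real.tendsto_exp_div_pow_atTop 1).comp (tendsto_id.const_mul_atTop hc20)
    have h2 := h1.const_mul_atTop hc20
    refine h2.congr' ?_
    filter_upwards [eventually_gt_atTop 0] with ν hν
    simp only [Function.comp, id, pow_one]
    field_simp
  have hev : ∀ᶠ ν : ℝ in atTop, 0 < ν ∧ 4 * (c1 + 1) ≤ Real.exp (c2 * ν) / ν ∧
      4 * (r / c) ≤ Real.exp (c2 * ν) / ν ∧ Real.exp (-(c2 / 2 * ν)) ≤ 1 / 2 ∧
      Real.exp (-(1 / 2 * ν)) ≤ 1 - a := by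
    have hE : ∀ d : ℝ, 0 < d → ∀ δ : ℝ, 0 < δ → ∀ᶠ ν : ℝ in atTop, Real.exp (-(d * ν)) ≤ δ := by
      intro d hd δ hδ
      have : Tendsto (fun ν : ℝ => Real.exp (-(d * ν))) atTop (𝓝 0) :=
        Real.tendsto_exp_neg_atTop_nhds_zero.comp (tendsto_id.const_mul_atTop hd)
      exact this.eventually_le_const hδ
    filter_upwards [eventually_gt_atTop 0, hT.eventually_ge_atTop _, hT.eventually_ge_atTop _,
      hE (c2 / 2) (by positivity) (1 / 2) (by norm_num), hE (1 / 2) (by norm_num) (1 - a)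
        (by linarith)] with ν h1 h2 h3 h4 h5
    exact ⟨h1, h2, h3, h4, h5⟩
  obtain ⟨ν0, hν0⟩ := eventually_atTop.1 hev
  refine ⟨max ν0 1, by positivity, fun ν hν b hb0 hb1 hb2 => ?_⟩
  obtain ⟨hνpos, e1, e2, e3, e4⟩ := hν0 ν ((le_max_left _ _).trans hν)
  rw [le_div_iff₀ hνpos] at e1 e2
  -- after the first passage of `c1 * ν`
  have hjump : ∀ t, c1 * ν < b t → Real.exp (c2 * ν) / 4 ≤ b (t + 1) := by
    intro t ht
    have h1 := hb2 t (c2 * ν) (by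
      calc c2 * ν ≤ 1 * ν := by gcongr; exact min_le_right _ _
        _ = ν := one_mul ν)
    have h2 : c2 * ν ≤ c * b t := by
      calc c2 * ν ≤ c * c1 * ν := by gcongr; exact min_le_left _ _
        _ ≤ c * b t := by rw [mul_assoc]; gcongr
    have h3 : Real.exp (c2 * ν / 2 - c * b t) ≤ 1 / 2 :=
      (Real.exp_le_exp.2 (by linarith)).trans e3
    nlinarith [Real.exp_pos (c2 * ν)]
  -- Monotonicity of `b` is not available; but a value above c1 ν is followed by one of at least
  -- e^{c2 ν}/4, which is again above c1 ν.
  have hstay : ∀ s, c1 * ν < b s → ∀ k, c1 * ν < b (s + k) := by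
    intro s hs k
    induction k with
    | zero => exact hs
    | succ k ih =>
      have := hjump _ ih
      rw [← add_assoc]
      nlinarith
  suffices h : ∃ s, s ≤ t0 + logStar ν ∧ c1 * ν < b s by
    obtain ⟨s, hs, hbs⟩ := h
    obtain ⟨k, hk⟩ := Nat.exists_eq_add_of_le hs
    have h1 := hjump _ (hstay s hbs k)
    rw [← hk] at h1
    have h2 : r * ν = c * (r / c * ν) := by field_simp
    rw [h2]
    refine mul_le_mul_of_nonneg_left (le_trans ?_ h1) hc0.le
    linarith
  by_contra! hno
  have hrec : ∀ s, s ≤ t0 + logStar ν → a * Real.exp (lam * b s) ≤ b (s + 1) := by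
    intro s hs
    refine le_trans ?_ (hb1 s)
    have h1 := hno s hs
    have h2 : (M + 1) * lam * b s ≤ 1 / 2 * ν := by
      calc (M + 1) * lam * b s ≤ (M + 1) * lam * (c1 * ν) := by gcongr
        _ = 1 / 2 * ν := by rw [hc1]; field_simp
    have h3 : Real.exp (-ν + (M + 2) * lam * b s)
        ≤ Real.exp (lam * b s) * Real.exp (-(1 / 2 * ν)) := by
      rw [← Real.exp_add]
      exact Real.exp_le_exp.2 (by linarith)
    nlinarith [Real.exp_pos (lam * b s)]
  have hgeom : ∀ s, s ≤ t0 → g ^ s / 2 ≤ b s := by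
    intro s
    induction s with
    | zero => intro _; simpa using hb0
    | succ s ih =>
      intro hs
      have h1 := ih (by omega)
      refine le_trans ?_ (hrec s (by omega))
      have h2 : Real.exp 1 * (lam * b s) ≤ Real.exp (lam * b s) := by
        have := Real.add_one_le_exp (lam * b s - 1)
        calc Real.exp 1 * (lam * b s) ≤ Real.exp 1 * Real.exp (lam * b s - 1) := by
              gcongr; linarith
          _ = Real.exp (lam * b s) := by rw [← Real.exp_add]; ring_nf
      calc g ^ (s + 1) / 2 = g * (g ^ s / 2) := by ring
        _ ≤ g * b s := by gcongr
        _ = a * (Real.exp 1 * (lam * b s)) := by rw [← hag]; ring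
        _ ≤ a * Real.exp (lam * b s) := by gcongr
  -- Climbing the tower backwards: step k undoes one logarithm, so that k = log* ν ends at y ν + B.
  have htower : ∀ k, k ≤ logStar ν → y * Real.log^[logStar ν - k] ν + B ≤ b (t0 + k) := by
    intro k
    induction k with
    | zero =>
      intro _
      have h1 := hgeom t0 le_rfl
      have h2 := iterate_logStar_le_one ν
      rw [Nat.sub_zero, add_zero]
      have := mul_le_mul_of_nonneg_left h2 hy0.le
      linarith
    | succ k ih =>
      intro hk
      have h1 := ih (by omega)
      set z := Real.log^[logStar ν - (k + 1)] ν with hz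
      have hz1 : 1 < z := one_lt_iterate_of_lt_logStar (by omega)
      have h2 : Real.log^[logStar ν - k] ν = Real.log z := by
        have : logStar ν - k = logStar ν - (k + 1) + 1 := by omega
        rw [this, Function.iterate_succ_apply']
      rw [h2] at h1
      refine le_trans ?_ (hrec (t0 + k) (by omega))
      have h3 : z * (2 * (y + B)) ≤ Real.exp (lam * b (t0 + k)) := by
        calc z * (2 * (y + B)) ≤ Real.exp (Real.log z) * Real.exp (lam * B) := by
              rw [Real.exp_log (by linarith)]; gcongr
          _ = Real.exp (lam * (y * Real.log z + B)) := by
              rw [← Real.exp_add]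
              congr 1
              linear_combination (-Real.log z) * hyl
          _ ≤ _ := by gcongr
      have h4 := mul_le_mul_of_nonneg_right ha2 (Real.exp_nonneg (lam * b (t0 + k)))
      have h5 := mul_le_mul_of_nonneg_right hz1.le hB0.le
      linarith
  have h1 := htower (logStar ν) le_rfl
  rw [Nat.sub_self, Function.iterate_zero, id] at h1
  have h2 := hno _ le_rfl
  -- Thus the top of the tower exceeds c1 ν, contradicting the assumption that this level is never
  -- passed.
  have h3 : c1 ≤ y := by
    rw [hc1, hy]
    apply one_div_le_one_div_of_le hlam0
    nlinarith
  have := mul_le_mul_of_nonneg_right h3 hνpos.le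
  linarith

/-- The Bhattacharyya coefficient of the beliefs on the Poisson tree is smaller than every power
of `e^{-ν}`, after `t₀ + log* ν + 2` iterations. -/
theorem exists_small_coefficient {lam : ℝ} (hlam : 1 / Real.exp 1 < lam) :
    ∃ t0 : ℕ, ∀ M : ℝ, ∀ r : ℝ, ∃ ν0 : ℝ, ∀ P : Params, P.lam = lam → P.p ≤ M * P.q →
      ν0 ≤ P.ν →
      avg (P.law (iterations t0 P.n P.K) false) (fun x => ENNReal.ofReal (Real.exp (1 / 2 * x)))
        ≤ ENNReal.ofReal (Real.exp (-(r * P.ν))) := by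
  obtain ⟨t0, h⟩ := exists_growth hlam
  refine ⟨t0, fun M r => ?_⟩
  -- No parameters satisfy 0 < q ≤ p ≤ M q with M < 1.
  rcases lt_or_ge M 1 with hM | hM
  · refine ⟨0, fun P _ hP _ => ?_⟩
    have := P.q_le
    nlinarith [P.q_pos]
  obtain ⟨ν0, hν0, hν⟩ := h M hM r
  refine ⟨ν0, fun P hP hPM hPν => ?_⟩
  have hR : P.p / P.q ≤ M := (div_le_iff₀ P.q_pos).2 hPM
  have h1 := hν P.ν hPν P.signal (P.half_le_signal_zero (by linarith))
    (fun t => hP ▸ P.le_signal_succ t hR)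
    (fun t u hu => hP ▸ P.le_signal_succ_of_le t hR hu)
  -- The coefficient at time t + 1 is governed by the signal at time t; this accounts for the final
  -- + 2 in `iterations`.
  have h2 := P.avg_exp_half (t0 + logStar P.ν + 1) hR
  rw [hP] at h2
  refine h2.trans (ENNReal.ofReal_le_ofReal (Real.exp_le_exp.2 (by linarith)))

/-! ### Random graphs with independent edges -/

section RandomGraph

open Classical

variable {V : Type*} [Fintype V]

/-- The pairs of distinct vertices. -/
def pairs (V : Type*) [Fintype V] : Finset (Sym2 V) := Finset.univ.filter fun e => ¬ e.IsDiag

/-- The probability of the graph `H` if the edges are independent with probabilities `w`. -/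
def graphWeight (w : Sym2 V → ℝ) (H : SimpleGraph V) : ℝ≥0∞ :=
  ∏ e ∈ pairs V, if e ∈ H.edgeSet then ENNReal.ofReal (w e) else ENNReal.ofReal (1 - w e)

/-- The expectation of `F` if the edges are independent with probabilities `w`. -/
def expect (w : Sym2 V → ℝ) (F : SimpleGraph V → ℝ≥0∞) : ℝ≥0∞ := ∑ H, graphWeight w H * F H

/-- The probability of `A` if the edges are independent with probabilities `w`. -/
def prob (w : Sym2 V → ℝ) (A : SimpleGraph V → Prop) : ℝ≥0∞ :=
  expect w fun H => if A H then 1 else 0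

theorem mem_pairs {e : Sym2 V} : e ∈ pairs V ↔ ¬ e.IsDiag := by simp [pairs]

theorem mk_mem_pairs {a b : V} : s(a, b) ∈ pairs V ↔ a ≠ b := by simp [pairs]

/-- The edges of `H`, as a finite set. -/
def edgesOf (H : SimpleGraph V) : Finset (Sym2 V) := (pairs V).filter (· ∈ H.edgeSet)

theorem mem_edgesOf {H : SimpleGraph V} {e : Sym2 V} :
    e ∈ edgesOf H ↔ e ∈ pairs V ∧ e ∈ H.edgeSet := by
  simp [edgesOf]

/-- Graphs on `V` correspond to subsets of `pairs V`, so expanding the product of sums enumerates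
the graphs. -/
theorem sum_prod_edges (a b : Sym2 V → ℝ≥0∞) :
    ∑ H : SimpleGraph V, ∏ e ∈ pairs V, (if e ∈ H.edgeSet then a e else b e)
      = ∏ e ∈ pairs V, (a e + b e) := by
  rw [Finset.prod_add]
  refine Finset.sum_nbij' edgesOf
    (fun t => SimpleGraph.fromEdgeSet (t : Set (Sym2 V))) ?_ ?_ ?_ ?_ ?_
  · intro H _
    exact Finset.mem_powerset.2 (Finset.filter_subset _ _)
  · intro t _
    exact Finset.mem_univ _
  · intro H _
    ext u v
    rw [SimpleGraph.fromEdgeSet_adj, Finset.mem_coe, mem_edgesOf, mk_mem_pairs,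
      SimpleGraph.mem_edgeSet]
    exact ⟨fun h => h.1.2, fun h => ⟨⟨h.ne, h⟩, h.ne⟩⟩
  · intro t ht
    rw [Finset.mem_powerset] at ht
    ext e
    rw [mem_edgesOf, SimpleGraph.edgeSet_fromEdgeSet]
    exact ⟨fun h => h.2.1, fun h => ⟨ht h, h, mem_pairs.1 (ht h)⟩⟩
  · intro H _
    rw [Finset.prod_ite, Finset.filter_not, edgesOf]

variable {w : Sym2 V → ℝ}

theorem ofReal_add_ofReal_one_sub {x : ℝ} (h : 0 ≤ x ∧ x ≤ 1) :
    ENNReal.ofReal x + ENNReal.ofReal (1 - x) = 1 := by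
  rw [← ENNReal.ofReal_add h.1 (by linarith [h.2])]
  simp

theorem expect_prod (x y : Sym2 V → ℝ≥0∞) :
    expect w (fun H => ∏ e ∈ pairs V, if e ∈ H.edgeSet then x e else y e)
      = ∏ e ∈ pairs V, (ENNReal.ofReal (w e) * x e + ENNReal.ofReal (1 - w e) * y e) := by
  rw [← sum_prod_edges]
  unfold expect graphWeight
  refine Finset.sum_congr rfl fun H _ => ?_
  rw [← Finset.prod_mul_distrib]
  refine Finset.prod_congr rfl fun e _ => ?_
  split_ifs <;> rfl

theorem expect_mono {F G : SimpleGraph V → ℝ≥0∞} (h : ∀ H, F H ≤ G H) :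
    expect w F ≤ expect w G :=
  Finset.sum_le_sum fun H _ => by gcongr; exact h H

theorem expect_add (F G : SimpleGraph V → ℝ≥0∞) :
    expect w (fun H => F H + G H) = expect w F + expect w G := by
  simp only [expect, mul_add, Finset.sum_add_distrib]

theorem expect_const_mul (a : ℝ≥0∞) (F : SimpleGraph V → ℝ≥0∞) :
    expect w (fun H => a * F H) = a * expect w F := by
  simp only [expect, Finset.mul_sum, mul_left_comm]

theorem expect_sum {ι : Type*} (s : Finset ι) (F : ι → SimpleGraph V → ℝ≥0∞) :
    expect w (fun H => ∑ i ∈ s, F i H) = ∑ i ∈ s, expect w (F i) := by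
  simp only [expect, Finset.mul_sum]
  exact Finset.sum_comm

theorem prob_mono {A B : SimpleGraph V → Prop} (h : ∀ H, A H → B H) : prob w A ≤ prob w B :=
  expect_mono fun H => by
    by_cases hA : A H
    · simp [hA, h H hA]
    · simp [hA]

theorem prob_or_le (A B : SimpleGraph V → Prop) :
    prob w (fun H => A H ∨ B H) ≤ prob w A + prob w B := by
  unfold prob
  rw [← expect_add]
  refine expect_mono fun H => ?_
  by_cases hA : A H <;> by_cases hB : B H <;> simp [hA, hB]

theorem prob_exists_le {ι : Type*} (s : Finset ι) (A : ι → SimpleGraph V → Prop) :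
    prob w (fun H => ∃ i ∈ s, A i H) ≤ ∑ i ∈ s, prob w (A i) := by
  unfold prob
  rw [← expect_sum]
  refine expect_mono fun H => ?_
  split_ifs with h
  · obtain ⟨i, hi, hA⟩ := h
    exact le_trans (by simp [hA]) (Finset.single_le_sum (f := fun i => if A i H then (1 : ℝ≥0∞) else 0)
      (fun _ _ => zero_le) hi)
  · exact zero_le

theorem expect_one (hw : ∀ e, 0 ≤ w e ∧ w e ≤ 1) : expect w (fun _ => 1) = 1 := by
  have h := expect_prod (w := w) (fun _ => 1) (fun _ => 1)
  simp only [ite_self, Finset.prod_const_one, mul_one, ofReal_add_ofReal_one_sub (hw _)] at h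
  exact h

/-- The probability that all pairs in `T` are edges, and no pair in `U` is an edge. -/
theorem prob_edges (hw : ∀ e, 0 ≤ w e ∧ w e ≤ 1) {T U : Finset (Sym2 V)} (hT : T ⊆ pairs V)
    (hU : U ⊆ pairs V) (hTU : Disjoint T U) :
    prob w (fun H => (∀ e ∈ T, e ∈ H.edgeSet) ∧ ∀ e ∈ U, e ∉ H.edgeSet)
      = (∏ e ∈ T, ENNReal.ofReal (w e)) * ∏ e ∈ U, ENNReal.ofReal (1 - w e) := by
  -- The event is a product over pairs: the factor 0 penalizes an edge in `U` and a non-edge in `T`.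
  have h := expect_prod (w := w) (fun e => if e ∈ U then 0 else 1) (fun e => if e ∈ T then 0 else 1)
  have h1 : ∀ H : SimpleGraph V, (∏ e ∈ pairs V, if e ∈ H.edgeSet then
      (if e ∈ U then (0 : ℝ≥0∞) else 1) else (if e ∈ T then 0 else 1))
      = if (∀ e ∈ T, e ∈ H.edgeSet) ∧ ∀ e ∈ U, e ∉ H.edgeSet then 1 else 0 := by
    intro H
    split_ifs with h
    · refine Finset.prod_eq_one fun e _ => ?_
      by_cases he : e ∈ H.edgeSet
      · rw [if_pos he, if_neg fun h' => h.2 e h' he]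
      · rw [if_neg he, if_neg fun h' => he (h.1 e h')]
    · rw [not_and_or] at h
      push Not at h
      rcases h with ⟨e, he, heH⟩ | ⟨e, he, heH⟩
      · exact Finset.prod_eq_zero (hT he) (by simp [heH, he])
      · exact Finset.prod_eq_zero (hU he) (by rw [if_pos heH, if_pos he])
  simp only [h1] at h
  have h2 : ∏ e ∈ T, ENNReal.ofReal (w e)
      = ∏ e ∈ pairs V, if e ∈ T then ENNReal.ofReal (w e) else 1 := by
    rw [Finset.prod_ite_mem, Finset.inter_eq_right.2 hT]
  have h3 : ∏ e ∈ U, ENNReal.ofReal (1 - w e)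
      = ∏ e ∈ pairs V, if e ∈ U then ENNReal.ofReal (1 - w e) else 1 := by
    rw [Finset.prod_ite_mem, Finset.inter_eq_right.2 hU]
  refine Eq.trans (by unfold prob; congr!) (h.trans ?_)
  rw [h2, h3, ← Finset.prod_mul_distrib]
  refine Finset.prod_congr rfl fun e _ => ?_
  by_cases heT : e ∈ T
  · have heU : e ∉ U := Finset.disjoint_left.1 hTU heT
    simp [heT, heU]
  · by_cases heU : e ∈ U
    · simp [heT, heU]
    · simp [heT, heU, ofReal_add_ofReal_one_sub (hw e)]

/-- The graph whose edges touching `D` are those of `H₁`, and whose other edges are those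
of `H₂`. -/
def mixGraph (D : Set V) (H₁ H₂ : SimpleGraph V) : SimpleGraph V where
  Adj a b := if a ∈ D ∨ b ∈ D then H₁.Adj a b else H₂.Adj a b
  symm := ⟨fun a b h => by
    by_cases hD : a ∈ D ∨ b ∈ D
    · rw [if_pos hD] at h
      rw [if_pos hD.symm]
      exact h.symm
    · rw [if_neg hD] at h
      rw [if_neg (fun h' => hD h'.symm)]
      exact h.symm⟩
  loopless := ⟨fun a h => by
    split_ifs at h
    · exact h.ne rfl
    · exact h.ne rfl⟩

/-- Functions of the edges that touch `D` are independent of functions of the other edges. -/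
theorem expect_mul (hw : ∀ e, 0 ≤ w e ∧ w e ≤ 1) (D : Set V) {f g : SimpleGraph V → ℝ≥0∞}
    (hf : ∀ H H' : SimpleGraph V, (∀ a b, a ∈ D ∨ b ∈ D → (H.Adj a b ↔ H'.Adj a b)) → f H = f H')
    (hg : ∀ H H' : SimpleGraph V, (∀ a b, a ∉ D → b ∉ D → (H.Adj a b ↔ H'.Adj a b)) → g H = g H') :
    expect w (fun H => f H * g H) = expect w f * expect w g := by
  have hinv : ∀ H₁ H₂ : SimpleGraph V, mixGraph D (mixGraph D H₁ H₂) (mixGraph D H₂ H₁) = H₁ := by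
    intro H₁ H₂
    ext a b
    by_cases hD : a ∈ D ∨ b ∈ D
    · simp [mixGraph, hD]
    · simp [mixGraph, hD]
  -- In a pair of independent graphs, exchange the edges that do not touch `D`. This involution
  -- preserves the joint weight and moves `g` to the second graph.
  let φ : SimpleGraph V × SimpleGraph V ≃ SimpleGraph V × SimpleGraph V :=
    { toFun := fun x => (mixGraph D x.1 x.2, mixGraph D x.2 x.1)
      invFun := fun x => (mixGraph D x.1 x.2, mixGraph D x.2 x.1)
      left_inv := fun x => Prod.ext (hinv x.1 x.2) (hinv x.2 x.1)
      right_inv := fun x => Prod.ext (hinv x.1 x.2) (hinv x.2 x.1) }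
  have hW : ∀ H₁ H₂ : SimpleGraph V, graphWeight w (mixGraph D H₁ H₂)
      * graphWeight w (mixGraph D H₂ H₁) = graphWeight w H₁ * graphWeight w H₂ := by
    intro H₁ H₂
    unfold graphWeight
    rw [← Finset.prod_mul_distrib, ← Finset.prod_mul_distrib]
    refine Finset.prod_congr rfl fun e _ => ?_
    induction e with
    | h a b =>
      simp only [SimpleGraph.mem_edgeSet]
      by_cases hD : a ∈ D ∨ b ∈ D
      · simp [mixGraph, hD]
      · simp only [mixGraph, hD, if_false]
        rw [mul_comm]
  have h1 : expect w f * expect w g = ∑ x : SimpleGraph V × SimpleGraph V,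
      graphWeight w x.1 * f x.1 * (graphWeight w x.2 * g x.2) := by
    rw [expect, expect, Finset.sum_mul_sum, ← Finset.univ_product_univ, Finset.sum_product]
  have h2 : expect w (fun H => f H * g H) * expect w (fun _ => 1)
      = ∑ x : SimpleGraph V × SimpleGraph V,
        graphWeight w x.1 * (f x.1 * g x.1) * (graphWeight w x.2 * 1) := by
    rw [expect, expect, Finset.sum_mul_sum, ← Finset.univ_product_univ, Finset.sum_product]
  rw [expect_one hw, mul_one] at h2
  rw [h1, h2]
  refine Fintype.sum_equiv φ _ _ fun x => ?_
  have e1 : f (mixGraph D x.1 x.2) = f x.1 := hf _ _ fun a b hab => by simp [mixGraph, hab]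
  have e2 : g (mixGraph D x.2 x.1) = g x.1 := hg _ _ fun a b ha hb => by simp [mixGraph, ha, hb]
  change _ = graphWeight w (mixGraph D x.1 x.2) * f (mixGraph D x.1 x.2) *
    (graphWeight w (mixGraph D x.2 x.1) * g (mixGraph D x.2 x.1))
  rw [e1, e2]
  calc _ = graphWeight w x.1 * graphWeight w x.2 * (f x.1 * g x.1) := by ring
    _ = _ := by rw [← hW x.1 x.2]; ring

end RandomGraph

/-! ### Exploration of a neighborhood, level by level -/

section Exploration

open Classical

variable {V : Type*} [DecidableEq V]

/-- The neighbors of `S` in `U`. -/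
def nextLevel (H : SimpleGraph V) (S U : Finset V) : Finset V := U.filter fun v => ∃ l ∈ S, H.Adj l v

/-- The values that arise at `S` if the messages are passed for `t` rounds through the successive
levels of the exploration of `U` from `S`. -/
def treeValue (off : ℝ) (con : ℝ → ℝ) (H : SimpleGraph V) : ℕ → Finset V → Finset V → V → ℝ
  | 0, _, _, _ => 0
  | t + 1, S, U, l => off + ∑ v ∈ U with H.Adj l v,
      con (treeValue off con H t (nextLevel H S U) (U \ nextLevel H S U) v)

/-- The first `t` levels of the exploration of `U` from `S` are a forest which has at most `L`
vertices in each level, and none of them is adjacent to `Z`. -/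
def IsTreelike (L : ℝ) (Z : Finset V) (H : SimpleGraph V) : ℕ → Finset V → Finset V → Prop
  | 0, _, _ => True
  | t + 1, S, U => (∀ v ∈ U, ∀ l ∈ S, ∀ l' ∈ S, H.Adj l v → H.Adj l' v → l = l') ∧
      (∀ l ∈ S, ∀ v ∈ S ∪ Z, ¬ H.Adj l v) ∧ ((nextLevel H S U).card : ℝ) ≤ L ∧
      IsTreelike L Z H t (nextLevel H S U) (U \ nextLevel H S U)

variable {H H' : SimpleGraph V} {S U W Z : Finset V} {off L : ℝ} {con : ℝ → ℝ}

theorem mem_nextLevel {v : V} : v ∈ nextLevel H S U ↔ v ∈ U ∧ ∃ l ∈ S, H.Adj l v := by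
  simp [nextLevel]

theorem nextLevel_subset : nextLevel H S U ⊆ U := Finset.filter_subset _ _

theorem nextLevel_congr (hH : ∀ a ∈ S, ∀ b ∈ U, (H.Adj a b ↔ H'.Adj a b)) :
    nextLevel H S U = nextLevel H' S U := by
  ext v
  rw [mem_nextLevel, mem_nextLevel]
  constructor
  · rintro ⟨hv, l, hl, h⟩
    exact ⟨hv, l, hl, (hH l hl v hv).1 h⟩
  · rintro ⟨hv, l, hl, h⟩
    exact ⟨hv, l, hl, (hH l hl v hv).2 h⟩

/-- Locality: only edges within `W` matter. Together with the following lemma, this supplies the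
independence hypotheses of `expect_mul`. -/
theorem treeValue_congr (hH : ∀ a ∈ W, ∀ b ∈ W, (H.Adj a b ↔ H'.Adj a b)) (t : ℕ)
    (hS : S ⊆ W) (hU : U ⊆ W) {l : V} (hl : l ∈ W) :
    treeValue off con H t S U l = treeValue off con H' t S U l := by
  induction t generalizing S U l with
  | zero => rfl
  | succ t ih =>
    have h1 : nextLevel H S U = nextLevel H' S U :=
      nextLevel_congr fun a ha b hb => hH a (hS ha) b (hU hb)
    have h2 : (U.filter fun v => H.Adj l v) = U.filter fun v => H'.Adj l v :=
      Finset.filter_congr fun v hv => hH l hl v (hU hv)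
    simp only [treeValue]
    rw [h2, h1]
    refine congrArg _ (Finset.sum_congr rfl fun v hv => congrArg _ ?_)
    exact ih (nextLevel_subset.trans hU) (Finset.sdiff_subset.trans hU)
      (hU (Finset.mem_filter.1 hv).1)

theorem isTreelike_congr (hH : ∀ a ∈ W, ∀ b ∈ W, (H.Adj a b ↔ H'.Adj a b)) (t : ℕ)
    (hS : S ⊆ W) (hU : U ⊆ W) (hZ : Z ⊆ W) :
    IsTreelike L Z H t S U ↔ IsTreelike L Z H' t S U := by
  induction t generalizing S U with
  | zero => rfl
  | succ t ih =>
    have h1 : nextLevel H S U = nextLevel H' S U :=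
      nextLevel_congr fun a ha b hb => hH a (hS ha) b (hU hb)
    simp only [IsTreelike]
    rw [h1, ih (nextLevel_subset.trans hU) (Finset.sdiff_subset.trans hU)]
    refine and_congr ?_ (and_congr ?_ Iff.rfl)
    · refine forall₂_congr fun v hv => forall₂_congr fun l hl => forall₂_congr fun l' hl' => ?_
      rw [hH l (hS hl) v (hU hv), hH l' (hS hl') v (hU hv)]
    · refine forall₂_congr fun l hl => forall₂_congr fun v hv => ?_
      rw [hH l (hS hl) v (Finset.union_subset hS hZ hv)]

/-- On a treelike neighborhood the messages are those of the exploration. -/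
theorem message_eq_treeValue {n : ℕ} {H : SimpleGraph (Fin n)} (K : ℕ) (p q : ℝ)
    {Z : Finset (Fin n)} (t : ℕ) {S U : Finset (Fin n)} (par : Fin n → Fin n)
    (hS : ∀ l ∈ S, ∀ v, H.Adj l v → v = par l ∨ v ∈ S ∪ Z ∨ v ∈ U)
    (hU : ∀ l ∈ U, ∀ v, H.Adj l v → v ∈ S ∨ v ∈ U ∨ v ∈ Z)
    (hpar : ∀ l ∈ S, par l ∉ U) (hSU : Disjoint S U) (hT : IsTreelike L Z H t S U) {l : Fin n} (hl : l ∈ S) :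
    message H K p q t l (par l)
      = treeValue (-(K * (p - q))) (contribution n K p q) H t S U l := by
  induction t generalizing S U l par with
  | zero => rfl
  | succ t ih =>
    obtain ⟨h1, h2, -, h4⟩ := hT
    have hfil : (Finset.univ.filter fun v => H.Adj l v ∧ v ≠ par l)
        = U.filter fun v => H.Adj l v := by
      ext v
      simp only [Finset.mem_filter, Finset.mem_univ, true_and]
      constructor
      · rintro ⟨ha, hne⟩
        rcases hS l hl v ha with h | h | h
        · exact absurd h hne
        · exact absurd ha (h2 l hl v h)
        · exact ⟨h, ha⟩
      · rintro ⟨hv, ha⟩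
        exact ⟨ha, fun h => hpar l hl (h ▸ hv)⟩
    rw [message, treeValue]
    refine congrArg₂ _ rfl ?_
    refine (Finset.sum_congr (by rw [← hfil]) fun v hv => congrArg _ ?_)
    obtain ⟨hvU, hlv⟩ := Finset.mem_filter.1 hv
    -- The parent of `u` is its neighbor in `S`, unique because the exploration is a forest; the
    -- default value for vertices without such a neighbor plays no role.
    let par' : Fin n → Fin n := fun u => if h : ∃ m ∈ S, H.Adj m u then h.choose else u
    have hpar' : ∀ m ∈ S, ∀ u ∈ U, H.Adj m u → par' u = m := by
      intro m hm u hu ha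
      have h : ∃ m ∈ S, H.Adj m u := ⟨m, hm, ha⟩
      simp only [par', dif_pos h]
      exact h1 u hu _ h.choose_spec.1 m hm h.choose_spec.2 ha
    have key := ih (S := nextLevel H S U) (U := U \ nextLevel H S U) par' ?_ ?_ ?_
      Finset.disjoint_sdiff h4
      (mem_nextLevel.2 ⟨hvU, l, hl, hlv⟩)
    · rwa [hpar' l hl v hvU hlv] at key
    · intro u hu m ha
      obtain ⟨huU, x, hx, hxu⟩ := mem_nextLevel.1 hu
      rcases hU u huU m ha with h | h | h
      · exact Or.inl (hpar' m h u huU ha.symm).symm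
      · by_cases hm : m ∈ nextLevel H S U
        · exact Or.inr (Or.inl (Finset.mem_union_left _ hm))
        · exact Or.inr (Or.inr (Finset.mem_sdiff.2 ⟨h, hm⟩))
      · exact Or.inr (Or.inl (Finset.mem_union_right _ h))
    · intro u hu m ha
      obtain ⟨huU, hun⟩ := Finset.mem_sdiff.1 hu
      rcases hU u huU m ha with h | h | h
      · exact absurd (mem_nextLevel.2 ⟨huU, m, h, ha.symm⟩) hun
      · by_cases hm : m ∈ nextLevel H S U
        · exact Or.inl hm
        · exact Or.inr (Or.inl (Finset.mem_sdiff.2 ⟨h, hm⟩))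
      · exact Or.inr (Or.inr h)
    · intro u hu h
      obtain ⟨huU, x, hx, hxu⟩ := mem_nextLevel.1 hu
      rw [hpar' x hx u huU hxu] at h
      exact Finset.disjoint_left.1 hSU hx (Finset.mem_sdiff.1 h).1

end Exploration

/-! ### Neighborhoods are treelike with high probability -/

section Treelike

open Classical

variable {V : Type*} [Fintype V] [DecidableEq V] {w : Sym2 V → ℝ} {p : ℝ}

theorem prob_adj_le (hw : ∀ e, 0 ≤ w e ∧ w e ≤ 1) (hp : ∀ e, w e ≤ p) (a b : V) :
    prob w (fun H => H.Adj a b) ≤ ENNReal.ofReal p := by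
  rcases eq_or_ne a b with rfl | hab
  · refine (le_of_eq ?_).trans zero_le
    simp [prob, expect]
  · have h := prob_edges (w := w) hw (T := {s(a, b)}) (U := ∅)
      (by simpa [mk_mem_pairs] using hab) (by simp) (by simp)
    simp only [Finset.mem_singleton, forall_eq, SimpleGraph.mem_edgeSet, Finset.notMem_empty,
      false_imp_iff, implies_true, and_true, Finset.prod_singleton, Finset.prod_empty,
      mul_one] at h
    rw [h]
    exact ENNReal.ofReal_le_ofReal (hp _)

theorem prob_adj_adj_le (hw : ∀ e, 0 ≤ w e ∧ w e ≤ 1) (hp : ∀ e, w e ≤ p) {a b a' b' : V}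
    (hne : s(a, b) ≠ s(a', b')) :
    prob w (fun H => H.Adj a b ∧ H.Adj a' b') ≤ ENNReal.ofReal p ^ 2 := by
  by_cases hab : a ≠ b ∧ a' ≠ b'
  · have h := prob_edges (w := w) hw (T := {s(a, b), s(a', b')}) (U := ∅)
      (by
        intro e he
        rcases Finset.mem_insert.1 he with rfl | he
        · exact mk_mem_pairs.2 hab.1
        · rw [Finset.mem_singleton.1 he]; exact mk_mem_pairs.2 hab.2) (by simp) (by simp)
    simp only [Finset.mem_insert, Finset.mem_singleton, forall_eq_or_imp, forall_eq,
      SimpleGraph.mem_edgeSet, Finset.notMem_empty, false_imp_iff, implies_true, and_true,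
      Finset.prod_pair hne, Finset.prod_empty, mul_one] at h
    rw [h, sq]
    exact mul_le_mul' (ENNReal.ofReal_le_ofReal (hp _)) (ENNReal.ofReal_le_ofReal (hp _))
  · refine (le_of_eq ?_).trans zero_le
    unfold prob expect
    refine Finset.sum_eq_zero fun H _ => ?_
    beta_reduce
    rw [if_neg (fun h => hab ⟨h.1.ne, h.2.ne⟩), mul_zero]

/-- Count ordered pairs of edges between `S` and `U`: equal pairs contribute p, and distinct ones
p², since disjointness rules out the same edge in both orders. The second moment is needed because
the failure bound of the exploration is quadratic in the size of its starting level. -/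
theorem expect_card_nextLevel_sq_le (hw : ∀ e, 0 ≤ w e ∧ w e ≤ 1) (hp : ∀ e, w e ≤ p)
    {S U : Finset V} (hSU : Disjoint S U) :
    expect w (fun H => ((nextLevel H S U).card : ℝ≥0∞) ^ 2)
      ≤ (S.card : ℝ≥0∞) ^ 2 * ((Fintype.card V * ENNReal.ofReal p) ^ 2
        + Fintype.card V * ENNReal.ofReal p) := by
  set π := ENNReal.ofReal p
  have h1 : ∀ H : SimpleGraph V, ((nextLevel H S U).card : ℝ≥0∞)
      ≤ ∑ x ∈ S ×ˢ U, if H.Adj x.1 x.2 then 1 else 0 := by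
    intro H
    rw [Finset.sum_boole, Nat.cast_le]
    refine le_trans (Finset.card_le_card ?_) (Finset.card_image_le (f := Prod.snd))
    intro v hv
    obtain ⟨hv, l, hl, h⟩ := mem_nextLevel.1 hv
    exact Finset.mem_image.2 ⟨(l, v), Finset.mem_filter.2 ⟨Finset.mk_mem_product hl hv, h⟩, rfl⟩
  have h2 : expect w (fun H => ((nextLevel H S U).card : ℝ≥0∞) ^ 2)
      ≤ ∑ x ∈ S ×ˢ U, ∑ y ∈ S ×ˢ U, prob w (fun H => H.Adj x.1 x.2 ∧ H.Adj y.1 y.2) := by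
    refine (expect_mono fun H => pow_le_pow_left₀ zero_le (h1 H) 2).trans ?_
    simp only [sq, Finset.sum_mul_sum]
    rw [expect_sum]
    refine Finset.sum_le_sum fun x _ => ?_
    rw [expect_sum]
    refine Finset.sum_le_sum fun y _ => ?_
    exact expect_mono fun H => by
      by_cases hx : H.Adj x.1 x.2 <;> by_cases hy : H.Adj y.1 y.2 <;> simp [hx, hy]
  refine h2.trans ?_
  have h3 : ∀ x ∈ S ×ˢ U, ∀ y ∈ S ×ˢ U, prob w (fun H => H.Adj x.1 x.2 ∧ H.Adj y.1 y.2)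
      ≤ π ^ 2 + if y = x then π else 0 := by
    intro x hx y hy
    rw [Finset.mem_product] at hx hy
    by_cases hxy : y = x
    · subst hxy
      rw [if_pos rfl]
      simp only [and_self]
      exact (prob_adj_le hw hp _ _).trans le_add_self
    · rw [if_neg hxy, add_zero]
      refine prob_adj_adj_le hw hp fun h => hxy ?_
      rcases Sym2.eq_iff.1 h with ⟨h1, h2⟩ | ⟨h1, h2⟩
      · exact Prod.ext h1.symm h2.symm
      · exact absurd (h1 ▸ hy.2) (Finset.disjoint_left.1 hSU hx.1)
  have hU : (U.card : ℝ≥0∞) ≤ Fintype.card V := by exact_mod_cast Finset.card_le_univ U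
  have hS : (S.card : ℝ≥0∞) ≤ (S.card : ℝ≥0∞) ^ 2 := by
    exact_mod_cast Nat.le_self_pow two_ne_zero _
  calc _ ≤ ∑ x ∈ S ×ˢ U, ∑ y ∈ S ×ˢ U, (π ^ 2 + if y = x then π else 0) :=
        Finset.sum_le_sum fun x hx => Finset.sum_le_sum fun y hy => h3 x hx y hy
    _ = ∑ x ∈ S ×ˢ U, ((S.card * U.card : ℕ) * π ^ 2 + π) := by
        refine Finset.sum_congr rfl fun x hx => ?_
        rw [Finset.sum_add_distrib, Finset.sum_const, Finset.sum_ite_eq' , if_pos hx,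
          Finset.card_product, nsmul_eq_mul]
    _ = (S.card : ℝ≥0∞) ^ 2 * (U.card * π) ^ 2 + S.card * (U.card * π) := by
        rw [Finset.sum_const, Finset.card_product, nsmul_eq_mul]
        push_cast
        ring
    _ ≤ (S.card : ℝ≥0∞) ^ 2 * (Fintype.card V * π) ^ 2
        + (S.card : ℝ≥0∞) ^ 2 * (Fintype.card V * π) := by gcongr
    _ = _ := by ring

theorem prob_collision_le (hw : ∀ e, 0 ≤ w e ∧ w e ≤ 1) (hp : ∀ e, w e ≤ p) {S U : Finset V}
    (hSU : Disjoint S U) :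
    prob w (fun H => ∃ v ∈ U, ∃ l ∈ S, ∃ l' ∈ S, l ≠ l' ∧ H.Adj l v ∧ H.Adj l' v)
      ≤ (S.card : ℝ≥0∞) ^ 2 * (Fintype.card V * ENNReal.ofReal p ^ 2) := by
  have hU : (U.card : ℝ≥0∞) ≤ Fintype.card V := by exact_mod_cast Finset.card_le_univ U
  have h : ∀ v ∈ U, ∀ l ∈ S, ∀ l' ∈ S, prob w (fun H => l ≠ l' ∧ H.Adj l v ∧ H.Adj l' v)
      ≤ ENNReal.ofReal p ^ 2 := by
    intro v hv l hl l' hl'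
    by_cases hne : l = l'
    · refine (le_of_eq ?_).trans zero_le
      simp [prob, expect, hne]
    · refine (prob_mono fun H h => h.2).trans (prob_adj_adj_le hw hp fun h => ?_)
      rcases Sym2.eq_iff.1 h with ⟨h1, -⟩ | ⟨h1, -⟩
      · exact hne h1
      · exact Finset.disjoint_left.1 hSU hl (h1 ▸ hv)
  calc _ ≤ ∑ v ∈ U, ∑ l ∈ S, ∑ l' ∈ S, prob w (fun H => l ≠ l' ∧ H.Adj l v ∧ H.Adj l' v) := by
        refine (prob_exists_le _ _).trans (Finset.sum_le_sum fun v _ => ?_)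
        refine (prob_exists_le _ _).trans (Finset.sum_le_sum fun l _ => ?_)
        exact prob_exists_le _ _
    _ ≤ ∑ v ∈ U, ∑ l ∈ S, ∑ l' ∈ S, ENNReal.ofReal p ^ 2 :=
        Finset.sum_le_sum fun v hv => Finset.sum_le_sum fun l hl => Finset.sum_le_sum
          fun l' hl' => h v hv l hl l' hl'
    _ = (S.card : ℝ≥0∞) ^ 2 * (U.card * ENNReal.ofReal p ^ 2) := by
        simp only [Finset.sum_const, nsmul_eq_mul]
        ring
    _ ≤ _ := by gcongr

theorem prob_inner_edge_le (hw : ∀ e, 0 ≤ w e ∧ w e ≤ 1) (hp : ∀ e, w e ≤ p) (S Z : Finset V) :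
    prob w (fun H => ∃ l ∈ S, ∃ v ∈ S ∪ Z, H.Adj l v)
      ≤ (S.card : ℝ≥0∞) ^ 2 * ((1 + Z.card) * ENNReal.ofReal p) := by
  have hS : (S.card : ℝ≥0∞) ≤ (S.card : ℝ≥0∞) ^ 2 := by
    exact_mod_cast Nat.le_self_pow two_ne_zero _
  have hSZ : ((S ∪ Z).card : ℝ≥0∞) ≤ S.card + Z.card := by
    exact_mod_cast Finset.card_union_le S Z
  calc _ ≤ ∑ l ∈ S, ∑ v ∈ S ∪ Z, prob w (fun H => H.Adj l v) := by
        refine (prob_exists_le _ _).trans (Finset.sum_le_sum fun v _ => ?_)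
        exact prob_exists_le _ _
    _ ≤ ∑ l ∈ S, ∑ v ∈ S ∪ Z, ENNReal.ofReal p :=
        Finset.sum_le_sum fun v _ => Finset.sum_le_sum fun l _ => prob_adj_le hw hp _ _
    _ = (S.card : ℝ≥0∞) * ((S ∪ Z).card * ENNReal.ofReal p) := by
        simp only [Finset.sum_const, nsmul_eq_mul]
    _ ≤ (S.card : ℝ≥0∞) * ((S.card + Z.card) * ENNReal.ofReal p) := by gcongr
    _ = ((S.card : ℝ≥0∞) ^ 2 + S.card * Z.card) * ENNReal.ofReal p := by ring
    _ ≤ ((S.card : ℝ≥0∞) ^ 2 + (S.card : ℝ≥0∞) ^ 2 * Z.card) * ENNReal.ofReal p := by gcongr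
    _ = _ := by ring

theorem prob_lt_card_nextLevel_le (hw : ∀ e, 0 ≤ w e ∧ w e ≤ 1) (hp : ∀ e, w e ≤ p)
    {S U : Finset V} (hSU : Disjoint S U) {L : ℝ} (hL : 0 < L) :
    prob w (fun H => L < (nextLevel H S U).card)
      ≤ (S.card : ℝ≥0∞) ^ 2 * (((Fintype.card V * ENNReal.ofReal p) ^ 2
        + Fintype.card V * ENNReal.ofReal p) * (ENNReal.ofReal L ^ 2)⁻¹) := by
  have hL' : ENNReal.ofReal L ≠ 0 := by simpa using hL
  have h : prob w (fun H => L < (nextLevel H S U).card)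
      ≤ expect w (fun H => (ENNReal.ofReal L ^ 2)⁻¹ * ((nextLevel H S U).card : ℝ≥0∞) ^ 2) := by
    refine expect_mono fun H => ?_
    split_ifs with h
    · rw [← ENNReal.inv_mul_cancel (a := ENNReal.ofReal L ^ 2) (pow_ne_zero _ hL')
        (ENNReal.pow_ne_top ENNReal.ofReal_ne_top)]
      gcongr
      exact ENNReal.ofReal_le_of_le_toReal (by simpa using h.le)
    · exact zero_le
  refine h.trans ?_
  rw [expect_const_mul, ← mul_assoc _ _ (ENNReal.ofReal L ^ 2)⁻¹, mul_comm]
  gcongr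
  exact expect_card_nextLevel_sq_le hw hp hSU

/-- The probability that the exploration from `S` is not treelike. -/
theorem prob_not_isTreelike_le (hw : ∀ e, 0 ≤ w e ∧ w e ≤ 1) (hp : ∀ e, w e ≤ p) {L : ℝ}
    (hL : 0 < L) {Z : Finset V} {β A : ℝ≥0∞}
    (hA : (Fintype.card V * ENNReal.ofReal p) ^ 2 + Fintype.card V * ENNReal.ofReal p ≤ A)
    (hA1 : 1 ≤ A)
    (hβ : Fintype.card V * ENNReal.ofReal p ^ 2 + (1 + Z.card) * ENNReal.ofReal p
      + ((Fintype.card V * ENNReal.ofReal p) ^ 2 + Fintype.card V * ENNReal.ofReal p)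
        * (ENNReal.ofReal L ^ 2)⁻¹ ≤ β) (t : ℕ) {S U : Finset V}
    (hSU : Disjoint S U) (hSZ : Disjoint S Z) (hUZ : Disjoint U Z) :
    prob w (fun H => ¬ IsTreelike L Z H t S U) ≤ (S.card : ℝ≥0∞) ^ 2 * (t * β * A ^ t) := by
  induction t generalizing S U with
  | zero => simp [prob, expect, IsTreelike]
  | succ t ih =>
    -- Decompose according to the next level `N`. This event depends on edges touching `S`, the
    -- later exploration on other edges; the induction gives a bound proportional to |N|², which is
    -- averaged by the second moment.
    have hlast : prob w (fun H => ¬ IsTreelike L Z H t (nextLevel H S U) (U \ nextLevel H S U))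
        ≤ (S.card : ℝ≥0∞) ^ 2 * (A * (t * β * A ^ t)) := by
      obtain ⟨B, hB⟩ : ∃ B : Finset V → SimpleGraph V → Prop,
          ∀ N H, B N H ↔ ¬ IsTreelike L Z H t N (U \ N) := ⟨_, fun _ _ => Iff.rfl⟩
      simp only [← hB]
      have h1 : ∀ H : SimpleGraph V, (if B (nextLevel H S U) H then (1 : ℝ≥0∞) else 0)
          = ∑ N ∈ U.powerset, (if nextLevel H S U = N then 1 else 0)
            * (if B N H then 1 else 0) := by
        intro H
        rw [Finset.sum_eq_single_of_mem (nextLevel H S U) (Finset.mem_powerset.2 nextLevel_subset)]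
        · rw [if_pos rfl, one_mul]
        · intro N _ hN
          rw [if_neg hN.symm, zero_mul]
      have h2 : ∀ N ∈ U.powerset, expect w (fun H => (if nextLevel H S U = N then (1 : ℝ≥0∞) else 0)
            * (if B N H then 1 else 0))
          ≤ expect w (fun H => (t * β * A ^ t) * ((if nextLevel H S U = N then (1 : ℝ≥0∞) else 0)
            * (N.card : ℝ≥0∞) ^ 2)) := by
        intro N hN
        have hNU := Finset.mem_powerset.1 hN
        rw [expect_mul hw (S : Set V)]
        · have h3 := ih (S := N) (U := U \ N) Finset.disjoint_sdiff (hUZ.mono_left hNU)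
            (hUZ.mono_left Finset.sdiff_subset)
          simp only [← hB] at h3
          refine (mul_le_mul' le_rfl h3).trans (le_of_eq ?_)
          rw [expect_const_mul]
          simp only [mul_comm _ ((N.card : ℝ≥0∞) ^ 2)]
          rw [expect_const_mul]
          ring
        · intro H H' h
          rw [nextLevel_congr fun a ha b _ => h a b (Or.inl (Finset.mem_coe.2 ha))]
        · intro H H' h
          have : ∀ a ∈ U ∪ Z, a ∉ (S : Set V) := by
            intro a ha haS
            rcases Finset.mem_union.1 ha with ha | ha
            · exact Finset.disjoint_left.1 hSU haS ha
            · exact Finset.disjoint_left.1 hSZ haS ha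
          have h4 := isTreelike_congr (L := L) (Z := Z) (S := N) (U := U \ N)
            (fun a ha b hb => h a b (this a ha) (this b hb)) t
            (hNU.trans Finset.subset_union_left)
            (Finset.sdiff_subset.trans Finset.subset_union_left) Finset.subset_union_right
          simp only [hB, h4]
      rw [prob, funext h1]
      rw [expect_sum]
      refine (Finset.sum_le_sum h2).trans ?_
      rw [← expect_sum]
      have h3 : ∀ H : SimpleGraph V, ∑ N ∈ U.powerset, (t * β * A ^ t) *
          ((if nextLevel H S U = N then (1 : ℝ≥0∞) else 0) * (N.card : ℝ≥0∞) ^ 2)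
          = (t * β * A ^ t) * ((nextLevel H S U).card : ℝ≥0∞) ^ 2 := by
        intro H
        rw [Finset.sum_eq_single_of_mem (nextLevel H S U) (Finset.mem_powerset.2 nextLevel_subset)]
        · rw [if_pos rfl, one_mul]
        · intro N _ hN
          rw [if_neg hN.symm, zero_mul, mul_zero]
      simp only [h3]
      rw [expect_const_mul]
      calc _ ≤ (t * β * A ^ t) * ((S.card : ℝ≥0∞) ^ 2 * A) := by
            gcongr
            exact (expect_card_nextLevel_sq_le hw hp hSU).trans (by gcongr)
        _ = _ := by ring
    have hor : prob w (fun H => ¬ IsTreelike L Z H (t + 1) S U) ≤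
        prob w (fun H => ∃ v ∈ U, ∃ l ∈ S, ∃ l' ∈ S, l ≠ l' ∧ H.Adj l v ∧ H.Adj l' v)
        + (prob w (fun H => ∃ l ∈ S, ∃ v ∈ S ∪ Z, H.Adj l v)
        + (prob w (fun H => L < (nextLevel H S U).card)
        + prob w (fun H => ¬ IsTreelike L Z H t (nextLevel H S U) (U \ nextLevel H S U)))) := by
      refine le_trans (prob_mono fun H h => ?_) ((prob_or_le _ _).trans (add_le_add_right
        ((prob_or_le _ _).trans (add_le_add_right (prob_or_le _ _) _)) _))
      by_contra hcon
      push Not at hcon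
      obtain ⟨h1, h2, h3, h4⟩ := hcon
      refine h ⟨fun v hv l hl l' hl' ha ha' => ?_, h2, h3, h4⟩
      by_contra hne
      exact h1 v hv l hl l' hl' hne ha ha'
    refine hor.trans ?_
    calc _ ≤ (S.card : ℝ≥0∞) ^ 2 * (Fintype.card V * ENNReal.ofReal p ^ 2)
          + ((S.card : ℝ≥0∞) ^ 2 * ((1 + Z.card) * ENNReal.ofReal p)
          + ((S.card : ℝ≥0∞) ^ 2 * (((Fintype.card V * ENNReal.ofReal p) ^ 2
            + Fintype.card V * ENNReal.ofReal p) * (ENNReal.ofReal L ^ 2)⁻¹)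
          + (S.card : ℝ≥0∞) ^ 2 * (A * (t * β * A ^ t)))) :=
        add_le_add (prob_collision_le hw hp hSU) (add_le_add (prob_inner_edge_le hw hp S Z)
          (add_le_add (prob_lt_card_nextLevel_le hw hp hSU hL) hlast))
      _ = (S.card : ℝ≥0∞) ^ 2 * ((Fintype.card V * ENNReal.ofReal p ^ 2
            + (1 + Z.card) * ENNReal.ofReal p
            + ((Fintype.card V * ENNReal.ofReal p) ^ 2 + Fintype.card V * ENNReal.ofReal p)
            * (ENNReal.ofReal L ^ 2)⁻¹) + t * β * (A ^ t * A)) := by ring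
      _ ≤ (S.card : ℝ≥0∞) ^ 2 * (β * A ^ (t + 1) + t * β * (A ^ t * A)) := by
        gcongr
        refine hβ.trans (le_mul_of_one_le_right zero_le (one_le_pow₀ hA1))
      _ = _ := by
        push_cast
        ring

end Treelike

/-! ### Averages over independent coordinates -/

section ProductAverage

variable {V : Type*} [Fintype V] [DecidableEq V] {μ μ' : V → ℝ → ℝ≥0∞} {Φ Ψ : (V → ℝ) → ℝ≥0∞}

/-- The average of `Φ` if the coordinates are independent with weights `μ`. -/
def productAvg (μ : V → ℝ → ℝ≥0∞) (Φ : (V → ℝ) → ℝ≥0∞) : ℝ≥0∞ :=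
  ∑' x : V → ℝ, (∏ v, μ v (x v)) * Φ x

theorem productAvg_mono (h : ∀ x, Φ x ≤ Ψ x) : productAvg μ Φ ≤ productAvg μ Ψ :=
  ENNReal.tsum_le_tsum fun x => by gcongr; exact h x

theorem productAvg_add :
    productAvg μ (fun x => Φ x + Ψ x) = productAvg μ Φ + productAvg μ Ψ := by
  simp only [productAvg, mul_add, ENNReal.tsum_add]

theorem productAvg_const_mul (a : ℝ≥0∞) :
    productAvg μ (fun x => a * Φ x) = a * productAvg μ Φ := by
  simp only [productAvg, ← ENNReal.tsum_mul_left, mul_left_comm]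

/-- Separate the coordinate `l` from the others. -/
theorem productAvg_split (μ : V → ℝ → ℝ≥0∞) (Φ : (V → ℝ) → ℝ≥0∞) (l : V) :
    productAvg μ Φ = ∑' y : {v // v ≠ l} → ℝ, (∏ v : {v // v ≠ l}, μ v (y v)) *
      avg (μ l) fun s => Φ ((Equiv.funSplitAt l ℝ).symm (s, y)) := by
  rw [productAvg, ← (Equiv.funSplitAt l ℝ).symm.tsum_eq, ENNReal.tsum_prod', ENNReal.tsum_comm]
  refine tsum_congr fun y => ?_
  rw [avg, ← ENNReal.tsum_mul_left]
  refine tsum_congr fun s => ?_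
  rw [Fintype.prod_eq_mul_prod_subtype_ne _ l, mul_comm (μ l _), mul_assoc]
  congr 1
  · refine Finset.prod_congr rfl fun v _ => ?_
    rw [Equiv.funSplitAt_symm_apply, dif_neg v.2]
  · rw [Equiv.funSplitAt_symm_apply, dif_pos rfl]

/-- Changing the law of one coordinate amounts to resampling it; the old law disappears because its
mass is one. -/
theorem productAvg_update (l : V) (h : ∑' y, μ l y = 1) (ν : ℝ → ℝ≥0∞) :
    productAvg (Function.update μ l ν) Φ
      = productAvg μ fun x => avg ν fun s => Φ (Function.update x l s) := by
  rw [productAvg_split _ _ l, productAvg_split _ _ l]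
  refine tsum_congr fun y => ?_
  congr 1
  · refine Finset.prod_congr rfl fun v _ => ?_
    rw [Function.update_of_ne v.2]
  · rw [Function.update_self]
    have h1 : ∀ s s' : ℝ, Function.update ((Equiv.funSplitAt l ℝ).symm (s, y)) l s'
        = (Equiv.funSplitAt l ℝ).symm (s', y) := by
      intro s s'
      funext v
      by_cases hv : v = l
      · subst hv
        simp [Equiv.funSplitAt_symm_apply]
      · simp [Equiv.funSplitAt_symm_apply, hv]
    simp only [h1]
    rw [avg.eq_def (μ l), ENNReal.tsum_mul_right, h, one_mul]

theorem productAvg_resample (l : V) (h : ∑' y, μ l y = 1) :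
    productAvg μ Φ = productAvg μ fun x => avg (μ l) fun s => Φ (Function.update x l s) := by
  rw [← productAvg_update l h, Function.update_eq_self]

/-- The laws outside `S` are exchanged one coordinate at a time; each exchange resamples a
coordinate that `Φ` does not see. -/
theorem productAvg_congr (h : ∀ v, ∑' y, μ v y = 1) (h' : ∀ v, ∑' y, μ' v y = 1) {S : Finset V}
    (hS : ∀ v ∈ S, μ v = μ' v) (hΦ : ∀ x y : V → ℝ, (∀ v ∈ S, x v = y v) → Φ x = Φ y) :
    productAvg μ Φ = productAvg μ' Φ := by
  have key : ∀ T : Finset V, Disjoint T S → productAvg (T.piecewise μ' μ) Φ = productAvg μ Φ := by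
    intro T
    induction T using Finset.induction_on with
    | empty => simp
    | insert j T hj ih =>
      intro hT
      rw [Finset.disjoint_insert_left] at hT
      rw [Finset.piecewise_insert, productAvg_update, ← ih hT.2]
      · congr 1
        funext x
        have : ∀ s, Φ (Function.update x j s) = Φ x := fun s => hΦ _ _ fun v hv =>
          Function.update_of_ne (ne_of_mem_of_not_mem hv hT.1) _ _
        simp only [this]
        rw [avg, ENNReal.tsum_mul_right, h', one_mul]
      · rw [Finset.piecewise_eq_of_notMem _ _ _ hj, h]
  rw [← key Sᶜ (by simpa using disjoint_compl_left)]
  congr 1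
  funext v
  by_cases hv : v ∈ S
  · rw [Finset.piecewise_eq_of_notMem _ _ _ (by simpa using hv), hS v hv]
  · rw [Finset.piecewise_eq_of_mem _ _ _ (by simpa using hv)]

/-- Independently include each `v ∈ U` with weight `a v`, and add `c (x v)` for the included ones:
the result is dominated by a compound Poisson average. -/
theorem sum_powerset_productAvg_le (h : ∀ v, ∑' y, μ v y = 1) (a : V → ℝ≥0∞) (c : ℝ → ℝ)
    (U : Finset V) (f : (V → ℝ) → ℝ → ℝ≥0∞)
    (hf : ∀ x, ∀ v ∈ U, ∀ y, f (Function.update x v y) = f x) (s : ℝ) :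
    ∑ N ∈ U.powerset, (∏ v ∈ N, a v) * productAvg μ (fun x => f x (s + ∑ v ∈ N, c (x v)))
      ≤ productAvg μ fun x => expOp c (fun y => ∑ v ∈ U, a v * μ v y) (f x) s := by
  induction U using Finset.induction_on generalizing f with
  | empty =>
    simp only [Finset.powerset_empty, Finset.sum_singleton, Finset.prod_empty, one_mul,
      Finset.sum_empty, add_zero]
    refine productAvg_mono fun x => ?_
    refine le_trans ?_ (ENNReal.le_tsum (f := fun m : ℕ => (m.factorial : ℝ≥0∞)⁻¹ *
      (shiftOp c fun _ => 0)^[m] (f x) s) 0)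
    simp
  | insert v U hv ih =>
    have e1 : ∀ N ∈ U.powerset, (∏ u ∈ insert v N, a u) *
        productAvg μ (fun x => f x (s + ∑ u ∈ insert v N, c (x u)))
        = a v * ((∏ u ∈ N, a u) *
          productAvg μ (fun x => f x (s + ∑ u ∈ N, c (x u) + c (x v)))) := by
      intro N hN
      have hvN : v ∉ N := fun h => hv (Finset.mem_powerset.1 hN h)
      simp only [Finset.prod_insert hvN, Finset.sum_insert hvN, mul_assoc, add_comm (c _),
        add_assoc]
    rw [Finset.sum_powerset_insert hv, Finset.sum_congr rfl e1, ← Finset.mul_sum]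
    have h1 := ih f (fun x u hu y => hf x u (Finset.mem_insert_of_mem hu) y)
    have h2 := ih (fun x s => f x (s + c (x v))) (fun x u hu y => by
      simp only [hf x u (Finset.mem_insert_of_mem hu) y,
        Function.update_of_ne (ne_of_mem_of_not_mem hu hv).symm])
    set m : ℝ → ℝ≥0∞ := fun y => ∑ u ∈ U, a u * μ u y
    -- If `v` is included, average over its own coordinate, on which `f` does not depend. This gives
    -- one `shiftOp`, which `expOp_add_shiftOp_le` then absorbs into the exponential series.
    have h3 : productAvg μ (fun x => expOp c m (fun s => f x (s + c (x v))) s)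
        = productAvg μ fun x => shiftOp c (μ v) (expOp c m (f x)) s := by
      rw [productAvg_resample v (h v)]
      congr 1
      funext x
      rw [shiftOp_eq_avg]
      congr 1
      funext y
      rw [Function.update_self, hf x v (Finset.mem_insert_self _ _), expOp_shift]
    rw [h3] at h2
    refine (add_le_add h1 (mul_le_mul' le_rfl h2)).trans ?_
    rw [← productAvg_const_mul, ← productAvg_add]
    refine productAvg_mono fun x => ?_
    have h4 : a v * shiftOp c (μ v) (expOp c m (f x)) s
        = shiftOp c (fun y => a v * μ v y) (expOp c m (f x)) s := by
      simp only [shiftOp, ← ENNReal.tsum_mul_left, mul_assoc]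
    rw [h4]
    refine expOp_add_shiftOp_le s |>.trans (le_of_eq ?_)
    congr 1
    funext y
    rw [Finset.sum_insert hv, add_comm]

theorem productAvg_of_single (hμ : ∀ v y, y ≠ 0 → μ v y = 0) (hμ0 : ∀ v, μ v 0 = 1) :
    productAvg μ Φ = Φ 0 := by
  rw [productAvg, tsum_eq_single 0]
  · simp [hμ0]
  · intro x hx
    obtain ⟨v, hv⟩ := Function.ne_iff.1 hx
    rw [Finset.prod_eq_zero (Finset.mem_univ v) (hμ v _ hv), zero_mul]

theorem productAvg_coordinate (h : ∀ v, ∑' y, μ v y = 1) (i : V) (φ : ℝ → ℝ≥0∞) :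
    productAvg μ (fun x => φ (x i)) = avg (μ i) φ := by
  -- The product weights have mass one: start from point masses and replace them by the given laws
  -- one coordinate at a time.
  have hone : ∀ T : Finset V, ∀ Φ : (V → ℝ) → ℝ≥0∞, Φ = (fun _ => 1) →
      productAvg (T.piecewise μ fun _ => Pi.single 0 1) Φ = 1 := by
    intro T Φ hΦ
    subst hΦ
    induction T using Finset.induction_on with
    | empty =>
      rw [Finset.piecewise_empty]
      exact productAvg_of_single (fun v y hy => Pi.single_eq_of_ne hy _) (fun v => Pi.single_eq_same _ _)
    | insert j T hj ih =>
      rw [Finset.piecewise_insert, productAvg_update]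
      · simpa only [avg, mul_one, h] using ih
      · rw [Finset.piecewise_eq_of_notMem _ _ _ hj]
        rw [tsum_eq_single 0 (fun y hy => Pi.single_eq_of_ne hy _), Pi.single_eq_same]
  refine (productAvg_resample i (h i)).trans ?_
  simp only [Function.update_self]
  have := hone Finset.univ _ rfl
  rw [Finset.piecewise_univ] at this
  have h2 := productAvg_const_mul (μ := μ) (Φ := fun _ => 1) (avg (μ i) φ)
  simp only [mul_one] at h2
  rw [this, mul_one] at h2
  exact h2

end ProductAverage

/-! ### Comparison of the exploration with the Poisson tree -/

section PartialLevel

open Classical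

variable {V : Type*} [DecidableEq V]

/-- The values at `S' ∪ S` if the vertices of `S` are one level above those of `S'`. -/
def partialValue (off : ℝ) (con : ℝ → ℝ) (H : SimpleGraph V) (t : ℕ) (S S' U : Finset V) (l : V) :
    ℝ :=
  if l ∈ S then off + ∑ v ∈ U with H.Adj l v,
    con (treeValue off con H t (S' ∪ nextLevel H S U) (U \ nextLevel H S U) v)
  else treeValue off con H t (S' ∪ nextLevel H S U) (U \ nextLevel H S U) l

/-- The exploration is treelike if the vertices of `S` are one level above those of `S'`. -/
def IsPartiallyTreelike (L : ℝ) (Z : Finset V) (H : SimpleGraph V) (t : ℕ) (S S' U : Finset V) :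
    Prop :=
  (∀ v ∈ U, ∀ l ∈ S, ∀ l' ∈ S, H.Adj l v → H.Adj l' v → l = l') ∧
    ((S' ∪ nextLevel H S U).card : ℝ) ≤ L ∧
    IsTreelike L Z H t (S' ∪ nextLevel H S U) (U \ nextLevel H S U)

variable {H H' : SimpleGraph V} {S S' U W Z : Finset V} {off L : ℝ} {con : ℝ → ℝ}

/-- Basis for exposing one vertex at a time: the children of `l` are removed from the unexplored set
first, and the rest of the level is explored in what remains. -/
theorem nextLevel_insert (l : V) :
    nextLevel H (insert l S) U
      = U.filter (H.Adj l) ∪ nextLevel H S (U \ U.filter (H.Adj l)) := by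
  ext v
  simp only [mem_nextLevel, Finset.mem_union, Finset.mem_filter, Finset.mem_sdiff,
    Finset.mem_insert, exists_eq_or_imp]
  tauto

theorem union_nextLevel_insert (l : V) : S' ∪ nextLevel H (insert l S) U
    = S' ∪ U.filter (H.Adj l) ∪ nextLevel H S (U \ U.filter (H.Adj l)) := by
  rw [nextLevel_insert, Finset.union_assoc]

theorem sdiff_nextLevel_insert (l : V) : U \ nextLevel H (insert l S) U
    = (U \ U.filter (H.Adj l)) \ nextLevel H S (U \ U.filter (H.Adj l)) := by
  rw [nextLevel_insert, sdiff_sdiff_left, Finset.sup_eq_union]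

theorem IsPartiallyTreelike.insert {t : ℕ} {l : V}
    (h : IsPartiallyTreelike L Z H t (insert l S) S' U) :
    IsPartiallyTreelike L Z H t S (S' ∪ U.filter (H.Adj l)) (U \ U.filter (H.Adj l)) := by
  obtain ⟨h1, h2, h3⟩ := h
  rw [union_nextLevel_insert] at h2 h3
  rw [sdiff_nextLevel_insert] at h3
  exact ⟨fun v hv a ha b hb => h1 v (Finset.mem_sdiff.1 hv).1 a (Finset.mem_insert_of_mem ha) b
    (Finset.mem_insert_of_mem hb), h2, h3⟩

/-- After its children have moved to the lower level, the value at `l` is a function of their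
values. The other values do not change, since in a forest no other vertex of the level shares a
child with `l`. -/
theorem partialValue_insert {t : ℕ} {l : V} (hl : l ∉ S) (hSU : Disjoint S U)
    (h : IsPartiallyTreelike L Z H t (insert l S) S' U) :
    partialValue off con H t (insert l S) S' U
      = Function.update (partialValue off con H t S (S' ∪ U.filter (H.Adj l))
          (U \ U.filter (H.Adj l))) l (off + ∑ v ∈ U.filter (H.Adj l),
            con (partialValue off con H t S (S' ∪ U.filter (H.Adj l))
              (U \ U.filter (H.Adj l)) v)) := by
  funext m
  rcases eq_or_ne m l with rfl | hm
  · rw [Function.update_self, partialValue, if_pos (Finset.mem_insert_self _ _)]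
    refine congrArg _ (Finset.sum_congr rfl fun v hv => ?_)
    have hvS : v ∉ S := fun hv' => Finset.disjoint_left.1 hSU hv' (Finset.mem_filter.1 hv).1
    rw [partialValue, if_neg hvS, union_nextLevel_insert, sdiff_nextLevel_insert]
  · rw [Function.update_of_ne hm, partialValue, partialValue, union_nextLevel_insert,
      sdiff_nextLevel_insert]
    by_cases hmS : m ∈ S
    · rw [if_pos (Finset.mem_insert_of_mem hmS), if_pos hmS]
      refine congrArg _ (Finset.sum_congr ?_ fun _ _ => rfl)
      ext v
      simp only [Finset.mem_filter, Finset.mem_sdiff]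
      constructor
      · rintro ⟨hv, ha⟩
        exact ⟨⟨hv, fun h' => hm (h.1 v hv m (Finset.mem_insert_of_mem hmS) l
          (Finset.mem_insert_self _ _) ha h'.2)⟩, ha⟩
      · rintro ⟨⟨hv, -⟩, ha⟩
        exact ⟨hv, ha⟩
    · rw [if_neg (by simp [hm, hmS]), if_neg hmS]

theorem partialValue_congr (hH : ∀ a ∈ W, ∀ b ∈ W, (H.Adj a b ↔ H'.Adj a b)) (t : ℕ)
    (hS : S ⊆ W) (hS' : S' ⊆ W) (hU : U ⊆ W) {l : V} (hl : l ∈ W) :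
    partialValue off con H t S S' U l = partialValue off con H' t S S' U l := by
  have h1 : nextLevel H S U = nextLevel H' S U :=
    nextLevel_congr fun a ha b hb => hH a (hS ha) b (hU hb)
  have h2 : (U.filter fun v => H.Adj l v) = U.filter fun v => H'.Adj l v :=
    Finset.filter_congr fun v hv => hH l hl v (hU hv)
  have h3 : ∀ v ∈ W, treeValue off con H t (S' ∪ nextLevel H' S U) (U \ nextLevel H' S U) v
      = treeValue off con H' t (S' ∪ nextLevel H' S U) (U \ nextLevel H' S U) v := fun v hv =>
    treeValue_congr hH t (Finset.union_subset hS' (nextLevel_subset.trans hU))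
      (Finset.sdiff_subset.trans hU) hv
  rw [partialValue, partialValue, h1, h2, h3 l hl]
  refine if_congr Iff.rfl (congrArg _ (Finset.sum_congr rfl fun v hv => ?_)) rfl
  rw [h3 v (hU (Finset.mem_filter.1 hv).1)]

theorem isPartiallyTreelike_congr (hH : ∀ a ∈ W, ∀ b ∈ W, (H.Adj a b ↔ H'.Adj a b)) (t : ℕ)
    (hS : S ⊆ W) (hS' : S' ⊆ W) (hU : U ⊆ W) (hZ : Z ⊆ W) :
    IsPartiallyTreelike L Z H t S S' U ↔ IsPartiallyTreelike L Z H' t S S' U := by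
  have h1 : nextLevel H S U = nextLevel H' S U :=
    nextLevel_congr fun a ha b hb => hH a (hS ha) b (hU hb)
  unfold IsPartiallyTreelike
  rw [h1, isTreelike_congr hH t (Finset.union_subset hS' (nextLevel_subset.trans hU))
      (Finset.sdiff_subset.trans hU) hZ]
  refine and_congr ?_ Iff.rfl
  refine forall₂_congr fun v hv => forall₂_congr fun l hl => forall₂_congr fun l' hl' => ?_
  rw [hH l (hS hl) v (hU hv), hH l' (hS hl') v (hU hv)]

theorem nextLevel_empty : nextLevel H ∅ U = ∅ := by simp [nextLevel]

theorem isPartiallyTreelike_empty {t : ℕ} :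
    IsPartiallyTreelike L Z H t ∅ S' U ↔ (S'.card : ℝ) ≤ L ∧ IsTreelike L Z H t S' U := by
  simp [IsPartiallyTreelike, nextLevel_empty]

theorem partialValue_empty (t : ℕ) :
    partialValue off con H t ∅ S' U = treeValue off con H t S' U := by
  funext l
  simp [partialValue, nextLevel_empty]

theorem IsTreelike.isPartiallyTreelike {t : ℕ} (h : IsTreelike L Z H (t + 1) S U) :
    IsPartiallyTreelike L Z H t S ∅ U := by
  obtain ⟨h1, -, h3, h4⟩ := h
  refine ⟨h1, ?_, ?_⟩
  · rwa [Finset.empty_union]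
  · rwa [Finset.empty_union]

theorem partialValue_eq_treeValue (t : ℕ) {l : V} (hl : l ∈ S) :
    partialValue off con H t S ∅ U l = treeValue off con H (t + 1) S U l := by
  rw [partialValue, if_pos hl, Finset.empty_union, treeValue]

end PartialLevel

/-! ### Domination of the law of a belief by its law on the Poisson tree -/

section Comparison

open Classical

/-- The absent edges contribute the product of 1 - w ≤ e^{-w}: the step from Bernoulli to Poisson,
as an upper bound only. -/
theorem prob_filter_adj_eq_le {V : Type*} [Fintype V] [DecidableEq V] {w : Sym2 V → ℝ}
    (hw : ∀ e, 0 ≤ w e ∧ w e ≤ 1) {U N : Finset V} (hN : N ⊆ U) {l : V} (hl : l ∉ U) :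
    prob w (fun H => U.filter (H.Adj l) = N)
      ≤ ENNReal.ofReal (Real.exp (-∑ v ∈ U \ N, w s(l, v)))
        * ∏ v ∈ N, ENNReal.ofReal (w s(l, v)) := by
  have hinj : ∀ s : Set V, Set.InjOn (fun v => s(l, v)) s := fun s a _ b _ h =>
    Sym2.congr_right.1 h
  have h1 : ∀ A ⊆ U, A.image (fun v => s(l, v)) ⊆ pairs V := by
    intro A hA e he
    obtain ⟨v, hv, rfl⟩ := Finset.mem_image.1 he
    exact mk_mem_pairs.2 fun h => hl (h ▸ hA hv)
  have h := prob_edges hw (h1 N hN) (h1 (U \ N) Finset.sdiff_subset) (by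
    rw [Finset.disjoint_left]
    intro e he he'
    obtain ⟨v, hv, rfl⟩ := Finset.mem_image.1 he
    obtain ⟨u, hu, huv⟩ := Finset.mem_image.1 he'
    rw [Sym2.congr_right.1 huv] at hu
    exact (Finset.mem_sdiff.1 hu).2 hv)
  rw [Finset.prod_image (hinj _), Finset.prod_image (hinj _)] at h
  refine (prob_mono fun H hH => ?_).trans (h.le.trans ?_)
  · constructor
    · intro e he
      obtain ⟨v, hv, rfl⟩ := Finset.mem_image.1 he
      rw [← hH] at hv
      exact (Finset.mem_filter.1 hv).2
    · intro e he h'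
      obtain ⟨v, hv, rfl⟩ := Finset.mem_image.1 he
      obtain ⟨hvU, hvN⟩ := Finset.mem_sdiff.1 hv
      exact hvN (hH ▸ Finset.mem_filter.2 ⟨hvU, h'⟩)
  · rw [mul_comm, ← Finset.sum_neg_distrib, Real.exp_sum,
      ENNReal.ofReal_prod_of_nonneg fun _ _ => Real.exp_nonneg _]
    gcongr
    exact Real.one_sub_le_exp_neg _

namespace Params

variable (P : Params) (C : Finset (Fin P.n))

/-- The law of the message of a vertex. -/
def vertexLaw (t : ℕ) (v : Fin P.n) : ℝ → ℝ≥0∞ := P.law t (decide (v ∈ C))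

theorem edgeProb_mem (hp : P.p ≤ 1) (e : Sym2 (Fin P.n)) :
    0 ≤ edgeProb P.p P.q C e ∧ edgeProb P.p P.q C e ≤ 1 := by
  unfold edgeProb
  split_ifs
  · exact ⟨P.p_pos.le, hp⟩
  · exact ⟨P.q_pos.le, P.q_le.trans hp⟩

theorem edgeProb_le (e : Sym2 (Fin P.n)) : edgeProb P.p P.q C e ≤ P.p := by
  unfold edgeProb
  split_ifs
  · exact le_rfl
  · exact P.q_le

theorem edgeProb_mk (l v : Fin P.n) : edgeProb P.p P.q C s(l, v)
    = if v ∈ C then P.rate (decide (l ∈ C)) else P.q := by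
  unfold edgeProb rate
  by_cases hl : l ∈ C <;> by_cases hv : v ∈ C <;> simp [hl, hv]

variable {C} {U : Finset (Fin P.n)}

theorem sum_edgeProb (l : Fin P.n) : ∑ v ∈ U, edgeProb P.p P.q C s(l, v)
    = (U ∩ C).card * P.rate (decide (l ∈ C)) + (U \ C).card * P.q := by
  simp only [edgeProb_mk]
  rw [Finset.sum_ite, Finset.sum_const, Finset.sum_const, nsmul_eq_mul, nsmul_eq_mul,
    Finset.filter_mem_eq_inter, Finset.filter_notMem_eq_sdiff]

theorem card_inter_add_card_sdiff : ((U ∩ C).card : ℝ) + (U \ C).card = U.card := by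
  exact_mod_cast Finset.card_inter_add_card_sdiff U C

theorem rate_le (b : Bool) : P.rate b ≤ P.p := by
  cases b <;> simp [rate, P.q_le]

theorem degree_le_sum_edgeProb (hUC : ((U ∩ C).card : ℝ) ≤ P.K)
    (hUC' : ((U \ C).card : ℝ) ≤ P.n - P.K) (l : Fin P.n) :
    P.degree (decide (l ∈ C)) - P.p * (P.n - U.card) ≤ ∑ v ∈ U, edgeProb P.p P.q C s(l, v) := by
  rw [sum_edgeProb, degree, ← card_inter_add_card_sdiff (C := C)]
  nlinarith [P.rate_le (decide (l ∈ C)), P.q_le]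

/-- The unexplored set has at most K vertices inside and at most n - K outside `C`, so its total
weight is dominated by that of the Poisson tree. -/
theorem sum_mul_vertexLaw_le (hUC : ((U ∩ C).card : ℝ) ≤ P.K)
    (hUC' : ((U \ C).card : ℝ) ≤ P.n - P.K) (t : ℕ) (l : Fin P.n) (y : ℝ) :
    ∑ v ∈ U, ENNReal.ofReal (edgeProb P.p P.q C s(l, v)) * P.vertexLaw C t v y
      ≤ P.mixLaw t (decide (l ∈ C)) y := by
  have h1 : ∀ v ∈ U, ENNReal.ofReal (edgeProb P.p P.q C s(l, v)) * P.vertexLaw C t v y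
      = if v ∈ C then ENNReal.ofReal (P.rate (decide (l ∈ C))) * P.law t true y
        else ENNReal.ofReal P.q * P.law t false y := by
    intro v _
    rw [edgeProb_mk, vertexLaw]
    by_cases hv : v ∈ C <;> simp [hv]
  rw [Finset.sum_congr rfl h1, Finset.sum_ite, Finset.sum_const, Finset.sum_const, nsmul_eq_mul,
    nsmul_eq_mul, Finset.filter_mem_eq_inter, Finset.filter_notMem_eq_sdiff, mixLaw, mix,
    ENNReal.ofReal_mul P.K_cast_pos.le, ENNReal.ofReal_mul P.n_sub_K_pos.le, mul_assoc, mul_assoc]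
  gcongr
  · rw [← ENNReal.ofReal_natCast]
    exact ENNReal.ofReal_le_ofReal hUC
  · rw [← ENNReal.ofReal_natCast]
    exact ENNReal.ofReal_le_ofReal hUC'

theorem tsum_vertexLaw (t : ℕ) (v : Fin P.n) : ∑' y, P.vertexLaw C t v y = 1 :=
  P.tsum_law t _

/-- The laws of the values of a partial level. -/
def partialLaw (C : Finset (Fin P.n)) (t : ℕ) (S : Finset (Fin P.n)) (v : Fin P.n) : ℝ → ℝ≥0∞ :=
  P.vertexLaw C (if v ∈ S then t + 1 else t) v

theorem tsum_partialLaw (t : ℕ) (S : Finset (Fin P.n)) (v : Fin P.n) :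
    ∑' y, P.partialLaw C t S v y = 1 := P.tsum_law _ _

theorem partialLaw_insert (t : ℕ) (S : Finset (Fin P.n)) (l : Fin P.n) :
    P.partialLaw C t (insert l S)
      = Function.update (P.partialLaw C t S) l (P.law (t + 1) (decide (l ∈ C))) := by
  funext v
  rcases eq_or_ne v l with rfl | hv
  · rw [Function.update_self, partialLaw, if_pos (Finset.mem_insert_self _ _), vertexLaw]
  · rw [Function.update_of_ne hv, partialLaw, partialLaw]
    simp only [Finset.mem_insert, hv, false_or]

/-- The exponent should be the full degree. It lacks the at most B vertices missing from `U` and the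
at most L vertices of `N`, each worth at most p; this is the factor e^{p(B+L)}. -/
theorem prob_filter_adj_eq_le (hp : P.p ≤ 1) {N : Finset (Fin P.n)}
    (hUC : ((U ∩ C).card : ℝ) ≤ P.K) (hUC' : ((U \ C).card : ℝ) ≤ P.n - P.K)
    (hN : N ⊆ U) {l : Fin P.n} (hl : l ∉ U) {L B : ℝ} (hNL : (N.card : ℝ) ≤ L)
    (hB : (P.n : ℝ) - U.card ≤ B) :
    prob (edgeProb P.p P.q C) (fun H => U.filter (H.Adj l) = N)
      ≤ ENNReal.ofReal (Real.exp (P.p * (B + L))) *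
        (ENNReal.ofReal (Real.exp (-P.degree (decide (l ∈ C)))) *
        ∏ v ∈ N, ENNReal.ofReal (edgeProb P.p P.q C s(l, v))) := by
  refine (HiddenCommunity.prob_filter_adj_eq_le (P.edgeProb_mem C hp) hN hl).trans ?_
  rw [← mul_assoc, ← ENNReal.ofReal_mul (Real.exp_nonneg _), ← Real.exp_add]
  gcongr
  have h1 := P.degree_le_sum_edgeProb hUC hUC' l
  have h2 := Finset.sum_sdiff (f := fun v => edgeProb P.p P.q C s(l, v)) hN
  have h3 : ∑ v ∈ N, edgeProb P.p P.q C s(l, v) ≤ N.card * P.p := by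
    rw [← nsmul_eq_mul]
    exact Finset.sum_le_card_nsmul _ _ _ fun v _ => P.edgeProb_le C _
  nlinarith [P.p_pos]

variable {L B : ℝ} {Z : Finset (Fin P.n)}

/-- The hypotheses on the unexplored part of the graph. -/
structure Unexplored (C Z U : Finset (Fin P.n)) : Prop where
  disjoint : Disjoint U Z
  inter_le : ((U ∩ C).card : ℝ) ≤ P.K
  sdiff_le : ((U \ C).card : ℝ) ≤ P.n - P.K

theorem Unexplored.mono {U U' : Finset (Fin P.n)} (h : P.Unexplored C Z U) (hU : U' ⊆ U) :
    P.Unexplored C Z U' where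
  disjoint := h.disjoint.mono_left hU
  inter_le := (Nat.cast_le.2 (Finset.card_le_card
    (Finset.inter_subset_inter_right hU))).trans h.inter_le
  sdiff_le := (Nat.cast_le.2 (Finset.card_le_card
    (Finset.sdiff_subset_sdiff hU le_rfl))).trans h.sdiff_le

/-- Expose the set `N` of children of `l`. It is independent of the edges not touching `l`, so the
induction hypothesis applies with `N` moved from `U` to `S'`, which preserves the budget n - |U| -
|S'|. Summing over `N` gives at most a compound Poisson average, which with the factor e^{-degree}
is the law of `l` one round later. -/
theorem expect_partialLevel_step (hp : P.p ≤ 1) (hL : 0 ≤ L) (hB : 0 ≤ B) (t : ℕ)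
    {S S' : Finset (Fin P.n)} {l : Fin P.n} (hlS : l ∉ S) {F : ℝ≥0∞}
    (ih : ∀ (S' U : Finset (Fin P.n)), Disjoint S S' → Disjoint S U → Disjoint S' U →
      Disjoint S Z → Disjoint S' Z →
      P.Unexplored C Z U → (P.n : ℝ) - U.card - S'.card + (t + 1) * L ≤ B →
      ∀ Φ : (Fin P.n → ℝ) → ℝ≥0∞, (∀ x y, (∀ v ∈ S ∪ S', x v = y v) → Φ x = Φ y) →
      expect (edgeProb P.p P.q C) (fun H => (if IsPartiallyTreelike L Z H t S S' U then 1 else 0)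
        * Φ (partialValue P.off P.con H t S S' U)) ≤ F * productAvg (P.partialLaw C t S) Φ)
    (hSS' : Disjoint (insert l S) S') (hSU : Disjoint (insert l S) U) (hS'U : Disjoint S' U)
    (hSZ : Disjoint (insert l S) Z) (hS'Z : Disjoint S' Z)
    (hU : P.Unexplored C Z U) (hUB : (P.n : ℝ) - U.card - S'.card + (t + 1) * L ≤ B)
    (Φ : (Fin P.n → ℝ) → ℝ≥0∞) (hΦ : ∀ x y, (∀ v ∈ insert l S ∪ S', x v = y v) → Φ x = Φ y) :
    expect (edgeProb P.p P.q C)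
        (fun H => (if IsPartiallyTreelike L Z H t (insert l S) S' U then 1 else 0)
          * Φ (partialValue P.off P.con H t (insert l S) S' U))
      ≤ F * ENNReal.ofReal (Real.exp (P.p * (B + L))) *
        productAvg (P.partialLaw C t (insert l S)) Φ := by
  have hw := P.edgeProb_mem C hp
  -- Otherwise the size bound of `IsPartiallyTreelike` fails and the left side vanishes.
  by_cases hS'L : (S'.card : ℝ) ≤ L
  swap
  · refine (le_of_eq ?_).trans zero_le
    unfold expect
    refine Finset.sum_eq_zero fun H _ => ?_
    beta_reduce
    rw [if_neg, zero_mul, mul_zero]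
    intro h
    refine hS'L (le_trans ?_ h.2.1)
    exact_mod_cast Finset.card_le_card Finset.subset_union_left
  obtain ⟨hlU, hSU'⟩ := Finset.disjoint_insert_left.1 hSU
  obtain ⟨hlS', hSS''⟩ := Finset.disjoint_insert_left.1 hSS'
  obtain ⟨hlZ, hSZ'⟩ := Finset.disjoint_insert_left.1 hSZ
  have hUB' : (P.n : ℝ) - U.card ≤ B := by
    have := mul_nonneg (Nat.cast_nonneg (α := ℝ) t) hL
    nlinarith
  set f : (Fin P.n → ℝ) → ℝ → ℝ≥0∞ := fun x s => Φ (Function.update x l s)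
  set g : Finset (Fin P.n) → SimpleGraph (Fin P.n) → ℝ≥0∞ := fun N H =>
    (if IsPartiallyTreelike L Z H t S (S' ∪ N) (U \ N) then 1 else 0) *
    f (partialValue P.off P.con H t S (S' ∪ N) (U \ N)) (P.off + ∑ v ∈ N,
      P.con (partialValue P.off P.con H t S (S' ∪ N) (U \ N) v))
  have h1 : ∀ H : SimpleGraph (Fin P.n),
      (if IsPartiallyTreelike L Z H t (insert l S) S' U then 1 else 0)
          * Φ (partialValue P.off P.con H t (insert l S) S' U)
      ≤ ∑ N ∈ U.powerset with (N.card : ℝ) ≤ L,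
        (if U.filter (H.Adj l) = N then 1 else 0) * g N H := by
    intro H
    split_ifs with h
    · have hmem : U.filter (H.Adj l) ∈ U.powerset.filter fun N => (N.card : ℝ) ≤ L := by
        refine Finset.mem_filter.2 ⟨Finset.mem_powerset.2 (Finset.filter_subset _ _), ?_⟩
        refine le_trans ?_ h.2.1
        rw [nextLevel_insert]
        exact_mod_cast Finset.card_le_card
          (Finset.subset_union_left.trans Finset.subset_union_right)
      refine le_trans (le_of_eq ?_) (Finset.single_le_sum (f := fun N =>
        (if U.filter (H.Adj l) = N then (1 : ℝ≥0∞) else 0) * g N H) (fun _ _ => zero_le) hmem)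
      rw [one_mul, partialValue_insert hlS hSU' h]
      simp only [if_true, one_mul, g, f]
      rw [if_pos h.insert, one_mul]
    · rw [zero_mul]
      exact zero_le
  refine (expect_mono h1).trans ?_
  rw [expect_sum]
  set a : Fin P.n → ℝ≥0∞ := fun v => ENNReal.ofReal (edgeProb P.p P.q C s(l, v))
  set E := ENNReal.ofReal (Real.exp (P.p * (B + L)))
  set D := ENNReal.ofReal (Real.exp (-P.degree (decide (l ∈ C))))
  have h2 : ∀ N ∈ U.powerset.filter fun N => (N.card : ℝ) ≤ L,
      expect (edgeProb P.p P.q C) (fun H => (if U.filter (H.Adj l) = N then 1 else 0) * g N H)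
      ≤ F * E * D * ((∏ v ∈ N, a v) * productAvg (P.partialLaw C t S) fun x =>
        f x (P.off + ∑ v ∈ N, P.con (x v))) := by
    intro N hN
    obtain ⟨hNU, hNL⟩ := Finset.mem_filter.1 hN
    rw [Finset.mem_powerset] at hNU
    have hdep : ∀ x y : Fin P.n → ℝ, (∀ v ∈ S ∪ (S' ∪ N), x v = y v) →
        f x (P.off + ∑ v ∈ N, P.con (x v)) = f y (P.off + ∑ v ∈ N, P.con (y v)) := by
      intro x y hxy
      have e1 : ∑ v ∈ N, P.con (x v) = ∑ v ∈ N, P.con (y v) :=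
        Finset.sum_congr rfl fun v hv => by rw [hxy v (by simp [hv])]
      rw [e1]
      refine hΦ _ _ fun v hv => ?_
      rcases eq_or_ne v l with rfl | hvl
      · rw [Function.update_self, Function.update_self]
      · rw [Function.update_of_ne hvl, Function.update_of_ne hvl]
        refine hxy v ?_
        simp only [Finset.mem_union, Finset.mem_insert, hvl, false_or] at hv ⊢
        tauto
    rw [expect_mul hw {l}]
    · have h3 := P.prob_filter_adj_eq_le hp hU.inter_le hU.sdiff_le hNU hlU hNL hUB'
      have h4 := ih (S' ∪ N) (U \ N) (Finset.disjoint_union_right.2 ⟨hSS'', hSU'.mono_right hNU⟩)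
        (hSU'.mono_right Finset.sdiff_subset)
        (Finset.disjoint_union_left.2 ⟨hS'U.mono_right Finset.sdiff_subset,
          Finset.disjoint_sdiff⟩) hSZ'
        (Finset.disjoint_union_left.2 ⟨hS'Z, hU.disjoint.mono_left hNU⟩)
        (hU.mono P Finset.sdiff_subset) (by
          rw [Finset.card_union_of_disjoint (hS'U.mono_right hNU), Finset.card_sdiff_of_subset hNU,
            Nat.cast_sub (Finset.card_le_card hNU)]
          push_cast
          linarith) _ hdep
      refine (mul_le_mul' (le_trans (le_of_eq (by unfold prob; congr!)) h3) h4).trans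
        (le_of_eq ?_)
      ring
    · intro H H' h
      have : U.filter (H.Adj l) = U.filter (H'.Adj l) :=
        Finset.filter_congr fun v _ => h l v (Or.inl rfl)
      simp only [this]
    · intro H H' h
      have hlW : ∀ v ∈ S ∪ S' ∪ U ∪ Z, v ∉ ({l} : Set (Fin P.n)) := by
        rintro v hv rfl
        simp only [Finset.mem_union] at hv
        tauto
      have hH : ∀ u ∈ S ∪ S' ∪ U ∪ Z, ∀ v ∈ S ∪ S' ∪ U ∪ Z, (H.Adj u v ↔ H'.Adj u v) :=
        fun u hu v hv => h u v (hlW u hu) (hlW v hv)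
      have s1 : S ⊆ S ∪ S' ∪ U ∪ Z := fun v hv => by simp [hv]
      have s2 : S' ∪ N ⊆ S ∪ S' ∪ U ∪ Z := fun v hv => by
        rcases Finset.mem_union.1 hv with hv | hv
        · simp [hv]
        · simp [hNU hv]
      have s3 : U \ N ⊆ S ∪ S' ∪ U ∪ Z := fun v hv => by simp [(Finset.mem_sdiff.1 hv).1]
      have s4 : Z ⊆ S ∪ S' ∪ U ∪ Z := fun v hv => by simp [hv]
      have e1 := isPartiallyTreelike_congr (L := L) hH t s1 s2 s3 s4
      simp only [g, e1]
      congr 1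
      refine hdep _ _ fun v hv => ?_
      exact partialValue_congr hH t s1 s2 s3 (Finset.union_subset s1 s2 hv)
  refine (Finset.sum_le_sum h2).trans ?_
  rw [← Finset.mul_sum]
  have hfU : ∀ x, ∀ v ∈ U, ∀ y, f (Function.update x v y) = f x := by
    intro x v hv y
    funext s
    refine hΦ _ _ fun u hu => ?_
    rcases eq_or_ne u l with rfl | hul
    · rw [Function.update_self, Function.update_self]
    · rw [Function.update_of_ne hul, Function.update_of_ne hul, Function.update_of_ne]
      rintro rfl
      rcases Finset.mem_union.1 hu with hu | hu
      · exact Finset.disjoint_left.1 hSU hu hv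
      · exact Finset.disjoint_left.1 hS'U hu hv
  have h5 := sum_powerset_productAvg_le (P.tsum_partialLaw (C := C) t S) a P.con U f hfU P.off
  have h6 : ∑ N ∈ U.powerset with (N.card : ℝ) ≤ L, (∏ v ∈ N, a v) *
      productAvg (P.partialLaw C t S) (fun x => f x (P.off + ∑ v ∈ N, P.con (x v)))
      ≤ productAvg (P.partialLaw C t S) fun x =>
        expOp P.con (P.mixLaw t (decide (l ∈ C))) (f x) P.off := by
    refine (Finset.sum_le_sum_of_subset (Finset.filter_subset _ _)).trans (h5.trans ?_)
    refine productAvg_mono fun x => expOp_mono_weight (fun y => ?_) _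
    refine (le_of_eq (Finset.sum_congr rfl fun v hv => ?_)).trans
      (P.sum_mul_vertexLaw_le hU.inter_le hU.sdiff_le t l y)
    rw [partialLaw, if_neg fun h => Finset.disjoint_left.1 hSU' h hv]
  calc _ ≤ F * E * D * productAvg (P.partialLaw C t S) fun x =>
        expOp P.con (P.mixLaw t (decide (l ∈ C))) (f x) P.off := by gcongr
    _ = F * E * productAvg (P.partialLaw C t S) fun x =>
        avg (P.law (t + 1) (decide (l ∈ C))) (f x) := by
      simp only [avg_law_succ]
      rw [productAvg_const_mul]
      ring
    _ = _ := by
      rw [partialLaw_insert, productAvg_update _ (P.tsum_partialLaw t S l)]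

/-- The law of the values of a treelike exploration is dominated, up to a constant factor, by the
law on the Poisson tree. -/
theorem expect_treeValue_le (hp : P.p ≤ 1) (hL : 0 ≤ L) (hB : 0 ≤ B) (t : ℕ)
    {S U : Finset (Fin P.n)} (hSU : Disjoint S U) (hSZ : Disjoint S Z) (hU : P.Unexplored C Z U)
    (hUB : (P.n : ℝ) - U.card + t * L ≤ B) (hS : (S.card : ℝ) ≤ L)
    (Φ : (Fin P.n → ℝ) → ℝ≥0∞) (hΦ : ∀ x y, (∀ v ∈ S, x v = y v) → Φ x = Φ y) :
    expect (edgeProb P.p P.q C) (fun H => (if IsTreelike L Z H t S U then 1 else 0)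
        * Φ (treeValue P.off P.con H t S U))
      ≤ ENNReal.ofReal (Real.exp (P.p * (B + L) * L * t)) * productAvg (P.vertexLaw C t) Φ := by
  induction t generalizing S U Φ with
  | zero =>
    have h1 : productAvg (P.vertexLaw C 0) Φ = Φ 0 := by
      refine productAvg_of_single (fun v y hy => ?_) (fun v => ?_)
      · exact Pi.single_eq_of_ne hy _
      · exact Pi.single_eq_same _ _
    have h2 : ∀ H : SimpleGraph (Fin P.n), (if IsTreelike L Z H 0 S U then (1 : ℝ≥0∞) else 0)
        * Φ (treeValue P.off P.con H 0 S U) = Φ 0 * 1 := by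
      intro H
      rw [if_pos (by trivial), one_mul, mul_one]
      rfl
    rw [funext h2, expect_const_mul, expect_one (P.edgeProb_mem C hp), h1]
    simp
  | succ t ih =>
    set E := ENNReal.ofReal (Real.exp (P.p * (B + L)))
    set F := ENNReal.ofReal (Real.exp (P.p * (B + L) * L * t))
    -- Each vertex of the level costs a factor E, hence E^|S| in total, and |S| ≤ L.
    have key : ∀ (S : Finset (Fin P.n)) (S' U : Finset (Fin P.n)), Disjoint S S' → Disjoint S U →
        Disjoint S' U → Disjoint S Z → Disjoint S' Z → P.Unexplored C Z U →
        (P.n : ℝ) - U.card - S'.card + (t + 1) * L ≤ B →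
        ∀ Φ : (Fin P.n → ℝ) → ℝ≥0∞, (∀ x y, (∀ v ∈ S ∪ S', x v = y v) → Φ x = Φ y) →
        expect (edgeProb P.p P.q C)
          (fun H => (if IsPartiallyTreelike L Z H t S S' U then 1 else 0)
            * Φ (partialValue P.off P.con H t S S' U))
          ≤ F * E ^ S.card * productAvg (P.partialLaw C t S) Φ := by
      intro S
      induction S using Finset.induction_on with
      | empty =>
        intro S' U _ _ hS'U _ hS'Z hU hUB Φ hΦ
        simp only [isPartiallyTreelike_empty, partialValue_empty]
        have h1 : P.partialLaw C t ∅ = P.vertexLaw C t := by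
          funext v
          simp [partialLaw]
        rw [h1, Finset.card_empty, pow_zero, mul_one]
        -- The whole level is exposed. If |S'| ≤ L, the budget still covers the remaining `t`
        -- levels; otherwise the event is empty.
        by_cases hS' : (S'.card : ℝ) ≤ L
        · simp only [hS', true_and]
          refine ih hS'U hS'Z hU (by linarith) hS' Φ fun x y hxy => hΦ x y fun v hv =>
            hxy v (by simpa using hv)
        · simp only [hS', false_and, if_false, zero_mul]
          refine (le_of_eq ?_).trans zero_le
          simp [expect]
      | insert l S hl ihS =>
        intro S' U h1 h2 h3 h4 h5 h6 h7 Φ hΦ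
        rw [Finset.card_insert_of_notMem hl, pow_succ, ← mul_assoc]
        exact P.expect_partialLevel_step hp hL hB t hl ihS h1 h2 h3 h4 h5 h6 h7 Φ hΦ
    have h1 := key S ∅ U (by simp) hSU (by simp) hSZ (by simp) hU (by
      push_cast at hUB
      simpa using hUB) Φ (fun x y hxy => hΦ x y fun v hv => hxy v (by simpa using hv))
    have h2 : expect (edgeProb P.p P.q C) (fun H => (if IsTreelike L Z H (t + 1) S U then 1 else 0)
        * Φ (treeValue P.off P.con H (t + 1) S U))
        ≤ expect (edgeProb P.p P.q C)
          (fun H => (if IsPartiallyTreelike L Z H t S ∅ U then 1 else 0)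
            * Φ (partialValue P.off P.con H t S ∅ U)) := by
      refine expect_mono fun H => ?_
      split_ifs with h h'
      · rw [hΦ _ _ fun v hv => (partialValue_eq_treeValue (off := P.off) (con := P.con)
          (H := H) (U := U) t hv).symm]
      · exact absurd h.isPartiallyTreelike h'
      · simp
      · simp
    refine h2.trans (h1.trans ?_)
    rw [productAvg_congr (μ' := P.vertexLaw C (t + 1)) (S := S) (P.tsum_partialLaw t S)
      (P.tsum_vertexLaw (t + 1)) (fun v hv => by rw [partialLaw, if_pos hv]) hΦ]
    gcongr
    rw [← ENNReal.ofReal_pow (Real.exp_nonneg _), ← ENNReal.ofReal_mul (Real.exp_nonneg _),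
      ← Real.exp_nat_mul, ← Real.exp_add]
    refine ENNReal.ofReal_le_ofReal (Real.exp_le_exp.2 ?_)
    push_cast
    nlinarith [mul_nonneg P.p_pos.le (add_nonneg hB hL)]

/-- The law of the belief of a vertex with a treelike neighborhood is dominated, up to a constant
factor, by the law on the Poisson tree. -/
theorem expect_belief_le (hp : P.p ≤ 1) (hL : 1 ≤ L) (hB : 0 ≤ B) {t : ℕ} (ht : t ≠ 0)
    {i : Fin P.n} (hi : i ∉ Z) (hU : P.Unexplored C Z (Finset.univ \ insert i Z))
    (hZB : 1 + (Z.card : ℝ) + t * L ≤ B) (φ : ℝ → ℝ≥0∞) :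
    expect (edgeProb P.p P.q C)
        (fun H => (if IsTreelike L Z H t {i} (Finset.univ \ insert i Z) then 1 else 0)
        * φ (belief H P.K P.p P.q t i))
      ≤ ENNReal.ofReal (Real.exp (P.p * (B + L) * L * t)) * avg (P.law t (decide (i ∈ C))) φ := by
  have h1 := P.expect_treeValue_le (L := L) (B := B) (Z := Z) (C := C) hp (by linarith) hB t
    (S := {i}) (U := Finset.univ \ insert i Z) (by simp) (by simpa using hi) hU (by
      rw [Finset.card_sdiff_of_subset (Finset.subset_univ _), Finset.card_univ, Fintype.card_fin,
        Finset.card_insert_of_notMem hi, Nat.cast_sub (by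
          rw [← Finset.card_insert_of_notMem hi]
          simpa using Finset.card_le_univ (insert i Z))]
      push_cast
      linarith) (by simpa using hL) (fun x => φ (x i)) (fun x y hxy => by rw [hxy i (by simp)])
  rw [productAvg_coordinate (P.tsum_vertexLaw t)] at h1
  refine le_trans (expect_mono fun H => ?_) h1
  split_ifs with h
  · have h2 := message_eq_treeValue (H := H) P.K P.p P.q (Z := Z) t (S := {i})
      (U := Finset.univ \ insert i Z) (fun i => i) (by
        intro l _ v _
        by_cases hv : v ∈ insert i Z
        · right; left
          simpa using hv
        · right; right
          simpa using hv) (by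
        intro l _ v _
        simp only [Finset.mem_singleton, Finset.mem_sdiff, Finset.mem_univ, Finset.mem_insert,
          true_and]
        tauto) (by simp) (by simp) h (Finset.mem_singleton_self i)
    -- The root acts as its own parent: a message from `i` to itself excludes no neighbor.
    have h3 : belief H P.K P.p P.q t i = message H P.K P.p P.q t i i := by
      obtain ⟨t, rfl⟩ := Nat.exists_eq_succ_of_ne_zero ht
      rw [belief, message]
      refine congrArg _ (Finset.sum_congr ?_ fun _ _ => rfl)
      ext v
      simp only [Finset.mem_filter, Finset.mem_univ, true_and]
      exact ⟨fun h => ⟨h, h.ne'⟩, fun h => h.1⟩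
    rw [h3, h2]
    rfl
  · simp

end Params

end Comparison

/-! ### The expected number of misclassified vertices -/

section Misclassification

/-- The vertices whose values exceed `θ`. -/
def thresholdSet {n : ℕ} (R : Fin n → ℝ) (θ : ℝ) : Finset (Fin n) :=
  Finset.univ.filter fun i => θ < R i

theorem mem_thresholdSet {n : ℕ} {R : Fin n → ℝ} {θ : ℝ} {i : Fin n} :
    i ∈ thresholdSet R θ ↔ θ < R i := by
  simp [thresholdSet]

/-- A top set is not much worse than a threshold set. -/
theorem IsTopSet.card_symmDiff_le {n K : ℕ} {R : Fin n → ℝ} {S : Finset (Fin n)}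
    (h : IsTopSet R K S) (C : Finset (Fin n)) (θ : ℝ) :
    ((symmDiff C S).card : ℝ) ≤ |(C.card : ℝ) - K| + 2 * (symmDiff C (thresholdSet R θ)).card := by
  set T := thresholdSet R θ
  -- Both sets collect the largest values, so they are nested, and their symmetric difference is
  -- determined by their sizes.
  have hcomp : S ⊆ T ∨ T ⊆ S := by
    by_contra! hcon
    obtain ⟨⟨i, hi, hi'⟩, ⟨j, hj, hj'⟩⟩ := And.imp Finset.not_subset.1 Finset.not_subset.1 hcon
    have h1 := h.2 i hi j hj'
    rw [mem_thresholdSet] at hi' hj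
    linarith
  have hcard : ∀ A B : Finset (Fin n), A ⊆ B → ((symmDiff A B).card : ℝ) = |(A.card : ℝ) - B.card| := by
    intro A B hAB
    rw [symmDiff_of_le hAB, Finset.card_sdiff_of_subset hAB, Nat.cast_sub (Finset.card_le_card hAB),
      abs_sub_comm, abs_of_nonneg]
    rw [sub_nonneg]
    exact_mod_cast Finset.card_le_card hAB
  have h1 : ((symmDiff T S).card : ℝ) = |(T.card : ℝ) - S.card| := by
    rcases hcomp with h' | h'
    · rw [symmDiff_comm, hcard _ _ h', abs_sub_comm]
    · exact hcard _ _ h'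
  have h2 : |(T.card : ℝ) - C.card| ≤ (symmDiff C T).card := by
    have e1 : (C \ T).card + (C ∩ T).card = C.card := Finset.card_sdiff_add_card_inter C T
    have e2 : (T \ C).card + (T ∩ C).card = T.card := Finset.card_sdiff_add_card_inter T C
    have e3 : (symmDiff C T).card = (C \ T).card + (T \ C).card :=
      Finset.card_union_of_disjoint disjoint_sdiff_sdiff
    rw [Finset.inter_comm] at e2
    rw [e3, ← e1, ← e2, abs_le]
    push_cast
    constructor <;> linarith [Nat.cast_nonneg (α := ℝ) (C \ T).card,
      Nat.cast_nonneg (α := ℝ) (T \ C).card]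
  have h3 : ((symmDiff C S).card : ℝ) ≤ (symmDiff C T).card + (symmDiff T S).card := by
    have : symmDiff C S ⊆ symmDiff C T ∪ symmDiff T S := symmDiff_triangle C T S
    exact_mod_cast (Finset.card_le_card this).trans (Finset.card_union_le _ _)
  have h4 := abs_sub_le (T.card : ℝ) C.card K
  rw [h1, h.1] at h3
  linarith

namespace Params

variable (P : Params) {C : Finset (Fin P.n)} {D L : ℝ}

/-- If the community has not exactly the size `K`, exclude some vertices. -/
theorem exists_excluded (hC : |(C.card : ℝ) - P.K| ≤ D) (i : Fin P.n) :
    ∃ Z : Finset (Fin P.n), i ∉ Z ∧ (Z.card : ℝ) ≤ D ∧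
      P.Unexplored C Z (Finset.univ \ insert i Z) := by
  have hn := P.K_lt
  have hK := P.K_pos
  have hcn : C.card ≤ P.n := by simpa using Finset.card_le_univ C
  have hcompl : Cᶜ.card = P.n - C.card := by rw [Finset.card_compl, Fintype.card_fin]
  have hd : ∀ Z : Finset (Fin P.n), Disjoint (Finset.univ \ insert i Z) Z := fun Z =>
    Finset.disjoint_of_subset_right (Finset.subset_insert i Z) Finset.sdiff_disjoint
  rcases le_total P.K C.card with h | h
  -- The surplus of |C| - K vertices is removed from `C`; K ≥ 1 leaves room to avoid `i`. In the
  -- other case K < n does the same for the complement.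
  · obtain ⟨Z, hZ, hZc⟩ := Finset.exists_subset_card_eq (s := C.erase i) (n := C.card - P.K) (by
      have := Finset.pred_card_le_card_erase (s := C) (a := i)
      omega)
    have hZC : Z ⊆ C := hZ.trans (Finset.erase_subset _ _)
    refine ⟨Z, fun h' => Finset.notMem_erase i C (hZ h'), ?_, hd Z, ?_, ?_⟩
    · rw [hZc, Nat.cast_sub h]
      exact (le_abs_self _).trans hC
    · have h1 : (Finset.univ \ insert i Z) ∩ C ⊆ C \ Z := fun v hv => by
        simp only [Finset.mem_inter, Finset.mem_sdiff, Finset.mem_insert, not_or] at hv ⊢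
        exact ⟨hv.2, hv.1.2.2⟩
      have h2 := Finset.card_le_card h1
      rw [Finset.card_sdiff_of_subset hZC, hZc] at h2
      exact_mod_cast h2.trans (by omega)
    · have h1 : (Finset.univ \ insert i Z) \ C ⊆ Cᶜ := fun v hv => by
        simpa using (Finset.mem_sdiff.1 hv).2
      have h2 := Finset.card_le_card h1
      rw [hcompl] at h2
      rw [← Nat.cast_sub hn.le]
      exact_mod_cast h2.trans (by omega)
  · obtain ⟨Z, hZ, hZc⟩ := Finset.exists_subset_card_eq (s := Cᶜ.erase i) (n := P.K - C.card) (by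
      have := Finset.pred_card_le_card_erase (s := Cᶜ) (a := i)
      omega)
    have hZC : Z ⊆ Cᶜ := hZ.trans (Finset.erase_subset _ _)
    refine ⟨Z, fun h' => Finset.notMem_erase i _ (hZ h'), ?_, hd Z, ?_, ?_⟩
    · rw [hZc, Nat.cast_sub h]
      exact (le_abs_self _).trans (by rwa [abs_sub_comm])
    · exact_mod_cast (Finset.card_le_card Finset.inter_subset_right).trans h
    · have h1 : (Finset.univ \ insert i Z) \ C ⊆ Cᶜ \ Z := fun v hv => by
        simp only [Finset.mem_sdiff, Finset.mem_insert, not_or, Finset.mem_compl] at hv ⊢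
        exact ⟨hv.2, hv.1.2.2⟩
      have h2 := Finset.card_le_card h1
      rw [Finset.card_sdiff_of_subset hZC, hZc, hcompl] at h2
      rw [← Nat.cast_sub hn.le]
      exact_mod_cast h2.trans (by omega)

/-- A bound for the probability that a neighborhood is not treelike. -/
def exceptional (D L : ℝ) (t : ℕ) : ℝ :=
  t * (P.n * P.p ^ 2 + (1 + D) * P.p + ((P.n * P.p) ^ 2 + P.n * P.p) / L ^ 2)
    * (1 + P.n * P.p) ^ (2 * t)

theorem prob_not_isTreelike_le (hp : P.p ≤ 1) (hL : 1 ≤ L) (t : ℕ) {i : Fin P.n}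
    {Z : Finset (Fin P.n)} (hi : i ∉ Z) (hZ : (Z.card : ℝ) ≤ D) :
    prob (edgeProb P.p P.q C)
        (fun H => ¬ IsTreelike L Z H t {i} (Finset.univ \ insert i Z))
      ≤ ENNReal.ofReal (P.exceptional D L t) := by
  have hp0 := P.p_pos.le
  have hD : 0 ≤ D := (Nat.cast_nonneg _).trans hZ
  have hnp : (0 : ℝ) ≤ P.n * P.p := by positivity
  have e1 : (Fintype.card (Fin P.n) : ℝ≥0∞) = ENNReal.ofReal P.n := by simp
  have e2 : (Z.card : ℝ≥0∞) ≤ ENNReal.ofReal D := by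
    rw [← ENNReal.ofReal_natCast]
    exact ENNReal.ofReal_le_ofReal hZ
  have e3 : (Fintype.card (Fin P.n) * ENNReal.ofReal P.p) ^ 2
      + Fintype.card (Fin P.n) * ENNReal.ofReal P.p
      = ENNReal.ofReal ((P.n * P.p) ^ 2 + P.n * P.p) := by
    rw [e1, ← ENNReal.ofReal_mul (by positivity), ← ENNReal.ofReal_pow hnp,
      ← ENNReal.ofReal_add (by positivity) hnp]
  have e4 : (ENNReal.ofReal L ^ 2)⁻¹ = ENNReal.ofReal (L ^ 2)⁻¹ := by
    rw [ENNReal.ofReal_inv_of_pos (by positivity), ENNReal.ofReal_pow (by linarith)]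
  have h := HiddenCommunity.prob_not_isTreelike_le (w := edgeProb P.p P.q C) (p := P.p) (L := L)
    (Z := Z) (P.edgeProb_mem C hp) (P.edgeProb_le C) (by linarith)
    (β := ENNReal.ofReal (P.n * P.p ^ 2 + (1 + D) * P.p
      + ((P.n * P.p) ^ 2 + P.n * P.p) / L ^ 2))
    (A := ENNReal.ofReal ((1 + P.n * P.p) ^ 2)) (by
      rw [e3]
      exact ENNReal.ofReal_le_ofReal (by nlinarith)) (by
      rw [← ENNReal.ofReal_one]
      exact ENNReal.ofReal_le_ofReal (by nlinarith)) (by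
      rw [e3, e4, e1, div_eq_mul_inv, ENNReal.ofReal_add (p := P.n * P.p ^ 2 + (1 + D) * P.p)
          (by positivity) (by positivity),
        ENNReal.ofReal_add (p := P.n * P.p ^ 2) (by positivity) (by positivity),
        ENNReal.ofReal_mul (p := (P.n * P.p) ^ 2 + P.n * P.p) (by positivity),
        ENNReal.ofReal_mul (p := (P.n : ℝ)) (q := P.p ^ 2) (by positivity),
        ENNReal.ofReal_mul (p := 1 + D) (by positivity), ENNReal.ofReal_pow hp0,
        ENNReal.ofReal_add zero_le_one hD, ENNReal.ofReal_one]
      gcongr) t (S := {i}) (U := Finset.univ \ insert i Z) (by simp) (by simpa using hi)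
    (Finset.disjoint_of_subset_right (Finset.subset_insert i Z) Finset.sdiff_disjoint)
  refine h.trans (le_of_eq ?_)
  rw [Finset.card_singleton, Nat.cast_one, one_pow, one_mul, ← ENNReal.ofReal_natCast,
    ← ENNReal.ofReal_mul (by positivity), ← ENNReal.ofReal_pow (by positivity),
    ← ENNReal.ofReal_mul (by positivity), exceptional, pow_mul]

open Classical in
/-- The probability that a vertex is misclassified by the threshold `ν`. -/
theorem prob_misclassified_le (hp : P.p ≤ 1) (hL : 1 ≤ L) {t : ℕ} (ht : t ≠ 0)
    (hC : |(C.card : ℝ) - P.K| ≤ D) (hF : P.p * (1 + D + t * L + L) * L * t ≤ 1) (i : Fin P.n) :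
    prob (edgeProb P.p P.q C)
        (fun H => i ∈ symmDiff C (thresholdSet (belief H P.K P.p P.q t) P.ν))
      ≤ ENNReal.ofReal (P.exceptional D L t) + ENNReal.ofReal (Real.exp 1) *
        (ENNReal.ofReal (Real.exp (if i ∈ C then P.ν / 2 else -(P.ν / 2))) *
          avg (P.law t false) fun x => ENNReal.ofReal (Real.exp (1 / 2 * x))) := by
  obtain ⟨Z, hiZ, hZ, hU⟩ := P.exists_excluded hC i
  have hD : 0 ≤ D := (Nat.cast_nonneg _).trans hZ
  -- This dominates the indicator of an error: e^{(ν-x)/2} ≥ 1 if x ≤ ν inside the community, and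
  -- e^{(x-ν)/2} ≥ 1 if x > ν outside. The bound `hF` makes the domination factor at most e.
  set φ : ℝ → ℝ≥0∞ := fun x => ENNReal.ofReal (Real.exp (if i ∈ C then P.ν / 2 else -(P.ν / 2))) *
    ENNReal.ofReal (Real.exp (if i ∈ C then -(1 / 2) * x else 1 / 2 * x))
  have h1 : avg (P.law t (decide (i ∈ C))) φ
      = ENNReal.ofReal (Real.exp (if i ∈ C then P.ν / 2 else -(P.ν / 2))) *
          avg (P.law t false) fun x => ENNReal.ofReal (Real.exp (1 / 2 * x)) := by
    rw [avg_const_mul]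
    by_cases hi : i ∈ C
    · simp only [hi, if_true, decide_true]
      rw [← P.avg_law_true_neg_half]
    · simp only [hi, if_false, decide_false]
  have h2 := P.expect_belief_le (C := C) hp hL (B := 1 + D + t * L) (by positivity) ht hiZ hU
    (by linarith) φ
  rw [h1] at h2
  have h3 := P.prob_not_isTreelike_le (C := C) hp hL t hiZ hZ
  refine le_trans ?_ (add_le_add h3 (h2.trans ?_))
  · unfold prob
    rw [← expect_add]
    refine expect_mono fun H => ?_
    by_cases hT : IsTreelike L Z H t {i} (Finset.univ \ insert i Z)
    · simp only [hT, not_true, if_false, if_true, one_mul, zero_add]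
      split_ifs with hmis
      · simp only [φ]
        rw [← ENNReal.ofReal_mul (Real.exp_nonneg _), ← Real.exp_add, ENNReal.one_le_ofReal,
          Real.one_le_exp_iff]
        rw [Finset.mem_symmDiff, mem_thresholdSet] at hmis
        by_cases hi : i ∈ C
        · simp only [hi, if_true]
          simp only [hi, not_true, and_false, or_false, true_and] at hmis
          linarith
        · simp only [hi, if_false]
          simp only [hi, not_false_eq_true, and_true, false_and, false_or] at hmis
          linarith
      · exact zero_le
    · simp only [hT, not_false_eq_true, if_true, if_false, zero_mul, add_zero]
      split_ifs <;> simp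
  · gcongr

/-- The expected number of vertices that are misclassified by the threshold `ν`. -/
theorem expect_misclassified_le (hp : P.p ≤ 1) (hL : 1 ≤ L) {t : ℕ} (ht : t ≠ 0)
    (hC : |(C.card : ℝ) - P.K| ≤ D) (hF : P.p * (1 + D + t * L + L) * L * t ≤ 1) (hDK : D ≤ P.K)
    {r : ℝ} (hν : 5 ≤ P.ν)
    (hr : avg (P.law t false) (fun x => ENNReal.ofReal (Real.exp (1 / 2 * x)))
      ≤ ENNReal.ofReal (Real.exp (-((r + 1) * P.ν)))) :
    expect (edgeProb P.p P.q C)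
        (fun H => ((symmDiff C (thresholdSet (belief H P.K P.p P.q t) P.ν)).card : ℝ≥0∞))
      ≤ ENNReal.ofReal (P.n * P.exceptional D L t + P.K * Real.exp (-(P.ν * r))) := by
  classical
  have hD : 0 ≤ D := (abs_nonneg _).trans hC
  have hp0 := P.p_pos.le
  have hexc : 0 ≤ P.exceptional D L t := by unfold exceptional; positivity
  have h1 : ∀ S : Finset (Fin P.n), (S.card : ℝ≥0∞) = ∑ i, if i ∈ S then 1 else 0 := by
    intro S
    simp
  simp only [h1]
  rw [expect_sum]
  set x := Real.exp (-((r + 1) * P.ν))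
  have h2 : ∀ i ∈ Finset.univ, expect (edgeProb P.p P.q C) (fun H =>
      if i ∈ symmDiff C (thresholdSet (belief H P.K P.p P.q t) P.ν) then 1 else 0)
      ≤ ENNReal.ofReal (P.exceptional D L t + Real.exp 1 *
        (Real.exp (if i ∈ C then P.ν / 2 else -(P.ν / 2)) * x)) := by
    intro i _
    rw [ENNReal.ofReal_add hexc (by positivity), ENNReal.ofReal_mul (by positivity),
      ENNReal.ofReal_mul (by positivity)]
    refine le_trans (le_of_eq ?_) ((P.prob_misclassified_le hp hL ht hC hF i).trans ?_)
    · unfold prob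
      congr!
    · gcongr
  refine (Finset.sum_le_sum h2).trans ?_
  rw [← ENNReal.ofReal_sum_of_nonneg fun i _ => by positivity]
  refine ENNReal.ofReal_le_ofReal ?_
  rw [Finset.sum_add_distrib, Finset.sum_const, Finset.card_univ, Fintype.card_fin, nsmul_eq_mul]
  gcongr
  rw [← Finset.mul_sum, ← Finset.sum_mul]
  have h3 : ∑ i : Fin P.n, Real.exp (if i ∈ C then P.ν / 2 else -(P.ν / 2))
      = C.card * Real.exp (P.ν / 2) + (P.n - C.card) * Real.exp (-(P.ν / 2)) := by
    simp only [apply_ite Real.exp]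
    rw [Finset.sum_ite, Finset.sum_const, Finset.sum_const, nsmul_eq_mul, nsmul_eq_mul,
      Finset.filter_not, Finset.filter_mem_eq_inter, Finset.univ_inter,
      Finset.card_sdiff_of_subset (Finset.subset_univ _), Finset.card_univ, Fintype.card_fin,
      Nat.cast_sub (by simpa using Finset.card_le_univ C)]
  -- The threshold ν balances the two kinds of error: (n - K) e^{-ν/2} = K e^{ν/2}.
  have hKn : (P.n - P.K : ℝ) = P.K * Real.exp P.ν := by
    have h4 := P.exp_neg_ν
    have h5 := P.n_sub_K_pos
    have h6 := P.K_cast_pos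
    rw [Real.exp_neg] at h4
    rw [← inv_inj, inv_inv] at h4
    rw [h4]
    field_simp
  have h4 : ∑ i : Fin P.n, Real.exp (if i ∈ C then P.ν / 2 else -(P.ν / 2))
      ≤ 4 * P.K * Real.exp (P.ν / 2) := by
    have e1 := abs_le.1 hC
    have e2 : (1 : ℝ) ≤ Real.exp P.ν := Real.one_le_exp (by linarith)
    have e3 : Real.exp P.ν * Real.exp (-(P.ν / 2)) = Real.exp (P.ν / 2) := by
      rw [← Real.exp_add]; congr 1; ring
    have e4 := P.K_cast_pos
    have e5 : (C.card : ℝ) ≤ 2 * P.K := by linarith [e1.2]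
    have e6 : (P.n - C.card : ℝ) ≤ 2 * (P.K * Real.exp P.ν) := by nlinarith [e1.1]
    rw [h3]
    calc _ ≤ 2 * P.K * Real.exp (P.ν / 2)
          + 2 * (P.K * Real.exp P.ν) * Real.exp (-(P.ν / 2)) := by gcongr
      _ = 2 * P.K * Real.exp (P.ν / 2)
          + 2 * P.K * (Real.exp P.ν * Real.exp (-(P.ν / 2))) := by ring
      _ = _ := by rw [e3]; ring
  have h5 : Real.exp (P.ν / 2) * x = Real.exp (-(P.ν * r)) * Real.exp (-(P.ν / 2)) := by
    rw [← Real.exp_add, ← Real.exp_add]; congr 1; ring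
  -- The extra power e^{-ν}, from r + 1 instead of r, pays for e^{ν/2} and, once ν ≥ 5, for all
  -- constants.
  have h6 : 4 * Real.exp 1 * Real.exp (-(P.ν / 2)) ≤ 1 := by
    have e1 : 4 * Real.exp 1 ≤ Real.exp (5 / 2) := by
      have e2 : Real.exp (5 / 2) = Real.exp 1 * Real.exp (3 / 2) := by
        rw [← Real.exp_add]; norm_num
      have e3 : (4 : ℝ) ≤ Real.exp (3 / 2) := by
        have e4 : Real.exp (3 / 2) = Real.exp (1 / 2) * Real.exp 1 := by
          rw [← Real.exp_add]; norm_num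
        have e5 : (3 / 2 : ℝ) ≤ Real.exp (1 / 2) := by
          have := Real.add_one_le_exp (1 / 2 : ℝ); linarith
        have e6 := Real.exp_one_gt_d9
        rw [e4]
        nlinarith
      rw [e2]
      nlinarith [Real.exp_pos 1]
    calc _ ≤ Real.exp (5 / 2) * Real.exp (-(5 / 2)) := by gcongr
      _ = 1 := by rw [← Real.exp_add]; simp
  calc _ ≤ Real.exp 1 * (4 * P.K * Real.exp (P.ν / 2) * x) := by gcongr
    _ = P.K * Real.exp (-(P.ν * r)) * (4 * Real.exp 1 * Real.exp (-(P.ν / 2))) := by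
      rw [mul_assoc _ (Real.exp (P.ν / 2)), h5]; ring
    _ ≤ P.K * Real.exp (-(P.ν * r)) * 1 := by gcongr
    _ = _ := mul_one _

end Params

end Misclassification

/-! ### The planted dense subgraph model -/

section Model

variable {n : ℕ} {Ω : Type*} [MeasurableSpace Ω] {μ : Measure Ω} {p q : ℝ}
  {Cs Chat : Ω → Finset (Fin n)} {G : Ω → SimpleGraph (Fin n)}

theorem edgeProb_mem_unit (hq : 0 ≤ q) (hqp : q ≤ p) (hp : p ≤ 1) (C : Finset (Fin n))
    (e : Sym2 (Fin n)) : 0 ≤ edgeProb p q C e ∧ edgeProb p q C e ≤ 1 := by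
  unfold edgeProb
  split_ifs
  · exact ⟨hq.trans hqp, hp⟩
  · exact ⟨hq, hqp.trans hp⟩

theorem le_edgeProb (hqp : q ≤ p) (C : Finset (Fin n)) (e : Sym2 (Fin n)) :
    q ≤ edgeProb p q C e := by
  unfold edgeProb
  split_ifs
  · exact hqp
  · exact le_rfl

open Classical in
theorem IsPlantedDenseSubgraph.measure_eq [IsProbabilityMeasure μ]
    (h : IsPlantedDenseSubgraph μ p q Cs G) (hq : 0 ≤ q) (hqp : q ≤ p) (hp : p ≤ 1)
    (C : Finset (Fin n)) (H : SimpleGraph (Fin n)) :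
    μ {ω | Cs ω = C ∧ G ω = H} = μ {ω | Cs ω = C} * graphWeight (edgeProb p q C) H := by
  have hw := edgeProb_mem_unit hq hqp hp C
  have h1 : graphWeight (edgeProb p q C) H
      = ENNReal.ofReal (∏ e ∈ pairs (Fin n), if e ∈ H.edgeSet then edgeProb p q C e
          else 1 - edgeProb p q C e) := by
    rw [ENNReal.ofReal_prod_of_nonneg]
    · refine Finset.prod_congr rfl fun e _ => ?_
      split_ifs <;> rfl
    · intro e _
      split_ifs
      · exact (hw e).1
      · linarith [(hw e).2]
  have h2 := congrArg ENNReal.ofReal (h.law C H)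
  rw [ENNReal.ofReal_mul measureReal_nonneg, ofReal_measureReal, ofReal_measureReal] at h2
  rw [h1, h2]
  congr 2
  unfold pairs
  congr!

/-- Conditioning on the community: only the finitely many values of `(Cs, G)` matter, so the
abstract probability space reduces to `expect`. -/
theorem IsPlantedDenseSubgraph.lintegral_eq [IsProbabilityMeasure μ]
    (h : IsPlantedDenseSubgraph μ p q Cs G) (hq : 0 ≤ q) (hqp : q ≤ p) (hp : p ≤ 1)
    (F : Finset (Fin n) → SimpleGraph (Fin n) → ℝ≥0∞) :
    ∫⁻ ω, F (Cs ω) (G ω) ∂μ = ∑ C, μ {ω | Cs ω = C} * expect (edgeProb p q C) (F C) := by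
  classical
  have hm : ∀ C H, MeasurableSet {ω | Cs ω = C ∧ G ω = H} := fun C H =>
    (h.measurable_community C).inter (h.measurable_graph H)
  have h1 : ∀ ω, F (Cs ω) (G ω) = ∑ C, ∑ H, {ω | Cs ω = C ∧ G ω = H}.indicator
      (fun _ => F C H) ω := by
    intro ω
    rw [Finset.sum_eq_single_of_mem (Cs ω) (Finset.mem_univ _),
      Finset.sum_eq_single_of_mem (G ω) (Finset.mem_univ _)]
    · rw [Set.indicator_of_mem (by simp)]
    · intro H _ hH
      rw [Set.indicator_of_notMem]
      exact fun h' => hH h'.2.symm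
    · intro C _ hC
      refine Finset.sum_eq_zero fun H _ => ?_
      rw [Set.indicator_of_notMem]
      exact fun h' => hC h'.1.symm
  have h2 : ∀ C H, ∫⁻ ω, {ω | Cs ω = C ∧ G ω = H}.indicator (fun _ => F C H) ω ∂μ
      = μ {ω | Cs ω = C} * (graphWeight (edgeProb p q C) H * F C H) := by
    intro C H
    rw [lintegral_indicator_const (hm C H) (F C H), h.measure_eq hq hqp hp, mul_comm, mul_assoc]
  have h3 : ∀ C H, Measurable fun ω => {ω | Cs ω = C ∧ G ω = H}.indicator (fun _ => F C H) ω :=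
    fun C H => measurable_const.indicator (hm C H)
  rw [lintegral_congr h1, lintegral_finsetSum _ fun C _ => Finset.measurable_fun_sum _
    fun H _ => h3 C H]
  refine Finset.sum_congr rfl fun C _ => ?_
  rw [lintegral_finsetSum _ fun H _ => h3 C H, Finset.sum_congr rfl fun H _ => h2 C H,
    ← Finset.mul_sum, expect]
  congr!

/-- If `f` is not integrable, its Bochner integral is 0 by convention and the bound is trivial. -/
theorem ofReal_integral_le_lintegral {f : Ω → ℝ} (hf : ∀ ω, 0 ≤ f ω) :
    ENNReal.ofReal (∫ ω, f ω ∂μ) ≤ ∫⁻ ω, ENNReal.ofReal (f ω) ∂μ := by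
  by_cases h : Integrable f μ
  · rw [ofReal_integral_eq_lintegral_ofReal h (Eventually.of_forall hf)]
  · rw [integral_undef h]
    simp

theorem expectedError_le_card [IsProbabilityMeasure μ] : expectedError μ Cs Chat ≤ n := by
  have h : ENNReal.ofReal (expectedError μ Cs Chat) ≤ ENNReal.ofReal n := by
    refine (ofReal_integral_le_lintegral fun ω => Nat.cast_nonneg _).trans ?_
    refine (lintegral_mono (g := fun _ => ENNReal.ofReal n) fun ω => ?_).trans ?_
    · refine ENNReal.ofReal_le_ofReal ?_
      exact_mod_cast (Finset.card_le_univ _).trans_eq (Fintype.card_fin n)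
    · simp
  exact (ENNReal.ofReal_le_ofReal_iff (Nat.cast_nonneg n)).1 h

theorem expectedError_nonneg : 0 ≤ expectedError μ Cs Chat :=
  integral_nonneg fun _ => Nat.cast_nonneg _

/-- If |C*| deviates from K by more than D, the error is bounded by n. Otherwise it is at most D
plus twice the threshold error, which is bounded for each fixed community. -/
theorem Params.expectedError_le [IsProbabilityMeasure μ] (P : Params)
    {Cs Chat : Ω → Finset (Fin P.n)} {G : Ω → SimpleGraph (Fin P.n)} {D L r : ℝ} {t : ℕ}
    (h : IsPlantedDenseSubgraph μ P.p P.q Cs G)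
    (hChat : ∀ᵐ ω ∂μ, IsTopSet (belief (G ω) P.K P.p P.q t) P.K (Chat ω))
    (hp : P.p ≤ 1) (hL : 1 ≤ L) (ht : t ≠ 0)
    (hF : P.p * (1 + D + t * L + L) * L * t ≤ 1) (hD : 0 ≤ D) (hDK : D ≤ P.K)
    (hν : 5 ≤ P.ν) (hr : avg (P.law t false) (fun x => ENNReal.ofReal (Real.exp (1 / 2 * x)))
      ≤ ENNReal.ofReal (Real.exp (-((r + 1) * P.ν)))) :
    expectedError μ Cs Chat ≤ P.n * μ.real {ω | D < |((Cs ω).card : ℝ) - P.K|}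
      + (D + 2 * (P.n * P.exceptional D L t + P.K * Real.exp (-(P.ν * r)))) := by
  classical
  have hp0 := P.p_pos.le
  have hexc : 0 ≤ P.exceptional D L t := by unfold Params.exceptional; positivity
  have hX : 0 ≤ P.n * P.exceptional D L t + P.K * Real.exp (-(P.ν * r)) := by positivity
  set X := P.n * P.exceptional D L t + P.K * Real.exp (-(P.ν * r))
  set F : Finset (Fin P.n) → SimpleGraph (Fin P.n) → ℝ≥0∞ := fun C H =>
    if D < |(C.card : ℝ) - P.K| then ENNReal.ofReal P.n else ENNReal.ofReal D +
      2 * (symmDiff C (thresholdSet (belief H P.K P.p P.q t) P.ν)).card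
  set F' : Finset (Fin P.n) → SimpleGraph (Fin P.n) → ℝ≥0∞ := fun C _ =>
    (if D < |(C.card : ℝ) - P.K| then ENNReal.ofReal P.n else 0) + ENNReal.ofReal (D + 2 * X)
  have hle : ∀ C, expect (edgeProb P.p P.q C) (F C) ≤ expect (edgeProb P.p P.q C) (F' C) := by
    intro C
    by_cases hC : D < |(C.card : ℝ) - P.K|
    · refine expect_mono fun H => ?_
      simp only [F, F', if_pos hC]
      exact le_self_add
    · have e1 : F' C = fun _ => ENNReal.ofReal (D + 2 * X) * 1 := by
        funext H
        simp only [F', if_neg hC, zero_add, mul_one]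
      have e2 : F C = fun H => ENNReal.ofReal D * 1 +
          2 * ((symmDiff C (thresholdSet (belief H P.K P.p P.q t) P.ν)).card : ℝ≥0∞) := by
        funext H
        simp only [F, if_neg hC, mul_one]
      rw [e1, e2, expect_add, expect_const_mul, expect_const_mul, expect_const_mul,
        expect_one (P.edgeProb_mem C hp), mul_one, mul_one, ENNReal.ofReal_add hD (by positivity),
        ENNReal.ofReal_mul zero_le_two, ENNReal.ofReal_ofNat]
      gcongr
      exact P.expect_misclassified_le hp hL ht (not_lt.1 hC) hF hDK hν hr
  have hbad : MeasurableSet {ω | D < |((Cs ω).card : ℝ) - P.K|} := by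
    have : {ω | D < |((Cs ω).card : ℝ) - P.K|}
        = ⋃ C ∈ {C : Finset (Fin P.n) | D < |(C.card : ℝ) - P.K|}, {ω | Cs ω = C} := by
      ext ω
      simp
    rw [this]
    exact MeasurableSet.biUnion (Set.to_countable _) fun C _ => h.measurable_community C
  have key : ENNReal.ofReal (expectedError μ Cs Chat)
      ≤ ENNReal.ofReal (P.n * μ.real {ω | D < |((Cs ω).card : ℝ) - P.K|} + (D + 2 * X)) := by
    calc _ ≤ ∫⁻ ω, ENNReal.ofReal ((symmDiff (Cs ω) (Chat ω)).card : ℝ) ∂μ :=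
          ofReal_integral_le_lintegral fun ω => Nat.cast_nonneg _
      _ ≤ ∫⁻ ω, F (Cs ω) (G ω) ∂μ := by
          refine lintegral_mono_ae (hChat.mono fun ω hω => ?_)
          simp only [F]
          split_ifs with hC
          · refine ENNReal.ofReal_le_ofReal ?_
            exact_mod_cast (Finset.card_le_univ _).trans_eq (Fintype.card_fin _)
          · have h1 := hω.card_symmDiff_le (Cs ω) P.ν
            have h2 : ((symmDiff (Cs ω) (Chat ω)).card : ℝ) ≤ D + 2 *
                (symmDiff (Cs ω) (thresholdSet (belief (G ω) P.K P.p P.q t) P.ν)).card := by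
              linarith [not_lt.1 hC]
            refine (ENNReal.ofReal_le_ofReal h2).trans (le_of_eq ?_)
            rw [ENNReal.ofReal_add hD (by positivity), ENNReal.ofReal_mul zero_le_two,
              ENNReal.ofReal_ofNat, ENNReal.ofReal_natCast]
      _ ≤ ∫⁻ ω, F' (Cs ω) (G ω) ∂μ := by
          rw [h.lintegral_eq P.q_pos.le P.q_le hp, h.lintegral_eq P.q_pos.le P.q_le hp]
          exact Finset.sum_le_sum fun C _ => mul_le_mul' le_rfl (hle C)
      _ = ENNReal.ofReal P.n * μ {ω | D < |((Cs ω).card : ℝ) - P.K|}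
          + ENNReal.ofReal (D + 2 * X) := by
          have e1 : ∀ ω, F' (Cs ω) (G ω) = {ω | D < |((Cs ω).card : ℝ) - P.K|}.indicator
              (fun _ => ENNReal.ofReal P.n) ω + ENNReal.ofReal (D + 2 * X) := by
            intro ω
            simp only [F', Set.indicator_apply, Set.mem_ofPred_eq]
          rw [lintegral_congr e1, lintegral_add_left (measurable_const.indicator hbad),
            lintegral_indicator_const hbad, lintegral_const, measure_univ, mul_one]
      _ = _ := by
          rw [ENNReal.ofReal_add (q := D + 2 * X) (by positivity) (by positivity),
            ENNReal.ofReal_mul (Nat.cast_nonneg _), ofReal_measureReal]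
  exact (ENNReal.ofReal_le_ofReal_iff (by positivity)).1 key

/-! ### The number of edges -/

theorem coe_edgesOf {V : Type*} [Fintype V] (H : SimpleGraph V) :
    (edgesOf H : Set (Sym2 V)) = H.edgeSet := by
  ext e
  rw [Finset.mem_coe, mem_edgesOf, mem_pairs]
  exact ⟨fun h => h.2, fun h => ⟨H.not_isDiag_of_mem_edgeSet h, h⟩⟩

/-- Exponential Markov inequality: the indicator is at most 2^n 2^{-|E|}, and each pair contributes
at most 1 - q/2 ≤ e^{-q/2}. With at least n²/4 pairs and nq ≥ 16 this is at most e^n e^{-2n}. -/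
theorem prob_ncard_edgeSet_lt_le {w : Sym2 (Fin n) → ℝ} (hw : ∀ e, 0 ≤ w e ∧ w e ≤ 1)
    (hqw : ∀ e, q ≤ w e) (hn : 2 ≤ n) (hnq : 16 ≤ n * q) :
    prob w (fun H => H.edgeSet.ncard < n) ≤ ENNReal.ofReal (Real.exp (-n)) := by
  classical
  have h1 : prob w (fun H => H.edgeSet.ncard < n)
      ≤ expect w fun H => ENNReal.ofReal (2 ^ n) * ∏ e ∈ pairs (Fin n),
        if e ∈ H.edgeSet then ENNReal.ofReal (1 / 2) else ENNReal.ofReal 1 := by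
    refine expect_mono fun H => ?_
    split_ifs with h
    · have e1 : ∏ e ∈ pairs (Fin n), (if e ∈ H.edgeSet then ENNReal.ofReal (1 / 2)
          else ENNReal.ofReal 1) = ENNReal.ofReal (1 / 2) ^ H.edgeSet.ncard := by
        rw [Finset.prod_ite, ENNReal.ofReal_one, Finset.prod_const_one, mul_one,
          Finset.prod_const]
        congr 1
        have e2 := Set.ncard_coe_finset (edgesOf H)
        rw [coe_edgesOf] at e2
        rw [e2, edgesOf]
      rw [e1, ← ENNReal.ofReal_pow (by norm_num), ← ENNReal.ofReal_mul (by positivity),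
        ENNReal.one_le_ofReal]
      calc (1 : ℝ) = 2 ^ n * (1 / 2) ^ n := by rw [← mul_pow]; norm_num
        _ ≤ _ := by
          gcongr 2 ^ n * ?_
          exact pow_le_pow_of_le_one (by norm_num) (by norm_num) h.le
    · exact zero_le
  refine h1.trans ?_
  rw [expect_const_mul]
  have h2 := expect_prod (w := w) (fun _ => ENNReal.ofReal (1 / 2)) (fun _ => ENNReal.ofReal 1)
  have h3 : ∀ e, ENNReal.ofReal (w e) * ENNReal.ofReal (1 / 2)
      + ENNReal.ofReal (1 - w e) * ENNReal.ofReal 1 ≤ ENNReal.ofReal (Real.exp (-(q / 2))) := by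
    intro e
    have := hw e
    rw [← ENNReal.ofReal_mul this.1, ← ENNReal.ofReal_mul (by linarith),
      ← ENNReal.ofReal_add (by linarith) (by linarith)]
    refine ENNReal.ofReal_le_ofReal ?_
    have h4 := Real.add_one_le_exp (-(q / 2))
    linarith [hqw e]
  have h4 : (pairs (Fin n)).card = n.choose 2 := by
    have h5 := Sym2.card_subtype_not_diag (α := Fin n)
    rw [Fintype.card_fin] at h5
    rw [← h5, Fintype.card_subtype]
    unfold pairs
    congr!
  have h5 : (n : ℝ) * (n / 2) / 2 ≤ n.choose 2 := by
    rw [Nat.cast_choose_two]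
    have : (2 : ℝ) ≤ n := by exact_mod_cast hn
    gcongr
    linarith
  calc _ ≤ ENNReal.ofReal (2 ^ n) * ENNReal.ofReal (Real.exp (-(q / 2))) ^ n.choose 2 := by
        gcongr
        refine le_trans (le_of_eq ?_) (h2.le.trans ?_)
        · congr!
        · rw [← h4, ← Finset.prod_const]
          exact Finset.prod_le_prod' fun e _ => h3 e
    _ = ENNReal.ofReal (2 ^ n * Real.exp (n.choose 2 * (-(q / 2)))) := by
        rw [← ENNReal.ofReal_pow (Real.exp_nonneg _), ← ENNReal.ofReal_mul (by positivity),
          Real.exp_nat_mul]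
    _ ≤ _ := by
        refine ENNReal.ofReal_le_ofReal ?_
        have h6 : (2 : ℝ) ^ n ≤ Real.exp n := by
          rw [← Real.exp_one_pow]
          gcongr
          linarith [Real.exp_one_gt_d9]
        calc _ ≤ Real.exp n * Real.exp (n.choose 2 * (-(q / 2))) := by gcongr
          _ = Real.exp (n + n.choose 2 * (-(q / 2))) := by rw [Real.exp_add]
          _ ≤ _ := by
            refine Real.exp_le_exp.2 ?_
            have hq : 0 ≤ q := by
              by_contra hcon
              have : (0 : ℝ) ≤ n := Nat.cast_nonneg n
              nlinarith
            have h7 : (n : ℝ) * (n / 2) / 2 * q ≤ n.choose 2 * q := by gcongr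
            have h8 : (n : ℝ) * 16 ≤ n * (n * q) := by gcongr
            nlinarith

theorem IsPlantedDenseSubgraph.measureReal_ncard_lt_le [IsProbabilityMeasure μ]
    (h : IsPlantedDenseSubgraph μ p q Cs G) (hq : 0 ≤ q) (hqp : q ≤ p) (hp : p ≤ 1)
    (hn : 2 ≤ n) (hnq : 16 ≤ n * q) :
    μ.real {ω | (G ω).edgeSet.ncard < n} ≤ Real.exp (-n) := by
  classical
  have hmeas : ∀ A : SimpleGraph (Fin n) → Prop, MeasurableSet {ω | A (G ω)} := by
    intro A
    have : {ω | A (G ω)} = ⋃ H ∈ {H | A H}, {ω | G ω = H} := by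
      ext ω
      simp
    rw [this]
    exact MeasurableSet.biUnion (Set.to_countable _) fun H _ => h.measurable_graph H
  refine ENNReal.toReal_le_of_le_ofReal (Real.exp_nonneg _) ?_
  have h1 : μ {ω | (G ω).edgeSet.ncard < n}
      = ∫⁻ ω, (fun (_ : Finset (Fin n)) (H : SimpleGraph (Fin n)) =>
        if H.edgeSet.ncard < n then (1 : ℝ≥0∞) else 0) (Cs ω) (G ω) ∂μ := by
    rw [← one_mul (μ _), ← lintegral_indicator_const (hmeas fun H => H.edgeSet.ncard < n)]
    refine lintegral_congr fun ω => ?_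
    simp only [Set.indicator_apply, Set.mem_ofPred_eq]
  have h2 := h.lintegral_eq hq hqp hp (fun _ _ => 1)
  rw [lintegral_one, measure_univ] at h2
  rw [h1, h.lintegral_eq hq hqp hp fun _ H => if H.edgeSet.ncard < n then (1 : ℝ≥0∞) else 0]
  calc _ ≤ ∑ C, μ {ω | Cs ω = C} * expect (edgeProb p q C) (fun _ => 1)
        * ENNReal.ofReal (Real.exp (-n)) := by
        refine Finset.sum_le_sum fun C _ => ?_
        rw [expect_one (edgeProb_mem_unit hq hqp hp C), mul_one]
        gcongr
        refine le_trans (le_of_eq ?_) (prob_ncard_edgeSet_lt_le (edgeProb_mem_unit hq hqp hp C)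
          (le_edgeProb hqp C) hn hnq)
        unfold prob
        congr!
    _ = _ := by rw [← Finset.sum_mul, ← h2, one_mul]

end Model

/-! ### Subpolynomial growth -/

section Subpolynomial

/-- `f n ≤ n^{o(1)}`. -/
def IsSubpoly (f : ℕ → ℝ) : Prop := ∀ η : ℝ, 0 < η → ∀ᶠ n : ℕ in atTop, f n ≤ (n : ℝ) ^ η

variable {f g : ℕ → ℝ}

theorem IsSubpoly.mono (hg : IsSubpoly g) (h : ∀ᶠ n in atTop, f n ≤ g n) : IsSubpoly f :=
  fun η hη => by
    filter_upwards [hg η hη, h] with n h1 h2 using h2.trans h1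

theorem IsSubpoly.mul (hf : IsSubpoly f) (hg : IsSubpoly g) (h : ∀ᶠ n in atTop, 0 ≤ g n) :
    IsSubpoly fun n => f n * g n := fun η hη => by
  filter_upwards [hf (η / 2) (by linarith), hg (η / 2) (by linarith), h, eventually_gt_atTop 0]
    with n h1 h2 h3 hn
  have hn' : (0 : ℝ) < n := by exact_mod_cast hn
  calc f n * g n ≤ (n : ℝ) ^ (η / 2) * (n : ℝ) ^ (η / 2) := by gcongr
    _ = (n : ℝ) ^ η := by rw [← Real.rpow_add hn', add_halves]

theorem isSubpoly_const (c : ℝ) : IsSubpoly fun _ => c := fun _ hη =>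
  ((tendsto_rpow_atTop hη).comp tendsto_natCast_atTop_atTop).eventually_ge_atTop c

theorem IsSubpoly.add (hf : IsSubpoly f) (hg : IsSubpoly g) : IsSubpoly fun n => f n + g n :=
  fun η hη => by
    filter_upwards [hf (η / 2) (by linarith), hg (η / 2) (by linarith),
      isSubpoly_const 2 (η / 2) (by linarith), eventually_gt_atTop 0] with n h1 h2 h3 hn
    have hn' : (0 : ℝ) < n := by exact_mod_cast hn
    calc f n + g n ≤ 2 * (n : ℝ) ^ (η / 2) := by linarith
      _ ≤ (n : ℝ) ^ (η / 2) * (n : ℝ) ^ (η / 2) := by gcongr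
      _ = (n : ℝ) ^ η := by rw [← Real.rpow_add hn', add_halves]

theorem IsSubpoly.pow (hf : IsSubpoly f) (h : ∀ᶠ n in atTop, 0 ≤ f n) (k : ℕ) :
    IsSubpoly fun n => f n ^ k := by
  induction k with
  | zero => simpa using isSubpoly_const 1
  | succ k ih =>
    simp only [pow_succ]
    exact ih.mul hf h

theorem isSubpoly_log : IsSubpoly fun n => Real.log n := fun η hη => by
  have h := ((isLittleO_log_rpow_atTop hη).comp_tendsto tendsto_natCast_atTop_atTop).bound
    one_pos
  filter_upwards [h] with n hn
  simp only [Function.comp_apply, one_mul, Real.norm_eq_abs] at hn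
  rw [abs_of_nonneg (Real.rpow_nonneg (Nat.cast_nonneg n) η)] at hn
  exact (le_abs_self _).trans hn

theorem isSubpoly_rpow {ε : ℕ → ℝ} (h : Tendsto ε atTop (𝓝 0)) :
    IsSubpoly fun n => (n : ℝ) ^ ε n := fun η hη => by
  filter_upwards [h.eventually_le_const hη, eventually_ge_atTop 1] with n h1 hn
  exact Real.rpow_le_rpow_of_exponent_le (by exact_mod_cast hn) h1

theorem IsSubpoly.exists_exponent (hf : IsSubpoly f) :
    ∃ ε : ℕ → ℝ, Tendsto ε atTop (𝓝 0) ∧ ∀ᶠ n : ℕ in atTop, f n ≤ (n : ℝ) ^ ε n := by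
  have hg : IsSubpoly fun n => max (f n) 1 := by
    intro η hη
    filter_upwards [hf η hη, eventually_ge_atTop 1] with n h1 hn
    exact max_le h1 (Real.one_le_rpow (by exact_mod_cast hn) hη.le)
  -- The maximum with 1 keeps the exponent nonnegative, so that upper bounds alone give convergence
  -- to 0.
  refine ⟨fun n => Real.log (max (f n) 1) / Real.log n, ?_, ?_⟩
  · rw [Metric.tendsto_nhds]
    intro η hη
    filter_upwards [hg (η / 2) (by linarith), eventually_ge_atTop 2] with n h1 hn
    have hn' : (1 : ℝ) < n := by exact_mod_cast hn
    have hlog := Real.log_pos hn'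
    have h2 : Real.log (max (f n) 1) ≤ η / 2 * Real.log n := by
      rw [← Real.log_rpow (by linarith)]
      exact Real.log_le_log (by positivity) h1
    rw [Real.dist_0_eq_abs, abs_of_nonneg (div_nonneg (Real.log_nonneg (le_max_right _ _)) hlog.le),
      div_lt_iff₀ hlog]
    nlinarith
  · filter_upwards [eventually_ge_atTop 2] with n hn
    have hn' : (1 : ℝ) < n := by exact_mod_cast hn
    have hlog := Real.log_pos hn'
    rw [Real.rpow_def_of_pos (by linarith), mul_div_cancel₀ _ hlog.ne', Real.exp_log (by positivity)]
    exact le_max_left _ _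

/-- The conclusions on an error that is at most `n^{s + o(1)} + 2 K e^{-ν r}`. -/
theorem error_conclusion {E ν : ℕ → ℝ} {K : ℕ → ℕ} {nuMin : ℝ → ℝ} {s : ℝ} (hs1 : s < 1)
    (hE0 : ∀ n, 0 ≤ E n) (hEn : ∀ n, E n ≤ n) (hg : IsSubpoly g)
    (h : ∀ᶠ n : ℕ in atTop, ∀ r, 0 < r → nuMin r ≤ ν n →
      E n ≤ (n : ℝ) ^ s * g n + 2 * K n * Real.exp (-(ν n * r)))
    (hν : Tendsto ν atTop atTop)
    (hK : ∃ ε : ℕ → ℝ, Tendsto ε atTop (𝓝 0) ∧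
      ∀ᶠ n : ℕ in atTop, (n : ℝ) ^ (1 - ε n) ≤ (K n : ℝ)) :
    (∃ ε : ℕ → ℝ, Tendsto ε atTop (𝓝 0) ∧ ∀ r : ℝ, 0 < r → ∀ n : ℕ, nuMin r ≤ ν n →
      E n ≤ (n : ℝ) ^ (s + ε n) + 2 * K n * Real.exp (-(ν n * r))) ∧
    E =o[atTop] (fun n => (K n : ℝ)) := by
  constructor
  · obtain ⟨ε, hε, hgε⟩ := hg.exists_exponent
    obtain ⟨N, hN⟩ := eventually_atTop.1 (h.and (hgε.and (eventually_gt_atTop 0)))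
    -- For the finitely many small n the exponent 1 - s gives the trivial bound n, so the estimate
    -- holds for all n, with one exponent sequence for all r.
    refine ⟨fun n => if N ≤ n then ε n else 1 - s, ?_, ?_⟩
    · refine hε.congr' ?_
      filter_upwards [eventually_ge_atTop N] with n hn
      rw [if_pos hn]
    · intro r hr n hn
      beta_reduce
      split_ifs with hNn
      · obtain ⟨h1, h2, h3⟩ := hN n hNn
        have h3' : (0 : ℝ) < n := by exact_mod_cast h3
        refine (h1 r hr hn).trans ?_
        rw [Real.rpow_add h3']
        gcongr
      · rw [add_sub_cancel, Real.rpow_one]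
        exact le_add_of_le_of_nonneg (hEn n) (by positivity)
  · obtain ⟨ε, hε, hKε⟩ := hK
    refine IsLittleO.of_bound fun c hc => ?_
    -- Then s + 2η ≤ 1 - η: one factor n^η absorbs `g`, the other the constant 2/c, and the result
    -- is still below K.
    set η := (1 - s) / 4
    have hη : 0 < η := by simp only [η]; linarith
    have h1 : ∀ᶠ n : ℕ in atTop, 2 / c ≤ (n : ℝ) ^ η := isSubpoly_const (2 / c) η hη
    have h2 : Tendsto (fun n => Real.exp (-(ν n * 1))) atTop (𝓝 0) := by
      simp only [mul_one]
      exact Real.tendsto_exp_neg_atTop_nhds_zero.comp hν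
    filter_upwards [h, h1, h2.eventually_le_const (show (0 : ℝ) < c / 4 by linarith), hg η hη,
      hKε, hε.eventually_le_const hη, hν.eventually_ge_atTop (nuMin 1), eventually_ge_atTop 1]
      with n e1 e2 e3 e4 e5 e6 e7 e8
    have hn1 : (1 : ℝ) ≤ n := by exact_mod_cast e8
    have hn : (0 : ℝ) < n := by linarith
    have e9 := e1 1 one_pos e7
    have e10 : (n : ℝ) ^ (1 - η) ≤ K n :=
      (Real.rpow_le_rpow_of_exponent_le hn1 (by linarith)).trans e5
    rw [Real.norm_of_nonneg (hE0 n), Real.norm_of_nonneg (Nat.cast_nonneg _)]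
    have e11 : (n : ℝ) ^ s * g n ≤ c / 2 * K n := by
      have e12 : (n : ℝ) ^ s * (n : ℝ) ^ η * (n : ℝ) ^ η ≤ (n : ℝ) ^ (1 - η) := by
        rw [← Real.rpow_add hn, ← Real.rpow_add hn]
        exact Real.rpow_le_rpow_of_exponent_le hn1 (by simp only [η]; linarith)
      have e13 : 0 ≤ (n : ℝ) ^ s := by positivity
      calc (n : ℝ) ^ s * g n ≤ (n : ℝ) ^ s * (n : ℝ) ^ η := by gcongr
        _ = c / 2 * ((n : ℝ) ^ s * (n : ℝ) ^ η * (2 / c)) := by field_simp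
        _ ≤ c / 2 * ((n : ℝ) ^ s * (n : ℝ) ^ η * (n : ℝ) ^ η) := by gcongr
        _ ≤ c / 2 * K n := by gcongr; exact e12.trans e10
    have e14 : (0 : ℝ) ≤ K n := Nat.cast_nonneg _
    nlinarith

end Subpolynomial

/-! ### The asymptotic regime -/

namespace SublinearRegime

variable {lam M : ℝ} {K : ℕ → ℕ} {p q : ℕ → ℝ}

theorem eventually_le_mul (h : SublinearRegime lam M K p q) {c : ℝ} (hc : 0 < c) :
    ∀ᶠ n : ℕ in atTop, (K n : ℝ) ≤ c * n := by
  filter_upwards [h.size_sublinear.bound hc] with n hn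
  simpa using hn

theorem eventually_rpow_le (h : SublinearRegime lam M K p q) {η : ℝ} (hη : 0 < η) :
    ∀ᶠ n : ℕ in atTop, (n : ℝ) ^ (1 - η) ≤ K n := by
  obtain ⟨ε, hε, hK⟩ := h.size_ge
  filter_upwards [hK, hε.eventually_le_const hη, eventually_ge_atTop 1] with n h1 h2 h3
  exact (Real.rpow_le_rpow_of_exponent_le (by exact_mod_cast h3) (by linarith)).trans h1

theorem eventually_size (h : SublinearRegime lam M K p q) :
    ∀ᶠ n : ℕ in atTop, 0 < K n ∧ K n < n := by
  filter_upwards [h.eventually_rpow_le (η := 1) one_pos,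
    h.eventually_le_mul (c := 1 / 2) (by norm_num), eventually_gt_atTop 0] with n h1 h2 h3
  have h3' : (0 : ℝ) < n := by exact_mod_cast h3
  simp only [sub_self, Real.rpow_zero] at h1
  refine ⟨by exact_mod_cast (zero_lt_one.trans_le h1), ?_⟩
  have : (K n : ℝ) < n := by linarith
  exact_mod_cast this

/-- If q were 0, division by zero would make the signal to noise ratio 0. -/
theorem eventually_pos (h : SublinearRegime lam M K p q) (hlam : 0 < lam) :
    ∀ᶠ n : ℕ in atTop, 0 < q n := by
  filter_upwards [h.snr_eq] with n hn
  refine lt_of_le_of_ne (h.probabilities n).1 fun h0 => ?_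
  rw [snr, ← h0, mul_zero, div_zero] at hn
  linarith

theorem tendsto_nu (h : SublinearRegime lam M K p q) :
    Tendsto (fun n => nu n (K n)) atTop atTop := by
  rw [tendsto_atTop]
  intro b
  have hb : 0 < Real.exp b := Real.exp_pos b
  filter_upwards [h.eventually_le_mul (c := 1 / (Real.exp b + 1)) (by positivity),
    h.eventually_size] with n h1 h2
  have h3 : (0 : ℝ) < K n := by exact_mod_cast h2.1
  rw [nu, ← Real.log_exp b]
  refine Real.log_le_log hb ?_
  rw [le_div_iff₀ h3]
  rw [one_div, inv_mul_eq_div, le_div_iff₀ (by positivity)] at h1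
  linarith

/-- From λ (n - K) q = K² (p - q)² ≤ K² (M - 1)² q² and K = o(n), the product n q must diverge. -/
theorem tendsto_mul (h : SublinearRegime lam M K p q) (hlam : 0 < lam) :
    Tendsto (fun n : ℕ => n * q n) atTop atTop := by
  rw [tendsto_atTop]
  intro b'
  set b := max b' 1
  have hb : 0 < b := lt_of_lt_of_le one_pos (le_max_right _ _)
  -- The summand 1 keeps A positive when M = 1.
  set A := 2 * ((M - 1) ^ 2 + 1) * b
  have hA : 0 < A := by positivity
  set c := min (1 / 2) (√(lam / A))
  have hc : 0 < c := lt_min (by norm_num) (Real.sqrt_pos.2 (by positivity))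
  have hc2 : c ^ 2 * A ≤ lam := by
    have h1 : c ^ 2 ≤ lam / A := by
      rw [← Real.sq_sqrt (show 0 ≤ lam / A by positivity)]
      gcongr
      exact min_le_right _ _
    rwa [le_div_iff₀ hA] at h1
  filter_upwards [h.eventually_le_mul hc, h.eventually_size, h.eventually_pos hlam, h.snr_eq,
    h.ratio_le] with n h1 h2 h3 h4 h5
  have hK : (0 : ℝ) < K n := by exact_mod_cast h2.1
  have hKn : (0 : ℝ) < n - K n := by
    rw [sub_pos]; exact_mod_cast h2.2
  have hn : (0 : ℝ) < n := by linarith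
  rw [snr, div_eq_iff (by positivity)] at h4
  have h6 : (p n - q n) ^ 2 ≤ ((M - 1) * q n) ^ 2 := by
    have := (h.probabilities n).2.1
    gcongr
    linarith
  have h7 : lam * (n / 2) * q n ≤ (c * n) ^ 2 * ((M - 1) * q n) ^ 2 := by
    calc lam * (n / 2) * q n ≤ lam * (n - K n) * q n := by
          gcongr
          have : c * n ≤ 1 / 2 * n := by
            gcongr
            exact min_le_left _ _
          linarith
      _ = K n ^ 2 * (p n - q n) ^ 2 := by rw [h4]; ring
      _ ≤ _ := by gcongr
  have h8 : lam ≤ 2 * c ^ 2 * (M - 1) ^ 2 * (n * q n) := by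
    have h9 : (n * q n) * lam ≤ (n * q n) * (2 * c ^ 2 * (M - 1) ^ 2 * (n * q n)) := by
      nlinarith
    exact le_of_mul_le_mul_left h9 (by positivity)
  by_contra! hcon
  have h10 : n * q n < b := hcon.trans_le (le_max_left _ _)
  have h11 : 2 * c ^ 2 * (M - 1) ^ 2 * (n * q n) ≤ 2 * c ^ 2 * ((M - 1) ^ 2 + 1) * (n * q n) := by
    gcongr
    linarith
  have h12 : 2 * c ^ 2 * ((M - 1) ^ 2 + 1) * (n * q n) < 2 * c ^ 2 * ((M - 1) ^ 2 + 1) * b := by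
    gcongr
  have h13 : 2 * c ^ 2 * ((M - 1) ^ 2 + 1) * b = c ^ 2 * A := by simp only [A]; ring
  linarith

theorem tendsto_mul_p (h : SublinearRegime lam M K p q) (hlam : 0 < lam) :
    Tendsto (fun n : ℕ => n * p n) atTop atTop :=
  tendsto_atTop_mono (fun n => mul_le_mul_of_nonneg_left (h.probabilities n).2.1
    (Nat.cast_nonneg n)) (h.tendsto_mul hlam)

end SublinearRegime

/-- A bound for the growth of the neighborhoods that are explored. -/
def growth (t0 : ℕ) (K : ℕ → ℕ) (p : ℕ → ℝ) (n : ℕ) : ℝ :=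
  4 * (iterations t0 n (K n)) ^ 2 * (1 + n * p n) ^ (2 * iterations t0 n (K n))

/-- Let x = np and Y = x^{log* ν}. For large n, x ≥ 2 and log* ν ≥ 1, hence x ≤ Y and log* ν ≤
2^{log* ν} ≤ Y. Everything is thus at most a fixed power of Y = n^{o(1)}. -/
theorem SublinearRegime.isSubpoly_growth {lam M : ℝ} {K : ℕ → ℕ} {p q : ℕ → ℝ}
    (h : SublinearRegime lam M K p q) (hlam : 0 < lam)
    (hY : EqNPowLittleO (fun n => ((n : ℝ) * p n) ^ logStar (nu n (K n)))) (t0 : ℕ) :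
    IsSubpoly (growth t0 K p) := by
  have hY' : IsSubpoly fun n => ((n : ℝ) * p n) ^ logStar (nu n (K n)) := by
    obtain ⟨ε, hε, h1⟩ := hY
    exact (isSubpoly_rpow hε).mono (h1.mono fun n hn => hn.le)
  have hnp : ∀ n : ℕ, 0 ≤ n * p n := fun n => mul_nonneg (Nat.cast_nonneg n)
    ((h.probabilities n).1.trans (h.probabilities n).2.1)
  refine (hY'.pow (Eventually.of_forall fun n => pow_nonneg (hnp n) _) (4 * t0 + 15)).mono ?_
  filter_upwards [h.tendsto_nu.eventually_gt_atTop 1,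
    (h.tendsto_mul_p hlam).eventually_ge_atTop (max 2 (4 * (t0 + 3) ^ 2))] with n h1 h2
  set x := (n : ℝ) * p n
  set m := logStar (nu n (K n))
  have hm : 1 ≤ m := by
    simp only [m]
    rw [logStar_of_one_lt h1]
    omega
  have hx2 : 2 ≤ x := (le_max_left _ _).trans h2
  have hx4 : 4 * ((t0 : ℝ) + 3) ^ 2 ≤ x := (le_max_right _ _).trans h2
  set Y := x ^ m
  have hxY : x ≤ Y := le_self_pow₀ (by linarith) (by omega)
  have hY1 : 1 ≤ Y := by linarith
  have hmY : (m : ℝ) ≤ Y := by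
    have e1 : (m : ℝ) ≤ 2 ^ m := by exact_mod_cast Nat.lt_two_pow_self.le
    exact e1.trans (pow_le_pow_left₀ (by norm_num) hx2 m)
  have ht : (iterations t0 n (K n) : ℝ) ≤ (t0 + 3) * Y := by
    rw [iterations]
    push_cast
    have : (t0 + 2 : ℝ) ≤ (t0 + 2) * Y := le_mul_of_one_le_right (by positivity) hY1
    linarith
  have hpow : (1 + x) ^ (2 * iterations t0 n (K n)) ≤ Y ^ (4 * t0 + 12) := by
    calc (1 + x) ^ (2 * iterations t0 n (K n)) ≤ (x ^ 2) ^ (2 * iterations t0 n (K n)) := by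
          gcongr
          nlinarith
      _ = x ^ (4 * t0 + 8) * Y ^ 4 := by
          rw [← pow_mul, ← pow_mul, ← pow_add, iterations]
          congr 1
          simp only [m]
          ring
      _ ≤ Y ^ (4 * t0 + 8) * Y ^ 4 := by gcongr
      _ = _ := by rw [← pow_add]
  calc growth t0 K p n
      ≤ 4 * ((t0 + 3) * Y) ^ 2 * Y ^ (4 * t0 + 12) := by
        unfold growth
        gcongr
    _ = (4 * (t0 + 3) ^ 2) * (Y ^ 2 * Y ^ (4 * t0 + 12)) := by ring
    _ ≤ Y * (Y ^ 2 * Y ^ (4 * t0 + 12)) := by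
        gcongr
        linarith
    _ = Y ^ (4 * t0 + 15) := by ring

/-! ### Choice of the bound for the size of the levels -/

namespace Params

variable (P : Params) {t : ℕ} {W G : ℝ}

/-- With D = 0 and L² = n / W, the domination exponent is of order t² n p / W ≤ 1, while n / L² = W
keeps the expected number of exceptional vertices subpolynomial. -/
theorem exceptional_le_of_size_eq (ht : 2 ≤ t)
    (hW : W = 4 * t ^ 2 * (1 + P.n * P.p) ^ (2 * t)) (hWn : W ≤ P.n) :
    1 ≤ √(P.n / W) ∧ P.p * (1 + 0 + t * √(P.n / W) + √(P.n / W)) * √(P.n / W) * t ≤ 1 ∧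
      P.n * P.exceptional 0 (√(P.n / W)) t ≤ W ^ 2 * (1 + W) := by
  have hp := P.p_pos
  have hn : (0 : ℝ) < P.n := by
    have := P.K_pos.trans P.K_lt
    exact_mod_cast this
  have ht' : (2 : ℝ) ≤ t := by exact_mod_cast ht
  set a := 1 + P.n * P.p with ha
  have ha1 : 1 ≤ a := by
    have := mul_pos hn hp
    linarith
  have hapow : a ≤ a ^ (2 * t) := le_self_pow₀ ha1 (by omega)
  have hapow2 : a ^ 2 ≤ a ^ (2 * t) := pow_le_pow_right₀ ha1 (by omega)
  have hW0 : 0 < W := by rw [hW]; positivity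
  have hWt : t * a ^ (2 * t) ≤ W := by
    rw [hW]
    gcongr
    nlinarith
  have hWa : a ^ 2 ≤ W := by
    rw [hW]
    nlinarith [pow_pos (by linarith : 0 < a) (2 * t)]
  have hL2 : √(P.n / W) ^ 2 = P.n / W := Real.sq_sqrt (by positivity)
  have hL : 1 ≤ √(P.n / W) := by
    rw [Real.one_le_sqrt, one_le_div hW0]
    exact hWn
  set L := √(P.n / W)
  refine ⟨hL, ?_, ?_⟩
  · calc P.p * (1 + 0 + t * L + L) * L * t ≤ P.p * (2 * t * L) * L * t := by
          gcongr
          nlinarith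
      _ = 2 * t ^ 2 * P.p * L ^ 2 := by ring
      _ = 2 * t ^ 2 * (P.n * P.p) / W := by rw [hL2]; ring
      _ ≤ 1 := by
          rw [div_le_one hW0, hW]
          have : P.n * P.p ≤ a ^ (2 * t) := by linarith
          nlinarith [mul_nonneg (sq_nonneg (t : ℝ)) (pow_pos (by linarith : 0 < a) (2 * t)).le,
            mul_le_mul_of_nonneg_left this (sq_nonneg (t : ℝ))]
  · have e1 : P.n * P.exceptional 0 L t = t * a ^ (2 * t) *
        ((P.n * P.p) ^ 2 + P.n * P.p + ((P.n * P.p) ^ 2 + P.n * P.p) * W) := by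
      rw [exceptional, hL2]
      field_simp
      ring
    have e2 : (P.n * P.p) ^ 2 + P.n * P.p ≤ W := by
      refine le_trans ?_ hWa
      rw [ha]
      nlinarith [mul_pos hn hp]
    rw [e1]
    calc _ ≤ W * (W + W * W) := by gcongr
      _ = _ := by ring

/-- Here L = x = n^{1/4}. Since D is at most √n up to G, the exponent is of order p D L t, which is
n^{-1/4} up to subpolynomial factors, and n / L² = √n gives the order of the number of exceptional
vertices. -/
theorem exceptional_le_of_size_near {x D : ℝ} (ht : 2 ≤ t) (hx : 1 ≤ x) (hx4 : x ^ 4 = P.n)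
    (hG : 0 ≤ G) (hD : 0 ≤ D) (hDG : D ≤ x ^ 2 * G)
    (hW : W = 4 * t ^ 2 * (1 + P.n * P.p) ^ (2 * t)) (hWx : W * (3 + G) ≤ x) :
    P.p * (1 + D + t * x + x) * x * t ≤ 1 ∧
      P.n * P.exceptional D x t ≤ x ^ 2 * (W ^ 2 * (3 + G)) := by
  have hp := P.p_pos
  have hn : (0 : ℝ) < P.n := by
    have := P.K_pos.trans P.K_lt
    exact_mod_cast this
  have ht' : (2 : ℝ) ≤ t := by exact_mod_cast ht
  have hx0 : 0 < x := by linarith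
  set a := 1 + P.n * P.p with ha
  have hnp := mul_pos hn hp
  have ha1 : 1 ≤ a := by linarith
  have hapow : a ≤ a ^ (2 * t) := le_self_pow₀ ha1 (by omega)
  have hapow2 : a ^ 2 ≤ a ^ (2 * t) := pow_le_pow_right₀ ha1 (by omega)
  have hW0 : 0 < W := by rw [hW]; positivity
  have hWt : t * a ^ (2 * t) ≤ W := by
    rw [hW]
    gcongr
    nlinarith
  have hWa : a ^ 2 ≤ W := by
    rw [hW]
    nlinarith [pow_pos (by linarith : 0 < a) (2 * t)]
  have hWta : t ^ 2 * a ≤ W := by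
    rw [hW]
    nlinarith [mul_le_mul_of_nonneg_left hapow (sq_nonneg (t : ℝ)),
      mul_nonneg (sq_nonneg (t : ℝ)) (pow_pos (by linarith : 0 < a) (2 * t)).le]
  have hxx : x ≤ x ^ 2 := by nlinarith
  have hx1 : 1 ≤ x ^ 2 := by nlinarith
  constructor
  · have e1 : 1 + D + t * x + x ≤ x ^ 2 * (t * (3 + G)) := by
      have e2 : G ≤ t * G := le_mul_of_one_le_left hG (by linarith)
      have e3 : x ^ 2 * G ≤ x ^ 2 * (t * G) := by gcongr
      have e4 : t * x ≤ t * x ^ 2 := by gcongr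
      have e5 : 2 * x ^ 2 ≤ t * x ^ 2 := by gcongr
      nlinarith
    have e6 : P.p * (1 + D + t * x + x) * x * t ≤ P.p * (x ^ 2 * (t * (3 + G))) * x * t := by
      gcongr
    have e7 : x * (P.p * (x ^ 2 * (t * (3 + G))) * x * t) ≤ x * 1 := by
      calc _ = (P.n * P.p) * t ^ 2 * (3 + G) := by rw [← hx4]; ring
        _ ≤ W * (3 + G) := by
          gcongr
          nlinarith [sq_nonneg (t : ℝ)]
        _ ≤ x * 1 := by linarith
    exact e6.trans (le_of_mul_le_mul_left e7 hx0)
  · have e1 : P.n * P.exceptional D x t = t * a ^ (2 * t) *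
        ((P.n * P.p) ^ 2 + (1 + D) * (P.n * P.p) + ((P.n * P.p) ^ 2 + P.n * P.p) * x ^ 2) := by
      have e2 : (P.n : ℝ) / x ^ 2 = x ^ 2 := by
        rw [← hx4]
        field_simp
      rw [exceptional]
      calc _ = t * a ^ (2 * t) * ((P.n * P.p) ^ 2 + (1 + D) * (P.n * P.p)
            + ((P.n * P.p) ^ 2 + P.n * P.p) * (P.n / x ^ 2)) := by ring
        _ = _ := by rw [e2]
    have e2 : (P.n * P.p) ^ 2 + P.n * P.p ≤ W := by
      refine le_trans ?_ hWa
      rw [ha]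
      nlinarith
    have e3 : (P.n * P.p) ^ 2 ≤ W * x ^ 2 := by nlinarith
    have e4 : P.n * P.p ≤ W := by nlinarith
    have e5 : (1 + D) * (P.n * P.p) ≤ x ^ 2 * (1 + G) * W := by
      gcongr
      nlinarith
    rw [e1]
    calc _ ≤ W * (W * x ^ 2 + x ^ 2 * (1 + G) * W + W * x ^ 2) := by gcongr
      _ = _ := by ring

end Params

/-! ### Error bounds and running time in the asymptotic regime -/

section Recovery

variable {lam M : ℝ} {K : ℕ → ℕ} {p q : ℕ → ℝ} {t0 : ℕ} {nuMin : ℝ → ℝ}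
  {Ω : ℕ → Type*} [∀ n, MeasurableSpace (Ω n)] {P : ∀ n, Measure (Ω n)}
  [∀ n, IsProbabilityMeasure (P n)] {Cs Chat : ∀ n, Ω n → Finset (Fin n)}
  {G : ∀ n, Ω n → SimpleGraph (Fin n)}

theorem two_le_iterations (t0 n K : ℕ) : 2 ≤ iterations t0 n K := by
  unfold iterations
  omega

theorem SublinearRegime.eventually_expectedError_le_of_size_eq
    (h : SublinearRegime lam M K p q) (hlam : 0 < lam)
    (hY : EqNPowLittleO (fun n => ((n : ℝ) * p n) ^ logStar (nu n (K n))))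
    (hcoef : ∀ r, ∀ Q : Params, Q.lam = lam → Q.p ≤ M * Q.q → nuMin r ≤ Q.ν → 5 ≤ Q.ν ∧
      avg (Q.law (iterations t0 Q.n Q.K) false) (fun x => ENNReal.ofReal (Real.exp (1 / 2 * x)))
        ≤ ENNReal.ofReal (Real.exp (-((r + 1) * Q.ν))))
    (hmodel : ∀ n, IsPlantedDenseSubgraph (P n) (p n) (q n) (Cs n) (G n))
    (hChat : ∀ᶠ n in atTop, ∀ᵐ ω ∂P n,
      IsTopSet (belief (G n ω) (K n) (p n) (q n) (iterations t0 n (K n))) (K n) (Chat n ω))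
    (hsize : ∀ᶠ n in atTop, ∀ᵐ ω ∂P n, (Cs n ω).card = K n) :
    ∀ᶠ n : ℕ in atTop, ∀ r, 0 < r → nuMin r ≤ nu n (K n) →
      expectedError (P n) (Cs n) (Chat n)
        ≤ (n : ℝ) ^ (0 : ℝ) * (2 * (growth t0 K p n ^ 2 * (1 + growth t0 K p n)))
          + 2 * K n * Real.exp (-(nu n (K n) * r)) := by
  filter_upwards [hChat, hsize, h.eventually_size, h.eventually_pos hlam, h.snr_eq, h.ratio_le,
    h.isSubpoly_growth hlam hY t0 1 one_pos] with n h1 h2 h3 h4 h5 h6 h7 r hr hν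
  rw [Real.rpow_one] at h7
  let Q : Params := ⟨n, K n, p n, q n, h3.1, h3.2, h4, (h.probabilities n).2.1⟩
  obtain ⟨hν5, hc⟩ := hcoef r Q h5 h6 hν
  have ht := two_le_iterations t0 n (K n)
  obtain ⟨e1, e2, e3⟩ := Q.exceptional_le_of_size_eq (W := growth t0 K p n) ht rfl h7
  have key := Q.expectedError_le (D := 0) (hmodel n) h1 (h.probabilities n).2.2 e1
    (by omega) e2 le_rfl (Nat.cast_nonneg _) hν5 hc
  have h8 : (P n).real {ω | 0 < |((Cs n ω).card : ℝ) - K n|} = 0 := by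
    rw [measureReal_eq_zero_iff, ← compl_compl {ω | _}]
    refine measure_mono_null ?_ h2
    intro ω hω hω'
    rw [Set.mem_compl_iff, Set.mem_compl_iff, not_not] at hω
    have h9 : (Cs n ω).card = K n := hω'
    have h10 : 0 < |((Cs n ω).card : ℝ) - K n| := hω
    rw [h9, sub_self, abs_zero] at h10
    exact lt_irrefl _ h10
  have h9 : expectedError (P n) (Cs n) (Chat n) ≤ n * (P n).real
      {ω | 0 < |((Cs n ω).card : ℝ) - K n|} + (0 + 2 * (n * Q.exceptional 0
        (√(Q.n / growth t0 K p n)) (iterations t0 n (K n))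
        + K n * Real.exp (-(nu n (K n) * r)))) := key
  rw [h8] at h9
  have e4 : n * Q.exceptional 0 (√(Q.n / growth t0 K p n)) (iterations t0 n (K n))
    ≤ growth t0 K p n ^ 2 * (1 + growth t0 K p n) := e3
  rw [Real.rpow_zero]
  linarith

/-- Three contributions of order n^{1/2+o(1)}: n times the probability of a bad size, the deviation
D ≤ √n (1 + 3 log n), and the exceptional neighborhoods. -/
theorem SublinearRegime.eventually_expectedError_le_of_size_near
    (h : SublinearRegime lam M K p q) (hlam : 0 < lam)
    (hY : EqNPowLittleO (fun n => ((n : ℝ) * p n) ^ logStar (nu n (K n))))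
    (hcoef : ∀ r, ∀ Q : Params, Q.lam = lam → Q.p ≤ M * Q.q → nuMin r ≤ Q.ν → 5 ≤ Q.ν ∧
      avg (Q.law (iterations t0 Q.n Q.K) false) (fun x => ENNReal.ofReal (Real.exp (1 / 2 * x)))
        ≤ ENNReal.ofReal (Real.exp (-((r + 1) * Q.ν))))
    (hmodel : ∀ n, IsPlantedDenseSubgraph (P n) (p n) (q n) (Cs n) (G n))
    (hChat : ∀ᶠ n in atTop, ∀ᵐ ω ∂P n,
      IsTopSet (belief (G n ω) (K n) (p n) (q n) (iterations t0 n (K n))) (K n) (Chat n ω))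
    {δ : ℕ → ℝ} (hsize : ∀ᶠ n : ℕ in atTop,
      (P n).real {ω | √(3 * K n * Real.log n) ≤ |((Cs n ω).card : ℝ) - K n|}
        ≤ (n : ℝ) ^ (-(1 / 2) + δ n)) :
    ∀ᶠ n : ℕ in atTop, ∀ r, 0 < r → nuMin r ≤ nu n (K n) →
      expectedError (P n) (Cs n) (Chat n)
        ≤ (n : ℝ) ^ (1 / 2 : ℝ) * ((n : ℝ) ^ δ n + (1 + 3 * Real.log n
            + 2 * (growth t0 K p n ^ 2 * (3 + (1 + 3 * Real.log n)))))
          + 2 * K n * Real.exp (-(nu n (K n) * r)) := by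
  have hgrow := h.isSubpoly_growth hlam hY t0
  have hG : IsSubpoly fun n => 3 + (1 + 3 * Real.log n) :=
    (isSubpoly_const 3).add ((isSubpoly_const 1).add ((isSubpoly_const 3).mul isSubpoly_log
      (Eventually.of_forall fun n => Real.log_natCast_nonneg n)))
  have hGn : ∀ n : ℕ, 0 ≤ 1 + 3 * Real.log n := fun n => by
    have := Real.log_natCast_nonneg n
    linarith
  filter_upwards [hChat, hsize, h.eventually_size, h.eventually_pos hlam, h.snr_eq, h.ratio_le,
    hgrow.mul hG (Eventually.of_forall fun n => by linarith [hGn n]) (1 / 4) (by norm_num),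
    h.eventually_rpow_le (η := 1 / 2) (by norm_num), ((isSubpoly_const 3).mul isSubpoly_log
      (Eventually.of_forall fun n => Real.log_natCast_nonneg n)) (1 / 2) (by norm_num)]
    with n h1 h2 h3 h4 h5 h6 h7 h8 h9 r hr hν
  let Q : Params := ⟨n, K n, p n, q n, h3.1, h3.2, h4, (h.probabilities n).2.1⟩
  obtain ⟨hν5, hc⟩ := hcoef r Q h5 h6 hν
  have ht := two_le_iterations t0 n (K n)
  have hn1 : (1 : ℝ) ≤ n := by exact_mod_cast (by omega : 1 ≤ n)
  have hn : (0 : ℝ) < n := by linarith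
  have hlog := Real.log_natCast_nonneg n
  have hK0 : (0 : ℝ) < K n := by exact_mod_cast h3.1
  have hKn : (K n : ℝ) ≤ n := by exact_mod_cast h3.2.le
  set x := (n : ℝ) ^ (1 / 4 : ℝ) with hx
  have hx1 : 1 ≤ x := Real.one_le_rpow hn1 (by norm_num)
  have hx2 : x ^ 2 = (n : ℝ) ^ (1 / 2 : ℝ) := by
    rw [hx, ← Real.rpow_natCast, ← Real.rpow_mul hn.le]
    norm_num
  have hx4 : x ^ 4 = n := by
    rw [hx, ← Real.rpow_natCast, ← Real.rpow_mul hn.le]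
    norm_num
  set D := √(3 * K n * Real.log n) with hDdef
  have hD : 0 ≤ D := Real.sqrt_nonneg _
  have hDK : D ≤ K n := by
    rw [hDdef, Real.sqrt_le_left hK0.le]
    have e1 : 3 * Real.log n ≤ K n := by
      refine h9.trans (le_trans (le_of_eq ?_) h8)
      norm_num
    nlinarith
  have hDG : D ≤ x ^ 2 * (1 + 3 * Real.log n) := by
    refine (Real.sqrt_le_left (by positivity)).2 ?_
    have e1 : (x ^ 2 * (1 + 3 * Real.log n)) ^ 2 = n * (1 + 3 * Real.log n) ^ 2 := by
      rw [← hx4]; ring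
    rw [e1]
    have e2 : 3 * Real.log n ≤ (1 + 3 * Real.log n) ^ 2 := by nlinarith
    calc 3 * K n * Real.log n = K n * (3 * Real.log n) := by ring
      _ ≤ _ := by gcongr
  obtain ⟨e2, e3⟩ := Q.exceptional_le_of_size_near (W := growth t0 K p n) ht hx1 hx4 (hGn n) hD hDG
    rfl h7
  have key := Q.expectedError_le (D := D) (hmodel n) h1 (h.probabilities n).2.2 hx1
    (by omega) e2 hD hDK hν5 hc
  have h10 : (P n).real {ω | D < |((Cs n ω).card : ℝ) - K n|} ≤ (n : ℝ) ^ (-(1 / 2) + δ n) :=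
    le_trans (measureReal_mono fun ω (hω : D < _) => hω.le) h2
  have h11 : n * (P n).real {ω | D < |((Cs n ω).card : ℝ) - K n|}
      ≤ (n : ℝ) ^ (1 / 2 : ℝ) * (n : ℝ) ^ δ n := by
    calc _ ≤ (n : ℝ) * (n : ℝ) ^ (-(1 / 2) + δ n) := by gcongr
      _ = (n : ℝ) ^ (1 : ℝ) * (n : ℝ) ^ (-(1 / 2) + δ n) := by rw [Real.rpow_one]
      _ = _ := by
        rw [← Real.rpow_add hn, ← Real.rpow_add hn]
        congr 1
        ring
  have h12 : expectedError (P n) (Cs n) (Chat n) ≤ n * (P n).real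
      {ω | D < |((Cs n ω).card : ℝ) - K n|} + (D + 2 * (n * Q.exceptional D x
        (iterations t0 n (K n)) + K n * Real.exp (-(nu n (K n) * r)))) := key
  have e4 : n * Q.exceptional D x (iterations t0 n (K n))
    ≤ x ^ 2 * (growth t0 K p n ^ 2 * (3 + (1 + 3 * Real.log n))) := e3
  rw [← hx2] at h11 ⊢
  linarith

/-- With probability at least 1 - e^{-n} the graph has at least n edges, and then n + |E| ≤ 2|E|. -/
theorem SublinearRegime.tendsto_measureReal_time_le (h : SublinearRegime lam M K p q)
    (hlam : 0 < lam)
    (hmodel : ∀ n, IsPlantedDenseSubgraph (P n) (p n) (q n) (Cs n) (G n)) {c : ℕ} {T : ∀ n, SimpleGraph (Fin n) → ℕ}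
    (hT : ∀ n (H : SimpleGraph (Fin n)), 2 ≤ n → T n H ≤ c * (n + H.edgeSet.ncard) * logStar n) :
    Tendsto (fun n => (P n).real {ω | T n (G n ω) ≤ 2 * c * (G n ω).edgeSet.ncard * logStar n})
      atTop (𝓝 1) := by
  have h1 : Tendsto (fun n : ℕ => 1 - Real.exp (-(n : ℝ))) atTop (𝓝 (1 - 0)) :=
    tendsto_const_nhds.sub (Real.tendsto_exp_neg_atTop_nhds_zero.comp tendsto_natCast_atTop_atTop)
  rw [sub_zero] at h1
  refine tendsto_of_tendsto_of_tendsto_of_le_of_le' h1 tendsto_const_nhds ?_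
    (Eventually.of_forall fun n => measureReal_le_one)
  filter_upwards [eventually_ge_atTop 2, (h.tendsto_mul hlam).eventually_ge_atTop 16] with n hn hnq
  have h2 := (hmodel n).measureReal_ncard_lt_le (h.probabilities n).1 (h.probabilities n).2.1
    (h.probabilities n).2.2 hn hnq
  set A := {ω | T n (G n ω) ≤ 2 * c * (G n ω).edgeSet.ncard * logStar n}
  set B := {ω | (G n ω).edgeSet.ncard < n}
  have h3 : A ∪ B = Set.univ := by
    refine Set.eq_univ_of_forall fun ω => ?_
    by_cases hω : (G n ω).edgeSet.ncard < n
    · exact Or.inr hω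
    · refine Or.inl ((hT n (G n ω) hn).trans ?_)
      refine Nat.mul_le_mul_right _ ?_
      rw [mul_comm 2 c, mul_assoc]
      exact Nat.mul_le_mul_left _ (by omega)
  have h4 := measureReal_union_le (μ := P n) A B
  rw [h3, probReal_univ] at h4
  linarith

end Recovery

end HiddenCommunity

end

theorem theorem1 (lam : ℝ) (hlam : 1 / Real.exp 1 < lam) :
    ∃ t0 c : ℕ, ∀ M : ℝ, ∃ nuMin : ℝ → ℝ, ∀ (K : ℕ → ℕ) (p q : ℕ → ℝ),
      SublinearRegime lam M K p q →
      EqNPowLittleO (fun n => ((n : ℝ) * p n) ^ logStar (nu n (K n))) →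
      -- the program outputs the estimator of the algorithm
      (∀ (n : ℕ) (H : SimpleGraph (Fin n)), K n ≤ n →
        IsTopSet (belief H (K n) (p n) (q n) (iterations t0 n (K n))) (K n)
          (runBP H (K n) (p n) (q n) (iterations t0 n (K n))).val.toFinset) ∧
      -- running time on every graph
      (∀ (n : ℕ) (H : SimpleGraph (Fin n)), 2 ≤ n →
        (runBP H (K n) (p n) (q n) (iterations t0 n (K n))).time
          ≤ c * (n + H.edgeSet.ncard) * logStar n) ∧
      ∀ (Ω : ℕ → Type*) [∀ n, MeasurableSpace (Ω n)] (P : ∀ n, Measure (Ω n))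
        [∀ n, IsProbabilityMeasure (P n)]
        (Cs : ∀ n, Ω n → Finset (Fin n)) (G : ∀ n, Ω n → SimpleGraph (Fin n)),
        (∀ n, IsPlantedDenseSubgraph (P n) (p n) (q n) (Cs n) (G n)) →
        -- running time on the random graph
        Tendsto (fun n => (P n).real {ω |
          (runBP (G n ω) (K n) (p n) (q n) (iterations t0 n (K n))).time
            ≤ c * (G n ω).edgeSet.ncard * logStar n}) atTop (𝓝 1) ∧
        ∀ Chat : ∀ n, Ω n → Finset (Fin n),
          (∀ n S, MeasurableSet {ω | Chat n ω = S}) →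
          (∀ᶠ n in atTop, ∀ᵐ ω ∂P n,
            IsTopSet (belief (G n ω) (K n) (p n) (q n) (iterations t0 n (K n))) (K n)
              (Chat n ω)) →
          -- community of fixed size
          ((∀ᶠ n in atTop, ∀ᵐ ω ∂P n, (Cs n ω).card = K n) →
            (∃ ε : ℕ → ℝ, Tendsto ε atTop (𝓝 0) ∧
              ∀ r : ℝ, 0 < r → ∀ n : ℕ, nuMin r ≤ nu n (K n) →
                expectedError (P n) (Cs n) (Chat n)
                  ≤ (n : ℝ) ^ ε n + 2 * K n * Real.exp (-(nu n (K n) * r))) ∧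
            (fun n => expectedError (P n) (Cs n) (Chat n)) =o[atTop] (fun n => (K n : ℝ))) ∧
          -- community of random size
          ((∃ δ : ℕ → ℝ, Tendsto δ atTop (𝓝 0) ∧ ∀ᶠ n : ℕ in atTop,
              (P n).real {ω | √(3 * K n * Real.log n) ≤ |((Cs n ω).card : ℝ) - K n|}
                ≤ (n : ℝ) ^ (-(1 / 2) + δ n)) →
            (∃ ε : ℕ → ℝ, Tendsto ε atTop (𝓝 0) ∧
              ∀ r : ℝ, 0 < r → ∀ n : ℕ, nuMin r ≤ nu n (K n) →
                expectedError (P n) (Cs n) (Chat n)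
                  ≤ (n : ℝ) ^ (1 / 2 + ε n) + 2 * K n * Real.exp (-(nu n (K n) * r))) ∧
            (fun n => expectedError (P n) (Cs n) (Chat n)) =o[atTop] (fun n => (K n : ℝ))) := by
  have hlam0 : 0 < lam := lt_trans (by positivity) hlam
  obtain ⟨t0, ht0⟩ := exists_small_coefficient hlam
  obtain ⟨c, hc⟩ : ∃ c : ℕ, ∀ (n K : ℕ) (p q : ℝ) (H : SimpleGraph (Fin n)), 2 ≤ n →
      (runBP H K p q (iterations t0 n K)).time ≤ c * (n + H.edgeSet.ncard) * logStar n :=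
    ⟨_, fun n K p q H hn => runBP_time_le hn H K p q t0⟩
  refine ⟨t0, 2 * c, fun M => ?_⟩
  choose ν0 hν0 using ht0 M
  -- The shift to r + 1 and the bound 5 are what `expect_misclassified_le` uses to absorb e^{ν/2}
  -- and the constants.
  refine ⟨fun r => max 5 (ν0 (r + 1)), fun K p q hreg hY => ⟨fun n H hK =>
    runBP_isTopSet H _ _ _ _ (le_trans one_le_two (two_le_iterations _ _ _)) hK,
    fun n H hn => ?_, ?_⟩⟩
  · exact (hc n _ _ _ H hn).trans
      (Nat.mul_le_mul_right _ (Nat.mul_le_mul_right _ (by omega)))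
  intro Ω _ P _ Cs G hmodel
  have hcoef : ∀ r, ∀ Q : Params, Q.lam = lam → Q.p ≤ M * Q.q → max 5 (ν0 (r + 1)) ≤ Q.ν →
      5 ≤ Q.ν ∧ avg (Q.law (iterations t0 Q.n Q.K) false)
        (fun x => ENNReal.ofReal (Real.exp (1 / 2 * x)))
          ≤ ENNReal.ofReal (Real.exp (-((r + 1) * Q.ν))) := fun r Q h1 h2 h3 =>
    ⟨(le_max_left _ _).trans h3, hν0 (r + 1) Q h1 h2 ((le_max_right _ _).trans h3)⟩
  have hgrow := hreg.isSubpoly_growth hlam0 hY t0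
  have hpos : ∀ n, 0 ≤ growth t0 K p n := fun n => by
    have := (hreg.probabilities n).1.trans (hreg.probabilities n).2.1
    unfold growth
    positivity
  have hlog : IsSubpoly fun n => 1 + 3 * Real.log n :=
    (isSubpoly_const 1).add ((isSubpoly_const 3).mul isSubpoly_log
      (Eventually.of_forall fun n => Real.log_natCast_nonneg n))
  refine ⟨hreg.tendsto_measureReal_time_le hlam0 hmodel
    (T := fun n H => (runBP H (K n) (p n) (q n) (iterations t0 n (K n))).time)
    fun n H hn => hc n _ _ _ H hn, fun Chat _ hChat => ⟨fun hsize => ?_, ?_⟩⟩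
  · have hg : IsSubpoly fun n => 2 * (growth t0 K p n ^ 2 * (1 + growth t0 K p n)) :=
      (isSubpoly_const 2).mul ((hgrow.pow (Eventually.of_forall hpos) 2).mul
        ((isSubpoly_const 1).add hgrow) (Eventually.of_forall fun n => by linarith [hpos n]))
        (Eventually.of_forall fun n => by have := hpos n; positivity)
    have h := error_conclusion zero_lt_one (fun n => expectedError_nonneg)
      (fun n => expectedError_le_card) hg
      (hreg.eventually_expectedError_le_of_size_eq hlam0 hY hcoef hmodel hChat hsize)
      hreg.tendsto_nu hreg.size_ge
    simpa only [zero_add] using h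
  · rintro ⟨δ, hδ, hsize⟩
    have hg : IsSubpoly fun n => (n : ℝ) ^ δ n + (1 + 3 * Real.log n
        + 2 * (growth t0 K p n ^ 2 * (3 + (1 + 3 * Real.log n)))) :=
      (isSubpoly_rpow hδ).add (hlog.add ((isSubpoly_const 2).mul
        ((hgrow.pow (Eventually.of_forall hpos) 2).mul ((isSubpoly_const 3).add hlog)
          (Eventually.of_forall fun n => by
            have := Real.log_natCast_nonneg n
            positivity))
        (Eventually.of_forall fun n => by
          have := hpos n
          have := Real.log_natCast_nonneg n
          positivity)))
    exact error_conclusion (by norm_num) (fun n => expectedError_nonneg)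
      (fun n => expectedError_le_card) hg
      (hreg.eventually_expectedError_le_of_size_near hlam0 hY hcoef hmodel hChat hsize)
      hreg.tendsto_nu hreg.size_ge
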